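/- Let $G$ be a connected real reductive Lie group with Lie algebra $\mathfrak g$, Cartan involution $\theta$, $K=G^\theta$ its maximal compact subgroup, $\mathfrak g=\mathfrak p\oplus\mathfrak k$ the Cartan decomposition, $m=\dim\mathfrak p$, $n=\dim\mathfrak k$. Let $B$ be a nondegenerate symmetric bilinear form on $\mathfrak g$, invariant under $\mathrm{Ad}(G)$ and $\theta$, positive on $\mathfrak p$ and negative on $\mathfrak k$; put $\langle u,v\rangle=-B(u,\theta v)$. Let $\rho^E$ be a unitary representation of $K$ on a finite dimensional Hermitian space $E$, $X=G/K$, $F=G\times_KE$, $TX=G\times_K\mathfrak p$, $N=G\times_K\mathfrak k$, and let $\widehat\pi:\widehat{\mathcal X}\to X$ be the total space of $TX\oplus N=G\times_K\mathfrak g$, with tautological section $Y=Y^{TX}+Y^N$. Identify $C^\infty(X,F)$ with $C^\infty(G,E)^K$, and the smooth sections of $\widehat\pi^*(\Lambda^\bullet(T^*X\oplus N^*)\otimes F)$ over $\widehat{\mathcal X}$ with $C^\infty(G\times\mathfrak g,\Lambda^\bullet(\mathfrak g^*)\otimes E)^K$. Elements of $\mathfrak g$ act on functions on $G$ as left invariant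 vector fields. Let $(e_i)$ be an orthonormal basis of $\mathfrak g$, with $e_1,\dots,e_m\in\mathfrak p$ and $e_{m+1},\dots,e_{m+n}\in\mathfrak k$, and let $(e_i^*)$ be its dual basis with respect to $B$. For $u\in\mathfrak g$ put $c(u)=B(u,\cdot)\wedge-i_u$ and $\widehat c(u)=B(u,\cdot)\wedge+i_u$ on $\Lambda^\bullet(\mathfrak g^*)$; for $A\in\mathrm{End}(\mathfrak g)$ antisymmetric with respect to $B$ put $c(A)=\frac14\sum_{i,j}B(Ae_i^*,e_j^*)c(e_i)c(e_j)$ and $\widehat c(A)=-\frac14\sum_{i,j}B(Ae_i^*,e_j^*)\widehat c(e_i)\widehat c(e_j)$, and extend them complex linearly. Let $\nabla$ be the connection induced by the connection on $G\to G/K$ with horizontal space $\mathfrak p$, let $\Delta$ be the Laplacian along the fibres of $TX\oplus N$, and $N^{\Lambda^\bullet}$ the number operator of $\Lambda^\bullet$. Set $$\alpha=\tfrac12(-\Delta+|Y|^2-m-n)+N^{\Lambda^\bullet},\qquad \vartheta=\tfrac12\big|[Y^N,Y^{TX}]\big|^2,$$ $$\beta=\nabla_{Y^{TX}}+\widehat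 c(\mathrm{ad}(Y^{TX}))-c(\mathrm{ad}(Y^{TX})+i\theta\,\mathrm{ad}(Y^N))-i\rho^E(Y^N),$$ and let $\mathcal L^X$ be the operator on $C^\infty(X,F)$ $$\mathcal L^X=\tfrac12C^{\mathfrak g}+\tfrac1{16}\mathrm{tr}^{\mathfrak p}[C^{\mathfrak k,\mathfrak p}]+\tfrac1{48}\mathrm{tr}^{\mathfrak k}[C^{\mathfrak k,\mathfrak k}],$$ where $C^{\mathfrak g}=-\sum_{i\le m}e_i^2+\sum_{i>m}e_i^2$, and $C^{\mathfrak k,\mathfrak p}$, $C^{\mathfrak k,\mathfrak k}$ are the restrictions of $\sum_{i>m}\mathrm{ad}(e_i)^2$ to $\mathfrak p$ and $\mathfrak k$. Among the smooth sections that are square integrable along the fibres, the kernel of $\alpha$ is $H=e^{-|Y|^2/2}\otimes F$ (with $F$ in degree $0$ of $\Lambda^\bullet$). Let $H^\perp$ be the space of those smooth, fibrewise square integrable sections that are orthogonal to $H$ along the fibres, let $P$ be the fibrewise orthogonal projection on $H$, and embed $C^\infty(X,F)$ isometrically along the fibres by $\iota s=\widehat\pi^*s\,e^{-|Y|^2/2}/\pi^{(m+n)/4}$.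 Then $\beta$ maps $H$ to $H^\perp$; for $h\in H$ there is exactly one $v=\alpha^{-1}\beta h$ in $H^\perp$ with $\alpha v=\beta h$, and $(\vartheta-\beta\alpha^{-1}\beta)h$ is square integrable along the fibres; and $$P(\vartheta-\beta\alpha^{-1}\beta)P=\mathcal L^X,$$ that is, $P(\vartheta-\beta\alpha^{-1}\beta)P\,\iota s=\iota(\mathcal L^Xs)$ for all $s\in C^\infty(X,F)$. -/

import Mathlib

open scoped Manifold ContDiff

noncomputable section

namespace HypoLap

/-! ### The group, its Cartan involution and the invariant form

`G` is a Lie group modelled on the finite dimensional real vector space `M`. By the definition of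
the tangent space in Mathlib, the Lie algebra `𝔤 = T₁G` is the vector space `M`, with the bracket
of `GroupLieAlgebra 𝓘(ℝ, M) G`. -/

/-- The differential at `1` of a map between Lie groups that maps `1` to `1`, as a linear map
between the Lie algebras. -/
def diffOne {M : Type*} [NormedAddCommGroup M] [NormedSpace ℝ M]
    {G : Type*} [TopologicalSpace G] [ChartedSpace M G] [Group G]
    {N : Type*} [NormedAddCommGroup N] [NormedSpace ℝ N]
    {K : Type*} [TopologicalSpace K] [ChartedSpace N K] [Group K]
    (f : K → G) : N →L[ℝ] M :=
  mfderiv 𝓘(ℝ, N) 𝓘(ℝ, M) f (1 : K)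

/-- The adjoint action `Ad(g)` of `g` on the Lie algebra: the differential at `1` of
`h ↦ g h g⁻¹`. -/
def Ad {M : Type*} [NormedAddCommGroup M] [NormedSpace ℝ M]
    {G : Type*} [TopologicalSpace G] [ChartedSpace M G] [Group G] (g : G) : M →L[ℝ] M :=
  diffOne (fun h : G => g * h * g⁻¹)

/-- A Lie group `G` with an involution `θ`, the Lie group `K` of its fixed points (with Lie
algebra `𝔨` the fixed points of `dθ`), and an invariant symmetric bilinear form `B` on `𝔤` that is
positive on `𝔭` and negative on `𝔨`. Every connected real reductive Lie group, with a Cartan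
involution, its maximal compact subgroup and an invariant form `B`, is of this kind. -/
structure ReductiveData
    (M : Type*) [NormedAddCommGroup M] [NormedSpace ℝ M]
    (G : Type*) [TopologicalSpace G] [ChartedSpace M G] [Group G]
    (N : Type*) [NormedAddCommGroup N] [NormedSpace ℝ N]
    (K : Type*) [TopologicalSpace K] [ChartedSpace N K] [Group K] where
  /-- the Cartan involution of `G` -/
  θ : G →* G
  contMDiff_θ : ContMDiff 𝓘(ℝ, M) 𝓘(ℝ, M) ∞ θ
  θ_θ : ∀ g, θ (θ g) = g
  /-- the inclusion of the subgroup `K` -/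
  incl : K →* G
  contMDiff_incl : ContMDiff 𝓘(ℝ, N) 𝓘(ℝ, M) ∞ incl
  incl_injective : Function.Injective incl
  range_incl : Set.range incl = {g | θ g = g}
  diff_incl_injective : Function.Injective (diffOne incl : N →L[ℝ] M)
  range_diff_incl : Set.range (diffOne incl : N →L[ℝ] M) =
    {u | (diffOne θ : M →L[ℝ] M) u = u}
  /-- the bilinear form -/
  B : M →ₗ[ℝ] M →ₗ[ℝ] ℝ
  B_symm : ∀ u v, B u v = B v u
  B_Ad : ∀ (g : G) (u v : M), B (Ad g u) (Ad g v) = B u v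
  B_θ : ∀ u v : M, B ((diffOne θ : M →L[ℝ] M) u) ((diffOne θ : M →L[ℝ] M) v) = B u v
  B_pos : ∀ u : M, (diffOne θ : M →L[ℝ] M) u = -u → u ≠ 0 → 0 < B u u
  B_neg : ∀ u : M, (diffOne θ : M →L[ℝ] M) u = u → u ≠ 0 → B u u < 0

section

variable {M : Type*} [NormedAddCommGroup M] [NormedSpace ℝ M] [FiniteDimensional ℝ M]
  {G : Type*} [TopologicalSpace G] [ChartedSpace M G] [Group G] [LieGroup 𝓘(ℝ, M) ∞ G]
  {N : Type*} [NormedAddCommGroup N] [NormedSpace ℝ N] [FiniteDimensional ℝ N]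
  {K : Type*} [TopologicalSpace K] [ChartedSpace N K] [Group K] [LieGroup 𝓘(ℝ, N) ∞ K]
  {E : Type*} [NormedAddCommGroup E] [InnerProductSpace ℂ E]

namespace ReductiveData

variable (D : ReductiveData M G N K)

/-- The Cartan involution on the Lie algebra. -/
def dθ : M →ₗ[ℝ] M := (diffOne D.θ : M →L[ℝ] M)

/-- The projection `Y ↦ Y^𝔭` on the `-1` eigenspace of `θ`. -/
def projP : M →ₗ[ℝ] M := (1 / 2 : ℝ) • (LinearMap.id - D.dθ)

/-- The projection `Y ↦ Y^𝔨` on the `1` eigenspace of `θ`. -/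
def projK : M →ₗ[ℝ] M := (1 / 2 : ℝ) • (LinearMap.id + D.dθ)

/-- `ad(u) v = [u, v]`, with the bracket of the Lie algebra of left invariant vector fields. -/
def ad (_D : ReductiveData M G N K) (u : M) : M →ₗ[ℝ] M :=
  haveI : CompleteSpace M := FiniteDimensional.complete ℝ M
  haveI : LieGroup 𝓘(ℝ, M) (minSmoothness ℝ 3) G := by
    rw [minSmoothness_of_isRCLikeNormedField]; infer_instance
  (LieAlgebra.ad ℝ (GroupLieAlgebra 𝓘(ℝ, M) G) (u : GroupLieAlgebra 𝓘(ℝ, M) G) :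
    GroupLieAlgebra 𝓘(ℝ, M) G →ₗ[ℝ] GroupLieAlgebra 𝓘(ℝ, M) G)

/-- The scalar product `⟨u, v⟩ = -B(u, θ v)` on `𝔤`. -/
def scal (u v : M) : ℝ := -D.B u (D.dθ v)

/-- `|u|² = ⟨u, u⟩`. -/
def normSq (u : M) : ℝ := D.scal u u

/-- The metric dual `φ u = B(u, ·)`. -/
def flat (u : M) : M →L[ℝ] ℝ := LinearMap.toContinuousLinearMap (D.B u)

/-- The differential `ρ^E(u)`, `u ∈ 𝔨`, of the representation `ρ^E` of `K`. Here `u ∈ 𝔨` is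
identified with its unique preimage in the Lie algebra of `K`. -/
def dRep (ρ : K →* (E ≃ₗᵢ[ℂ] E)) (u : M) : E →L[ℂ] E :=
  (mfderiv 𝓘(ℝ, N) 𝓘(ℝ, E →L[ℂ] E)
    (fun k : K => ((ρ k : E ≃ₗᵢ[ℂ] E) : E →L[ℂ] E)) (1 : K) : N →L[ℝ] (E →L[ℂ] E))
    (Function.invFun (diffOne D.incl : N →L[ℝ] M) u)

end ReductiveData

/-- An orthonormal basis of `(𝔤, ⟨·,·⟩)` made of a basis of `𝔭` (indexed by `Fin m`) and a basis
of `𝔨` (indexed by `Fin n`). -/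
structure AdaptedBasis (D : ReductiveData M G N K) (m n : ℕ) where
  basis : Module.Basis (Fin m ⊕ Fin n) ℝ M
  mem_p : ∀ i : Fin m, D.dθ (basis (Sum.inl i)) = -basis (Sum.inl i)
  mem_k : ∀ j : Fin n, D.dθ (basis (Sum.inr j)) = basis (Sum.inr j)
  orthonormal : ∀ a b, D.scal (basis a) (basis b) = if a = b then 1 else 0

/-! ### Forms: the algebra `Λ^•(𝔤^*) ⊗ E` -/

/-- `Λ^•(𝔤^*) ⊗ E`: a form is the family of its components of degree `p`, the component of degree
`p` being an alternating `p`-linear form on `𝔤` with values in `E` (it vanishes for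
`p > dim 𝔤`). -/
abbrev Forms (M : Type*) [NormedAddCommGroup M] [NormedSpace ℝ M]
    (E : Type*) [NormedAddCommGroup E] [InnerProductSpace ℂ E] : Type _ :=
  (p : ℕ) → M [⋀^Fin p]→L[ℝ] E

/-- Exterior multiplication `ξ ∧ w` by a `1`-form `ξ`. -/
def wedge (ξ : M →L[ℝ] ℝ) (w : Forms M E) : Forms M E
  | 0 => 0
  | p + 1 => ContinuousAlternatingMap.alternatizeUncurryFin (ξ.smulRight (w p))

/-- Contraction `i_u w`. -/
def contract (u : M) (w : Forms M E) : Forms M E :=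
  fun p => (w (p + 1)).curryLeft u

/-- The number operator `N^{Λ^•(𝔤^*)}`. -/
def number (w : Forms M E) : Forms M E := fun p => (p : ℝ) • w p

/-- An element of `E`, as a form of degree `0`. -/
def degZero (x : E) : Forms M E
  | 0 => ContinuousAlternatingMap.constOfIsEmpty ℝ M (Fin 0) x
  | _ + 1 => 0

/-- A linear map of `E` acting on `Λ^•(𝔤^*) ⊗ E`. -/
def actE (T : E →L[ℂ] E) (w : Forms M E) : Forms M E :=
  fun p => (T.restrictScalars ℝ).compContinuousAlternatingMap (w p)

/-- Pull-back of a form by a linear map of `𝔤`. -/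
def pull (T : M →L[ℝ] M) (w : Forms M E) : Forms M E :=
  fun p => (w p).compContinuousLinearMap T

namespace ReductiveData

variable (D : ReductiveData M G N K)

/-- `c(u) = φu ∧ - i_u`. -/
def c (u : M) (w : Forms M E) : Forms M E := wedge (D.flat u) w - contract u w

/-- `ĉ(u) = φu ∧ + i_u`. -/
def chat (u : M) (w : Forms M E) : Forms M E := wedge (D.flat u) w + contract u w

end ReductiveData

/-! ### Operators on sections

A section over `X = G/K` of `F = G ×_K E` is a `K`-invariant function `G → E`. A section over the
total space of `TX ⊕ N = G ×_K 𝔤` of the pull-back of `Λ^•(T^*X ⊕ N^*) ⊗ F` is a `K`-invariant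
function `G × 𝔤 → Λ^•(𝔤^*) ⊗ E`. -/

/-- The left invariant vector field on `G` attached to `u ∈ 𝔤`, acting on functions. -/
def leftDeriv {W : Type*} [NormedAddCommGroup W] [NormedSpace ℝ W] (u : M) (f : G → W) (g : G) :
    W :=
  (mfderiv 𝓘(ℝ, M) 𝓘(ℝ, W) f g : TangentSpace 𝓘(ℝ, M) g →L[ℝ] W)
    (mulInvariantVectorField (I := 𝓘(ℝ, M)) (u : GroupLieAlgebra 𝓘(ℝ, M) G) g)

/-- `C^∞(X, F) = C^∞(G, E)^K`. -/
structure IsSectionX (D : ReductiveData M G N K) (ρ : K →* (E ≃ₗᵢ[ℂ] E)) (s : G → E) : Prop where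
  smooth : ContMDiff 𝓘(ℝ, M) 𝓘(ℝ, E) ∞ s
  equivariant : ∀ (k : K) (g : G), s (g * D.incl k) = ρ k⁻¹ (s g)

/-- Smooth sections over the total space of `TX ⊕ N`: smooth functions `φ` on `G × 𝔤` with
`φ(gk, Ad(k⁻¹)Y) = ρ(k⁻¹) φ(g, Y)`, where `K` acts on `Λ^•(𝔤^*) ⊗ E` by the coadjoint action on
`𝔤^*` and by `ρ^E` on `E`. -/
structure IsSection (D : ReductiveData M G N K) (ρ : K →* (E ≃ₗᵢ[ℂ] E))
    (φ : G → M → Forms M E) : Prop where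
  smooth : ∀ p : ℕ, ContMDiff (𝓘(ℝ, M).prod 𝓘(ℝ, M)) 𝓘(ℝ, M [⋀^Fin p]→L[ℝ] E) ∞
    (fun x : G × M => φ x.1 x.2 p)
  equivariant : ∀ (k : K) (g : G) (Y : M),
    φ (g * D.incl k) (Ad (D.incl k)⁻¹ Y) =
      actE ((ρ k⁻¹ : E ≃ₗᵢ[ℂ] E) : E →L[ℂ] E) (pull (Ad (D.incl k)) (φ g Y))

namespace AdaptedBasis

variable {D : ReductiveData M G N K} {m n : ℕ} (e : AdaptedBasis D m n)

/-- The basis `e_i^*` of `𝔤` that is dual to `e_i` with respect to `B`: it is `e_i` on `𝔭` and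
`-e_i` on `𝔨`. -/
def dual : Fin m ⊕ Fin n → M
  | Sum.inl i => e.basis (Sum.inl i)
  | Sum.inr j => -e.basis (Sum.inr j)

/-- `c(A) = ¼ ∑ B(A e_i^*, e_j^*) c(e_i) c(e_j)`, for `A ∈ End(𝔤)` antisymmetric with respect
to `B`. -/
def cEnd (A : M →ₗ[ℝ] M) (w : Forms M E) : Forms M E :=
  (1 / 4 : ℝ) • ∑ i, ∑ j, D.B (A (e.dual i)) (e.dual j) • D.c (e.basis i) (D.c (e.basis j) w)

/-- `ĉ(A) = -¼ ∑ B(A e_i^*, e_j^*) ĉ(e_i) ĉ(e_j)`, for `A ∈ End(𝔤)` antisymmetric with respect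
to `B`. -/
def chatEnd (A : M →ₗ[ℝ] M) (w : Forms M E) : Forms M E :=
  -((1 / 4 : ℝ) • ∑ i, ∑ j,
    D.B (A (e.dual i)) (e.dual j) • D.chat (e.basis i) (D.chat (e.basis j) w))

/-- The Casimir operator `C^𝔤 = -∑_{𝔭} e_i² + ∑_{𝔨} e_i²` acting on functions on `G`. -/
def casimir (s : G → E) : G → E :=
  -(∑ i : Fin m, leftDeriv (e.basis (Sum.inl i)) (leftDeriv (e.basis (Sum.inl i)) s)) +
    ∑ j : Fin n, leftDeriv (e.basis (Sum.inr j)) (leftDeriv (e.basis (Sum.inr j)) s)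

/-- The action on `𝔤` of the Casimir element `C^𝔨` of `𝔨`; it preserves `𝔭` and `𝔨`, on which it
is `C^{𝔨,𝔭}` and `C^{𝔨,𝔨}`. -/
def casimirK : M →ₗ[ℝ] M :=
  ∑ j : Fin n, D.ad (e.basis (Sum.inr j)) ∘ₗ D.ad (e.basis (Sum.inr j))

/-- `tr^𝔭[C^{𝔨,𝔭}]`. -/
def traceP : ℝ := LinearMap.trace ℝ M (e.casimirK ∘ₗ D.projP)

/-- `tr^𝔨[C^{𝔨,𝔨}]`. -/
def traceK : ℝ := LinearMap.trace ℝ M (e.casimirK ∘ₗ D.projK)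

/-- `ℒ^X = ½ C^𝔤 + (1/16) tr^𝔭[C^{𝔨,𝔭}] + (1/48) tr^𝔨[C^{𝔨,𝔨}]`. -/
def LX (s : G → E) : G → E :=
  (1 / 2 : ℝ) • e.casimir s + ((1 / 16 : ℝ) * e.traceP + (1 / 48 : ℝ) * e.traceK) • s

/-- The Laplacian along `𝔤` for the scalar product `⟨·,·⟩`. -/
def laplacian (φ : G → M → Forms M E) : G → M → Forms M E :=
  fun g Y p => ∑ a, fderiv ℝ (fun Z => fderiv ℝ (fun Z' => φ g Z' p) Z (e.basis a)) Y (e.basis a)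

/-- `α = ½ (-Δ^{TX ⊕ N} + |Y|² - m - n) + N^{Λ^•}`. -/
def α (φ : G → M → Forms M E) : G → M → Forms M E :=
  fun g Y =>
    (1 / 2 : ℝ) • (-(e.laplacian φ g Y) + (D.normSq Y - (m : ℝ) - (n : ℝ)) • φ g Y) +
      number (φ g Y)

/-- The covariant derivative `∇_{Y^{TX}}` of sections for the connection on `G → G/K` whose
horizontal space is `𝔭`. -/
def nablaY (D : ReductiveData M G N K) (φ : G → M → Forms M E) : G → M → Forms M E :=
  fun g Y p => leftDeriv (D.projP Y) (fun h => φ h Y p) g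

/-- `β = ∇_{Y^{TX}} + ĉ(ad(Y^{TX})) - c(ad(Y^{TX}) + iθ ad(Y^N)) - iρ^E(Y^N)`. -/
def β (ρ : K →* (E ≃ₗᵢ[ℂ] E)) (φ : G → M → Forms M E) : G → M → Forms M E :=
  fun g Y =>
    nablaY D φ g Y + e.chatEnd (D.ad (D.projP Y)) (φ g Y)
      - (e.cEnd (D.ad (D.projP Y)) (φ g Y)
          + Complex.I • e.cEnd (D.dθ ∘ₗ D.ad (D.projK Y)) (φ g Y))
      - Complex.I • actE (D.dRep ρ (D.projK Y)) (φ g Y)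

/-- `ϑ = ½ |[Y^N, Y^{TX}]|²`. -/
def vartheta (D : ReductiveData M G N K) (φ : G → M → Forms M E) : G → M → Forms M E :=
  fun g Y => ((1 / 2 : ℝ) * D.normSq (D.ad (D.projK Y) (D.projP Y))) • φ g Y

/-! ### Square integrable sections, the kernel `H` of `α` and the projection `P` -/

/-- The vector of `𝔤` with coordinates `y` in the orthonormal basis. The volume `dY` on `𝔤` is the
image of the Lebesgue measure under this map. -/
def vec (y : Fin m ⊕ Fin n → ℝ) : M := ∑ a, y a • e.basis a

/-- Square integrability along the fibres. -/
def FibreL2 (φ : G → M → Forms M E) : Prop :=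
  ∀ (g : G) (p : ℕ), MeasureTheory.MemLp (fun y => φ g (e.vec y) p) 2 MeasureTheory.volume

/-- The Hermitian product on `Λ^•(𝔤^*) ⊗ E`. -/
def formInner (w η : Forms M E) : ℂ :=
  ∑ p ∈ Finset.range (m + n + 1), ((p.factorial : ℂ)⁻¹ *
    ∑ a : Fin p → Fin m ⊕ Fin n,
      inner ℂ (w p (fun i => e.basis (a i))) (η p (fun i => e.basis (a i))))

/-- The `L²` Hermitian product along a fibre. -/
def fibreInner (u v : M → Forms M E) : ℂ :=
  ∫ y : Fin m ⊕ Fin n → ℝ, e.formInner (u (e.vec y)) (v (e.vec y))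

/-- The isometric embedding `s ↦ π̂^* s e^{-|Y|²/2} / π^{(m+n)/4}`, whose image is
`H = e^{-|Y|²/2} ⊗ F`. -/
def embed (_e : AdaptedBasis D m n) (s : G → E) : G → M → Forms M E :=
  fun g Y => degZero
    ((Real.pi ^ (-((m : ℝ) + n) / 4) * Real.exp (-D.normSq Y / 2)) • s g)

/-- The smooth sections in `H^⊥`: they are square integrable along the fibres and orthogonal to
the fibres `e^{-|Y|²/2} ⊗ E` of `H`. -/
structure InHperp (ρ : K →* (E ≃ₗᵢ[ℂ] E)) (φ : G → M → Forms M E) : Prop where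
  isSection : IsSection D ρ φ
  fibreL2 : e.FibreL2 φ
  orthogonal : ∀ (g : G) (x : E),
    e.fibreInner (fun Y => degZero (Real.exp (-D.normSq Y / 2) • x)) (φ g) = 0

/-- The orthogonal projection `P` on `H`:
`(Pφ)(g, Y) = π^{-(m+n)/2} e^{-|Y|²/2} ∫ e^{-|Z|²/2} φ_0(g, Z) dZ`, where `φ_0` is the component
of degree `0` of `φ`. -/
def P (φ : G → M → Forms M E) : G → M → Forms M E :=
  fun g Y => degZero
    ((Real.pi ^ (-((m : ℝ) + n) / 2) * Real.exp (-D.normSq Y / 2)) •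
      ∫ y : Fin m ⊕ Fin n → ℝ,
        Real.exp (-D.normSq (e.vec y) / 2) • φ g (e.vec y) 0 ![])

open Classical in
/-- The inverse `α⁻¹` of the restriction of `α` to `H^⊥`: `α⁻¹ u` is the unique `v` in `H^⊥` with
`α v = u` (and `0` if there is no such unique `v`). -/
def αInv (ρ : K →* (E ≃ₗᵢ[ℂ] E)) (u : G → M → Forms M E) : G → M → Forms M E :=
  if h : ∃! v, e.InHperp ρ v ∧ e.α v = u then h.choose else 0

/-- The operator `ϑ - β α⁻¹ β`. -/
def secondOrder (ρ : K →* (E ≃ₗᵢ[ℂ] E)) (φ : G → M → Forms M E) : G → M → Forms M E :=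
  vartheta D φ - e.β ρ (e.αInv ρ (e.β ρ φ))

end AdaptedBasis

end

end HypoLap

end

/-! Along each fibre, `α` is a harmonic oscillator with ground state energy zero, plus the form
degree, so the computation takes place among Gaussians times polynomials in `Y`. Since `β`
differentiates only along `G`, it sends `e^{-|Y|²/2} s` to the same Gaussian times a form that is
linear in `Y`. That form lives in degrees 0 and 2. In degree 0 it is `Y^𝔭 s + i Y^𝔨 s`, because
equivariance of `s` turns `ρ^E(u) s` into `-u s` for `u ∈ 𝔨`; the degree 2 part comes from the
Clifford terms. Being odd in `Y`, it is orthogonal to `H`. A Gaussian times a linear form of degree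
`p` is an eigenvector of `α` with eigenvalue `1 + p` (`α_gauss_affine`), so `α⁻¹` divides by 1 in
degree 0 and by 3 in degree 2 (`α_invβ`).

Uniqueness of `α⁻¹β h` and the description of the kernel both rest on the smooth square integrable
solutions of `α φ = 0`. No decay of derivatives is known, so the factorisation of the oscillator
through `∂_a + y_a` is tested against cut-offs (`energy_estimate`, `annih_eq_zero`). This forces
`(∂_a + y_a) u = 0`, hence a multiple of the Gaussian, and `u = 0` in positive degree.

Applying `β` again gives a quadratic polynomial, and `P` keeps half the trace of its coefficients
(`integral_β_invβ`). Diagonal coefficients consist of `e_i²` on `𝔭` and `-e_j²` on `𝔨`, which make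
the Casimir operator, and of sums of squared structure constants (`secondCoeff_inl`,
`secondCoeff_inr`). The quartic `ϑ` contributes another such sum through fourth moments
(`integral_vartheta_embed`). With `S = sumKPP = -tr^𝔭[C^{𝔨,𝔭}]` and `S' = sumKKK = -tr^𝔨[C^{𝔨,𝔨}]`
the scalar terms are `(1/8 - 1/6 - 1/48) S - S'/48`, the constants of `ℒ^X` (`LX_eq`).

The Lie theoretic input is that the bracket of left invariant fields is the derivative of `Ad`
(`derivOne_Ad`). Invariance of `B`, of `θ` and of sections under groups then differentiates to the
infinitesimal identities used above. -/

noncomputable section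
namespace HypoLap
set_option linter.unusedSectionVars false
-- Lie groups in the chart at the identity: the bracket as derivative of `Ad`
section
variable {M : Type*} [NormedAddCommGroup M] [NormedSpace ℝ M]
  {G : Type*} [TopologicalSpace G] [ChartedSpace M G] [Group G]
  {W : Type*} [NormedAddCommGroup W] [NormedSpace ℝ W]

open Topology Filter

/-- The differential at `1` of a map from a Lie group to a vector space. -/
def derivOne (f : G → W) : M →L[ℝ] W := mfderiv 𝓘(ℝ, M) 𝓘(ℝ, W) f (1 : G)

theorem derivOne_eq_fderiv {f : G → W} (hf : MDifferentiableAt 𝓘(ℝ, M) 𝓘(ℝ, W) f 1) :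
    derivOne f = fderiv ℝ (fun y => f ((extChartAt 𝓘(ℝ, M) (1 : G)).symm y))
        (extChartAt 𝓘(ℝ, M) (1 : G) 1) := by
  simp only [derivOne, mfderiv, hf, writtenInExtChartAt, extChartAt_model_space_eq_id,
    ModelWithCorners.range_eq_univ, fderivWithin_univ]
  rfl

variable [LieGroup 𝓘(ℝ, M) ∞ G]

theorem leftDeriv_eq_derivOne {f : G → W} {g : G} (hf : MDifferentiableAt 𝓘(ℝ, M) 𝓘(ℝ, W) f g)
    (u : M) : leftDeriv u f g = derivOne (fun h : G => f (g * h)) u := by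
  have h1 : MDifferentiableAt 𝓘(ℝ, M) 𝓘(ℝ, M) (fun h : G => g * h) (1 : G) :=
    (contMDiff_mul_left (I := 𝓘(ℝ, M)) (n := ∞) (a := g)).mdifferentiableAt (by simp)
  -- The chain rule asks for the derivative at `g * 1`, which equals `g` only propositionally; the
  -- derivative at `g` is transported along this equality.
  have aux : ∀ g' : G, g' = g → HasMFDerivAt 𝓘(ℝ, M) 𝓘(ℝ, W) f g'
      (mfderiv 𝓘(ℝ, M) 𝓘(ℝ, W) f g : M →L[ℝ] W) := by
    rintro _ rfl; exact hf.hasMFDerivAt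
  have hf' := aux ((fun h : G => g * h) 1) (mul_one g)
  have := (HasMFDerivAt.comp (1 : G) hf' h1.hasMFDerivAt).mfderiv
  exact (DFunLike.congr_fun this u).symm

/-- The general result on smooth dependence of derivatives speaks of tangent coordinates. Here the
base point stays at `1` and the target is a vector space, so both coordinate changes are trivial. -/
theorem contMDiffAt_derivOne {F : G → G → W} {g : G}
    (hF : ContMDiffAt (𝓘(ℝ, M).prod 𝓘(ℝ, M)) 𝓘(ℝ, W) ∞ (Function.uncurry F) (g, 1)) (u : M) :
    ContMDiffAt 𝓘(ℝ, M) 𝓘(ℝ, W) ∞ (fun g => derivOne (F g) u) g := by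
  have : IsManifold 𝓘(ℝ, M) 1 G := IsManifold.of_le (n := ∞) (by simp)
  have := ContMDiffAt.mfderiv_apply (I := 𝓘(ℝ, M)) (I' := 𝓘(ℝ, W)) (J := 𝓘(ℝ, M)) (m := ∞) (n := ∞) F
    (fun _ => (1 : G)) id (fun _ => u) (x₀ := g) hF contMDiffAt_const contMDiffAt_id
    contMDiffAt_const (by simp)
  refine this.congr_of_eventuallyEq (Eventually.of_forall fun x => ?_)
  have e := inTangentCoordinates_eq_mfderiv_comp (I := 𝓘(ℝ, M)) (I' := 𝓘(ℝ, W))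
    (f := fun _ : G => (1 : G)) (g := fun x : G => F x 1)
    (ϕ := fun x => mfderiv 𝓘(ℝ, M) 𝓘(ℝ, W) (F x) 1) (x₀ := g) (x := x)
    (mem_chart_source M (1 : G)) (Set.mem_univ _)
  rw [mfderivWithin_range_extChartAt_symm] at e
  have h3 : mfderiv 𝓘(ℝ, W) 𝓘(ℝ, W) (extChartAt 𝓘(ℝ, W) (F g 1)) (F x 1) =
     ContinuousLinearMap.id ℝ _ := by
    rw [extChartAt_model_space_eq_id]; exact mfderiv_id
  rw [h3] at e
  exact (DFunLike.congr_fun e u).symm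

theorem contMDiff_leftDeriv {f : G → W} (hf : ContMDiff 𝓘(ℝ, M) 𝓘(ℝ, W) ∞ f) (u : M) :
    ContMDiff 𝓘(ℝ, M) 𝓘(ℝ, W) ∞ (leftDeriv u f) := by
  have : leftDeriv u f = fun g => derivOne (fun h : G => f (g * h)) u :=
    funext fun g => leftDeriv_eq_derivOne (hf.mdifferentiable (by simp) g) u
  rw [this]
  exact fun g => contMDiffAt_derivOne (F := fun g h => f (g * h))
    (hf.comp (contMDiff_mul 𝓘(ℝ, M) ∞)).contMDiffAt u

theorem diffOne_comp_derivOne {N : Type*} [NormedAddCommGroup N] [NormedSpace ℝ N]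
    {K : Type*} [TopologicalSpace K] [ChartedSpace N K] [Group K]
    {φ : K → G} (h1 : φ 1 = 1) (hφ : MDifferentiableAt 𝓘(ℝ, N) 𝓘(ℝ, M) φ 1)
    {f : G → W} (hf : MDifferentiableAt 𝓘(ℝ, M) 𝓘(ℝ, W) f 1) :
    derivOne (fun k => f (φ k)) = (derivOne f : M →L[ℝ] W) ∘L (diffOne φ : N →L[ℝ] M) := by
  have hf' : HasMFDerivAt 𝓘(ℝ, M) 𝓘(ℝ, W) f (φ 1) (mfderiv 𝓘(ℝ, M) 𝓘(ℝ, W) f 1) := by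
    rw [h1]; exact hf.hasMFDerivAt
  exact (HasMFDerivAt.comp (1 : K) hf' hφ.hasMFDerivAt).mfderiv

theorem diffOne_comp {N : Type*} [NormedAddCommGroup N] [NormedSpace ℝ N]
    {K : Type*} [TopologicalSpace K] [ChartedSpace N K] [Group K]
    {N' : Type*} [NormedAddCommGroup N'] [NormedSpace ℝ N']
    {K' : Type*} [TopologicalSpace K'] [ChartedSpace N' K'] [Group K']
    {φ : K → G} (h1 : φ 1 = 1) (hφ : MDifferentiableAt 𝓘(ℝ, N) 𝓘(ℝ, M) φ 1)
    {f : G → K'} (hf : MDifferentiableAt 𝓘(ℝ, M) 𝓘(ℝ, N') f 1) :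
    diffOne (fun k => f (φ k)) = (diffOne f : M →L[ℝ] N') ∘L (diffOne φ : N →L[ℝ] M) := by
  have hf' : HasMFDerivAt 𝓘(ℝ, M) 𝓘(ℝ, N') f (φ 1) (mfderiv 𝓘(ℝ, M) 𝓘(ℝ, N') f 1) := by
    rw [h1]; exact hf.hasMFDerivAt
  exact (HasMFDerivAt.comp (1 : K) hf' hφ.hasMFDerivAt).mfderiv

theorem mdifferentiable_conj (g : G) :
    MDifferentiable 𝓘(ℝ, M) 𝓘(ℝ, M) (fun h : G => g * h * g⁻¹) :=
  ((contMDiff_mul_right (I := 𝓘(ℝ, M)) (n := ∞) (a := g⁻¹)).comp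
    (contMDiff_mul_left (I := 𝓘(ℝ, M)) (n := ∞) (a := g))).mdifferentiable (by simp)

theorem Ad_mul (g h : G) : (Ad (g * h) : M →L[ℝ] M) = (Ad g : M →L[ℝ] M) ∘L Ad h := by
  rw [Ad, Ad, Ad, ← diffOne_comp (by simp) (mdifferentiable_conj h 1) (mdifferentiable_conj g 1)]
  congr 1
  ext k
  simp [mul_assoc]

theorem Ad_one : (Ad (1 : G) : M →L[ℝ] M) = ContinuousLinearMap.id ℝ M := by
  have : (fun h : G => (1 : G) * h * (1 : G)⁻¹) = id := by ext; simp
  rw [Ad, this]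
  exact mfderiv_id

theorem Ad_inv_Ad (g : G) (u : M) : (Ad g⁻¹ : M →L[ℝ] M) (Ad g u) = u := by
  rw [← ContinuousLinearMap.comp_apply, ← Ad_mul, inv_mul_cancel, Ad_one]; rfl

theorem derivOne_extChartAt : (derivOne (extChartAt 𝓘(ℝ, M) (1 : G)) : M →L[ℝ] M) =
    ContinuousLinearMap.id ℝ M := by
  have : IsManifold 𝓘(ℝ, M) 1 G := IsManifold.of_le (n := ∞) (by simp)
  exact mfderiv_extChartAt_self

/-- The chart at `1` has identity differential there. Reading `φ` in it makes the target a vector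
space, which is what `contMDiffAt_derivOne` needs for the smoothness of `Ad`. -/
theorem diffOne_eq_derivOne {N : Type*} [NormedAddCommGroup N] [NormedSpace ℝ N]
    {K : Type*} [TopologicalSpace K] [ChartedSpace N K] [Group K]
    {φ : K → G} (h1 : φ 1 = 1) (hφ : MDifferentiableAt 𝓘(ℝ, N) 𝓘(ℝ, M) φ 1) :
    (diffOne φ : N →L[ℝ] M) = derivOne (fun k => extChartAt 𝓘(ℝ, M) (1 : G) (φ k)) := by
  have : IsManifold 𝓘(ℝ, M) 1 G := IsManifold.of_le (n := ∞) (by simp)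
  rw [diffOne_comp_derivOne h1 hφ (mdifferentiableAt_extChartAt (by simp)), derivOne_extChartAt]
  rfl

theorem contMDiff_Ad (v : M) : ContMDiff 𝓘(ℝ, M) 𝓘(ℝ, M) ∞ (fun g : G => Ad g v) := by
  intro g
  have e : (fun g : G => (Ad g : M →L[ℝ] M) v) =
      fun g => derivOne (fun h => extChartAt 𝓘(ℝ, M) (1 : G) (g * h * g⁻¹)) v := by
    ext g
    rw [Ad, diffOne_eq_derivOne (by simp) (mdifferentiable_conj g 1)]
  rw [e]
  refine contMDiffAt_derivOne (F := fun g h => extChartAt 𝓘(ℝ, M) (1 : G) (g * h * g⁻¹)) ?_ v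
  have h1 : ContMDiffAt 𝓘(ℝ, M) 𝓘(ℝ, M) ∞ (extChartAt 𝓘(ℝ, M) (1 : G)) (g * 1 * g⁻¹) :=
    contMDiffAt_extChartAt' (by simp)
  exact ContMDiffAt.comp (g, (1 : G)) h1 ((contMDiff_fst.mul contMDiff_snd).mul contMDiff_fst.inv).contMDiffAt

variable (M G) in
/-- The multiplication of a Lie group in the chart at `1`. -/
def chartMul (z : M × M) : M :=
  extChartAt 𝓘(ℝ, M) (1 : G)
    ((extChartAt 𝓘(ℝ, M) (1 : G)).symm z.1 * (extChartAt 𝓘(ℝ, M) (1 : G)).symm z.2)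

local notation "x₁" => extChartAt 𝓘(ℝ, M) (1 : G) (1 : G)

theorem extChartAt_target_mem_nhds_one : ∀ᶠ x in 𝓝 x₁, x ∈ (extChartAt 𝓘(ℝ, M) (1 : G)).target :=
  extChartAt_target_mem_nhds (I := 𝓘(ℝ, M)) (1 : G)

theorem contMDiffAt_chart_symm {x : M} (hx : x ∈ (extChartAt 𝓘(ℝ, M) (1 : G)).target) :
    ContMDiffAt 𝓘(ℝ, M) 𝓘(ℝ, M) ∞ (extChartAt 𝓘(ℝ, M) (1 : G)).symm x :=
  (contMDiffOn_extChartAt_symm (1 : G)).contMDiffAt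
    ((isOpen_extChartAt_target (I := 𝓘(ℝ, M)) (1 : G)).mem_nhds hx)

theorem chart_symm_mem_source {x : M} (hx : x ∈ (extChartAt 𝓘(ℝ, M) (1 : G)).target) :
    (extChartAt 𝓘(ℝ, M) (1 : G)).symm x ∈ (chartAt M (1 : G)).source := by
  simpa using (extChartAt 𝓘(ℝ, M) (1 : G)).map_target hx

theorem contDiffAt_chartMul_left {x : M} (hx : x ∈ (extChartAt 𝓘(ℝ, M) (1 : G)).target) :
    ContDiffAt ℝ ∞ (chartMul M G) (x, x₁) := by
  have h1 := contMDiffAt_chart_symm hx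
  have h2 := contMDiffAt_chart_symm (x := x₁) (mem_extChartAt_target (I := 𝓘(ℝ, M)) (1 : G))
  have h3 : ContMDiffAt (𝓘(ℝ, M).prod 𝓘(ℝ, M)) 𝓘(ℝ, M) ∞ (fun z : M × M =>
     (extChartAt 𝓘(ℝ, M) (1 : G)).symm z.1 * (extChartAt 𝓘(ℝ, M) (1 : G)).symm z.2) (x, x₁) :=
    (ContMDiffAt.comp (x, x₁) h1 contMDiffAt_fst).mul (ContMDiffAt.comp (x, x₁) h2 contMDiffAt_snd)
  have h4 := ContMDiffAt.comp (I' := 𝓘(ℝ, M)) (x, x₁) (contMDiffAt_extChartAt' (I := 𝓘(ℝ, M)) (n := ∞)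
    (x := (1 : G)) (by simpa using chart_symm_mem_source hx)) h3
  rwa [chartedSpaceSelf_prod, ← modelWithCornersSelf_prod, contMDiffAt_iff_contDiffAt] at h4

theorem contDiffAt_chartMul_right {x : M} (hx : x ∈ (extChartAt 𝓘(ℝ, M) (1 : G)).target) :
    ContDiffAt ℝ ∞ (chartMul M G) (x₁, x) := by
  have h1 := contMDiffAt_chart_symm hx
  have h2 := contMDiffAt_chart_symm (x := x₁) (mem_extChartAt_target (I := 𝓘(ℝ, M)) (1 : G))
  have h3 : ContMDiffAt (𝓘(ℝ, M).prod 𝓘(ℝ, M)) 𝓘(ℝ, M) ∞ (fun z : M × M =>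
     (extChartAt 𝓘(ℝ, M) (1 : G)).symm z.1 * (extChartAt 𝓘(ℝ, M) (1 : G)).symm z.2) (x₁, x) :=
    (ContMDiffAt.comp (x₁, x) h2 contMDiffAt_fst).mul (ContMDiffAt.comp (x₁, x) h1 contMDiffAt_snd)
  have h4 := ContMDiffAt.comp (I' := 𝓘(ℝ, M)) (x₁, x) (contMDiffAt_extChartAt' (I := 𝓘(ℝ, M)) (n := ∞)
    (x := (1 : G)) (by simpa using chart_symm_mem_source hx)) h3
  rwa [chartedSpaceSelf_prod, ← modelWithCornersSelf_prod, contMDiffAt_iff_contDiffAt] at h4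

/-- Left translation in the chart. -/
theorem derivOne_mul_left {x : M} (hx : x ∈ (extChartAt 𝓘(ℝ, M) (1 : G)).target) (v : M) :
    derivOne (fun h : G => extChartAt 𝓘(ℝ, M) (1 : G) ((extChartAt 𝓘(ℝ, M) (1 : G)).symm x * h)) v =
      fderiv ℝ (chartMul M G) (x, x₁) (0, v) := by
  have hm : MDifferentiableAt 𝓘(ℝ, M) 𝓘(ℝ, M) (fun h : G => extChartAt 𝓘(ℝ, M) (1 : G)
      ((extChartAt 𝓘(ℝ, M) (1 : G)).symm x * h)) 1 := by
    have h1 : ContMDiffAt 𝓘(ℝ, M) 𝓘(ℝ, M) ∞ (extChartAt 𝓘(ℝ, M) (1 : G))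
      ((extChartAt 𝓘(ℝ, M) (1 : G)).symm x * 1) :=
      contMDiffAt_extChartAt' (by simpa only [mul_one, one_mul] using chart_symm_mem_source hx)
    exact (ContMDiffAt.comp (1 : G) h1 contMDiffAt_mul_left).mdifferentiableAt (by simp)
  rw [derivOne_eq_fderiv hm]
  have h := ((contDiffAt_chartMul_left hx).differentiableAt (by simp)).hasFDerivAt.comp x₁
    ((hasFDerivAt_const x x₁).prodMk (hasFDerivAt_id (𝕜 := ℝ) x₁))
  exact DFunLike.congr_fun h.fderiv v

/-- Right translation in the chart. -/
theorem derivOne_mul_right {x : M} (hx : x ∈ (extChartAt 𝓘(ℝ, M) (1 : G)).target) (v : M) :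
    derivOne (fun h : G => extChartAt 𝓘(ℝ, M) (1 : G) (h * (extChartAt 𝓘(ℝ, M) (1 : G)).symm x)) v =
      fderiv ℝ (chartMul M G) (x₁, x) (v, 0) := by
  have hm : MDifferentiableAt 𝓘(ℝ, M) 𝓘(ℝ, M) (fun h : G => extChartAt 𝓘(ℝ, M) (1 : G)
      (h * (extChartAt 𝓘(ℝ, M) (1 : G)).symm x)) 1 := by
    have h1 : ContMDiffAt 𝓘(ℝ, M) 𝓘(ℝ, M) ∞ (extChartAt 𝓘(ℝ, M) (1 : G))
      (1 * (extChartAt 𝓘(ℝ, M) (1 : G)).symm x) :=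
      contMDiffAt_extChartAt' (by simpa only [mul_one, one_mul] using chart_symm_mem_source hx)
    exact (ContMDiffAt.comp (1 : G) h1 contMDiffAt_mul_right).mdifferentiableAt (by simp)
  rw [derivOne_eq_fderiv hm]
  have h := ((contDiffAt_chartMul_right hx).differentiableAt (by simp)).hasFDerivAt.comp x₁
    ((hasFDerivAt_id (𝕜 := ℝ) x₁).prodMk (hasFDerivAt_const x x₁))
  exact DFunLike.congr_fun h.fderiv v

/-- Differentiate `(g h g⁻¹) g = g h` in `h` at `1`. This characterises `Ad` by the two partial
derivatives of the multiplication. -/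
theorem fderiv_chartMul_Ad {x : M} (hx : x ∈ (extChartAt 𝓘(ℝ, M) (1 : G)).target) (v : M) :
    fderiv ℝ (chartMul M G) (x₁, x) ((Ad ((extChartAt 𝓘(ℝ, M) (1 : G)).symm x) : M →L[ℝ] M) v, 0) =
      fderiv ℝ (chartMul M G) (x, x₁) (0, v) := by
  rw [← derivOne_mul_left hx, ← derivOne_mul_right hx, Ad, ← ContinuousLinearMap.comp_apply,
    ← diffOne_comp_derivOne (by simp) (mdifferentiable_conj _ _)]
  · simp
  · have h1 : ContMDiffAt 𝓘(ℝ, M) 𝓘(ℝ, M) ∞ (extChartAt 𝓘(ℝ, M) (1 : G))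
      (1 * (extChartAt 𝓘(ℝ, M) (1 : G)).symm x) :=
      contMDiffAt_extChartAt' (by simpa only [mul_one, one_mul] using chart_symm_mem_source hx)
    exact (ContMDiffAt.comp (1 : G) h1 contMDiffAt_mul_right).mdifferentiableAt (by simp)

/-- The pull-back inverts the differential of the inverse chart, that is, applies the differential
of the chart; by the chain rule the result differentiates left translation read in the chart. -/
theorem mpullback_chart_mulInvariantVectorField {x : M}
    (hx : x ∈ (extChartAt 𝓘(ℝ, M) (1 : G)).target) (v : M) :
    VectorField.mpullbackWithin 𝓘(ℝ, M) 𝓘(ℝ, M) (extChartAt 𝓘(ℝ, M) (1 : G)).symm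
      (mulInvariantVectorField (v : GroupLieAlgebra 𝓘(ℝ, M) G)) (Set.range 𝓘(ℝ, M)) x =
      fderiv ℝ (chartMul M G) (x, x₁) (0, v) := by
  have : IsManifold 𝓘(ℝ, M) 1 G := IsManifold.of_le (n := ∞) (by simp)
  rw [← derivOne_mul_left hx, VectorField.mpullbackWithin_apply]
  have h1 := mfderiv_extChartAt_comp_mfderivWithin_extChartAt_symm (I := 𝓘(ℝ, M)) hx
  have h2 := mfderivWithin_extChartAt_symm_comp_mfderiv_extChartAt (I := 𝓘(ℝ, M)) hx
  rw [ContinuousLinearMap.inverse_eq h2 h1]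
  set g := (extChartAt 𝓘(ℝ, M) (1 : G)).symm x with hg
  have aux : ∀ g' : G, g' = g → HasMFDerivAt 𝓘(ℝ, M) 𝓘(ℝ, M) (extChartAt 𝓘(ℝ, M) (1 : G)) g'
      (mfderiv 𝓘(ℝ, M) 𝓘(ℝ, M) (extChartAt 𝓘(ℝ, M) (1 : G)) g : M →L[ℝ] M) := by
    rintro _ rfl
    exact (mdifferentiableAt_extChartAt (chart_symm_mem_source hx)).hasMFDerivAt
  have h3 : MDifferentiableAt 𝓘(ℝ, M) 𝓘(ℝ, M) (fun h : G => g * h) (1 : G) :=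
    (contMDiff_mul_left (I := 𝓘(ℝ, M)) (n := ∞) (a := g)).mdifferentiableAt (by simp)
  have := (HasMFDerivAt.comp (1 : G) (aux ((fun h : G => g * h) 1) (mul_one g)) h3.hasMFDerivAt).mfderiv
  exact (DFunLike.congr_fun this v).symm

theorem mlieBracket_one_eq_lieBracketWithin (V W : (g : G) → TangentSpace 𝓘(ℝ, M) g) :
    VectorField.mlieBracket 𝓘(ℝ, M) V W (1 : G) =
      VectorField.lieBracketWithin ℝ
        (VectorField.mpullbackWithin 𝓘(ℝ, M) 𝓘(ℝ, M) (extChartAt 𝓘(ℝ, M) (1 : G)).symm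
          V (Set.range 𝓘(ℝ, M)))
        (VectorField.mpullbackWithin 𝓘(ℝ, M) 𝓘(ℝ, M) (extChartAt 𝓘(ℝ, M) (1 : G)).symm
          W (Set.range 𝓘(ℝ, M))) Set.univ x₁ := by
  have : IsManifold 𝓘(ℝ, M) 1 G := IsManifold.of_le (n := ∞) (by simp)
  rw [← VectorField.mlieBracketWithin_univ, VectorField.mlieBracketWithin_apply,
    Set.preimage_univ, Set.univ_inter]
  have aux : ∀ L : M →L[ℝ] M, L = ContinuousLinearMap.id ℝ M → ∀ x, L.inverse x = x := by
    rintro _ rfl x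
    simp
  have h1 : Set.range 𝓘(ℝ, M) = Set.univ := by simp
  refine (aux _ mfderiv_extChartAt_self _).trans ?_
  exact congrArg (fun S => VectorField.lieBracketWithin ℝ
        (VectorField.mpullbackWithin 𝓘(ℝ, M) 𝓘(ℝ, M) (extChartAt 𝓘(ℝ, M) (1 : G)).symm
          V (Set.range 𝓘(ℝ, M)))
        (VectorField.mpullbackWithin 𝓘(ℝ, M) 𝓘(ℝ, M) (extChartAt 𝓘(ℝ, M) (1 : G)).symm
          W (Set.range 𝓘(ℝ, M))) S x₁) h1

/-- Let `f` be the multiplication in the chart. Both sides are combinations of mixed second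
derivatives of `f` at the identity: the bracket because left invariant fields are `∂₂f(x, x₁)`, and
the derivative of `Ad` by differentiating the relation `fderiv_chartMul_Ad`. Symmetry of the second
derivative matches them. -/
theorem derivOne_Ad (u v : M) :
    derivOne (fun g : G => (Ad g : M →L[ℝ] M) v) u =
      VectorField.mlieBracket 𝓘(ℝ, M)
        (mulInvariantVectorField (u : GroupLieAlgebra 𝓘(ℝ, M) G))
        (mulInvariantVectorField (v : GroupLieAlgebra 𝓘(ℝ, M) G)) (1 : G) := by
  have : IsManifold 𝓘(ℝ, M) 1 G := IsManifold.of_le (n := ∞) (by simp)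
  have h0 : x₁ ∈ (extChartAt 𝓘(ℝ, M) (1 : G)).target := mem_extChartAt_target (I := 𝓘(ℝ, M)) (1 : G)
  set f := chartMul M G with hf
  have hsm : ContDiffAt ℝ ∞ f (x₁, x₁) := contDiffAt_chartMul_left h0
  have hdd : DifferentiableAt ℝ (fderiv ℝ f) (x₁, x₁) :=
    (hsm.fderiv_right (m := 1) (by
      rw [one_add_one_eq_two]; exact ENat.LEInfty.out)).differentiableAt (by simp)
  have hsymm : IsSymmSndFDerivAt ℝ f (x₁, x₁) := hsm.isSymmSndFDerivAt (by
    rw [minSmoothness_of_isRCLikeNormedField]; exact ENat.LEInfty.out)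
  -- first derivatives at the identity
  have hl : ∀ v : M, fderiv ℝ f (x₁, x₁) (0, v) = v := fun v => by
    rw [hf, ← derivOne_mul_left h0]
    simp only [extChartAt_to_inv, one_mul]
    exact DFunLike.congr_fun derivOne_extChartAt v
  have hr : ∀ v : M, fderiv ℝ f (x₁, x₁) (v, 0) = v := fun v => by
    rw [hf, ← derivOne_mul_right h0]
    simp only [extChartAt_to_inv, mul_one]
    exact DFunLike.congr_fun derivOne_extChartAt v
  have hL : ∀ v : M, HasFDerivAt (fun x => fderiv ℝ f (x, x₁) (0, v))
      ((fderiv ℝ (fderiv ℝ f) (x₁, x₁) ∘L (ContinuousLinearMap.id ℝ M).prod 0).flip (0, v)) x₁ := by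
    intro v
    have h := HasFDerivAt.comp (f := fun x : M => (x, x₁)) x₁ hdd.hasFDerivAt ((hasFDerivAt_id (𝕜 := ℝ) x₁).prodMk (hasFDerivAt_const x₁ x₁))
    have := h.clm_apply (hasFDerivAt_const ((0 : M), v) x₁)
    simpa using this
  have hV : ∀ v : M, VectorField.mpullbackWithin 𝓘(ℝ, M) 𝓘(ℝ, M) (extChartAt 𝓘(ℝ, M) (1 : G)).symm
      (mulInvariantVectorField (v : GroupLieAlgebra 𝓘(ℝ, M) G)) (Set.range 𝓘(ℝ, M)) =ᶠ[𝓝 x₁]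
      fun x => fderiv ℝ f (x, x₁) (0, v) := fun v => by
    filter_upwards [extChartAt_target_mem_nhds_one (G := G)] with x hx
    exact mpullback_chart_mulInvariantVectorField hx v
  have hbr : VectorField.mlieBracket 𝓘(ℝ, M)
        (mulInvariantVectorField (u : GroupLieAlgebra 𝓘(ℝ, M) G))
        (mulInvariantVectorField (v : GroupLieAlgebra 𝓘(ℝ, M) G)) (1 : G) =
      fderiv ℝ (fderiv ℝ f) (x₁, x₁) (u, 0) (0, v) - fderiv ℝ (fderiv ℝ f) (x₁, x₁) (v, 0) (0, u) := by
    have hgen : ∀ V W : M → M, V =ᶠ[𝓝 x₁] (fun x => fderiv ℝ f (x, x₁) (0, u)) →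
        W =ᶠ[𝓝 x₁] (fun x => fderiv ℝ f (x, x₁) (0, v)) →
        VectorField.lieBracketWithin ℝ V W Set.univ x₁ =
        fderiv ℝ (fderiv ℝ f) (x₁, x₁) (u, 0) (0, v) -
          fderiv ℝ (fderiv ℝ f) (x₁, x₁) (v, 0) (0, u) := fun V W h1 h2 => by
      rw [VectorField.lieBracketWithin_univ, h1.lieBracket_vectorField_eq h2,
        VectorField.lieBracket, (hL u).fderiv, (hL v).fderiv, hl, hl]
      simp
    rw [mlieBracket_one_eq_lieBracketWithin]
    exact hgen _ _ (hV u) (hV v)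
  have ha : MDifferentiableAt 𝓘(ℝ, M) 𝓘(ℝ, M) (fun g : G => (Ad g : M →L[ℝ] M) v) 1 :=
    (contMDiff_Ad v).mdifferentiable (by simp) 1
  rw [hbr, derivOne_eq_fderiv ha]
  set a : M → M := fun y => (Ad ((extChartAt 𝓘(ℝ, M) (1 : G)).symm y) : M →L[ℝ] M) v with hadef
  have had : DifferentiableAt ℝ a x₁ := by
    rw [← mdifferentiableAt_iff_differentiableAt]
    have hs := (contMDiffAt_chart_symm h0).mdifferentiableAt (by simp)
    refine MDifferentiableAt.comp (I' := 𝓘(ℝ, M)) x₁ (g := fun g : G => (Ad g : M →L[ℝ] M) v) ?_ hs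
    exact (contMDiff_Ad v).mdifferentiable (by simp) _
  -- The product rule for `∂₁f(x₁, x)(Ad(x) v)`, where both the point and the vector depend on `x`.
  have hR := (HasFDerivAt.comp (f := fun x : M => (x₁, x)) x₁ hdd.hasFDerivAt ((hasFDerivAt_const x₁ x₁).prodMk
    (hasFDerivAt_id (𝕜 := ℝ) x₁))).clm_apply (had.hasFDerivAt.prodMk (hasFDerivAt_const (0 : M) x₁))
  have heq : (fun x => fderiv ℝ f (x, x₁) (0, v)) =ᶠ[𝓝 x₁] fun x => fderiv ℝ f (x₁, x) (a x, 0) := by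
    filter_upwards [extChartAt_target_mem_nhds_one (G := G)] with x hx
    exact (fderiv_chartMul_Ad hx v).symm
  have hRL := DFunLike.congr_fun ((hL v).unique (hR.congr_of_eventuallyEq heq)) u
  have ha1 : a x₁ = v := by simp [hadef, Ad_one]
  clear heq hR ha hbr hV had h0 hL hdd hsm hl
  generalize x₁ = z at *
  simp [ha1, hr] at hRL
  -- `hRL` reads `D²f(u,0)(0,v) = D²f(0,u)(v,0) + a'(u)`, since `∂₁f` is the identity at the unit
  -- and `Ad(1) v = v`.
  rw [hRL, hsymm.eq (0, u) (v, 0)]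
  abel

end
end HypoLap
end

/-! ### Infinitesimal invariance: `ad`, `B`, `θ`, the representation and sections -/

noncomputable section
namespace HypoLap
set_option linter.unusedSectionVars false
section
variable {M : Type*} [NormedAddCommGroup M] [NormedSpace ℝ M]
  {G : Type*} [TopologicalSpace G] [ChartedSpace M G] [Group G]
  {W : Type*} [NormedAddCommGroup W] [NormedSpace ℝ W]
  {W' : Type*} [NormedAddCommGroup W'] [NormedSpace ℝ W']

/-- Passing to the chart makes the product rule of vector space calculus available for bilinear
expressions in functions on `G`. -/
theorem hasFDerivAt_chart {f : G → W} (hf : MDifferentiableAt 𝓘(ℝ, M) 𝓘(ℝ, W) f 1) :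
    HasFDerivAt (fun y => f ((extChartAt 𝓘(ℝ, M) (1 : G)).symm y)) (derivOne f : M →L[ℝ] W)
        (extChartAt 𝓘(ℝ, M) (1 : G) 1) := by
  rw [derivOne_eq_fderiv hf]
  apply DifferentiableAt.hasFDerivAt
  have := hf.differentiableWithinAt_writtenInExtChartAt
  rw [ModelWithCorners.range_eq_univ, differentiableWithinAt_univ] at this
  simp only [writtenInExtChartAt, extChartAt_model_space_eq_id] at this
  exact this

theorem derivOne_clm_comp (L : W →L[ℝ] W') {f : G → W}
    (hf : MDifferentiableAt 𝓘(ℝ, M) 𝓘(ℝ, W) f 1) :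
    (derivOne (fun h => L (f h)) : M →L[ℝ] W') = L ∘L derivOne f :=
  (HasMFDerivAt.comp (1 : G) L.hasMFDerivAt hf.hasMFDerivAt).mfderiv

theorem leftDeriv_clm_comp (L : W →L[ℝ] W') {f : G → W} {g : G}
    (hf : MDifferentiableAt 𝓘(ℝ, M) 𝓘(ℝ, W) f g) (u : M) :
    leftDeriv u (fun h => L (f h)) g = L (leftDeriv u f g) :=
  DFunLike.congr_fun (HasMFDerivAt.comp g L.hasMFDerivAt hf.hasMFDerivAt).mfderiv _

theorem leftDeriv_add_fun {f f' : G → W} {g : G}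
    (hf : MDifferentiableAt 𝓘(ℝ, M) 𝓘(ℝ, W) f g) (hf' : MDifferentiableAt 𝓘(ℝ, M) 𝓘(ℝ, W) f' g)
    (u : M) : leftDeriv u (fun h => f h + f' h) g = leftDeriv u f g + leftDeriv u f' g :=
  DFunLike.congr_fun (hf.hasMFDerivAt.add hf'.hasMFDerivAt).mfderiv _

theorem leftDeriv_const_smul_fun {f : G → W} {g : G}
    (hf : MDifferentiableAt 𝓘(ℝ, M) 𝓘(ℝ, W) f g) (c : ℝ) 
    (u : M) : leftDeriv u (fun h => c • f h) g = c • leftDeriv u f g :=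
  leftDeriv_clm_comp (c • ContinuousLinearMap.id ℝ W) hf u

theorem leftDeriv_zero_fun (g : G) (u : M) : leftDeriv u (fun _ : G => (0 : W)) g = 0 :=
  DFunLike.congr_fun (mfderiv_const (I := 𝓘(ℝ, M)) (x := g) (c := (0 : W))) _

theorem leftDeriv_sum_fun {ι : Type*} (t : Finset ι) {f : ι → G → W} {g : G}
    (hf : ∀ i, MDifferentiableAt 𝓘(ℝ, M) 𝓘(ℝ, W) (f i) g) (u : M) :
    leftDeriv u (fun h => ∑ i ∈ t, f i h) g = ∑ i ∈ t, leftDeriv u (f i) g := by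
  classical
  have key : MDifferentiableAt 𝓘(ℝ, M) 𝓘(ℝ, W) (fun h => ∑ i ∈ t, f i h) g ∧
      leftDeriv u (fun h => ∑ i ∈ t, f i h) g = ∑ i ∈ t, leftDeriv u (f i) g := by
    induction t using Finset.induction_on with
    | empty => simpa using ⟨mdifferentiableAt_const, leftDeriv_zero_fun g u⟩
    | insert a t ha ih =>
      simp only [Finset.sum_insert ha]
      exact ⟨(hf a).add ih.1, by rw [leftDeriv_add_fun (hf a) ih.1, ih.2]⟩
  exact key.2

/-- The left invariant derivative as a linear map of the vector. -/
def leftDerivL (f : G → W) (g : G) : M →ₗ[ℝ] W where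
  toFun u := leftDeriv u f g
  map_add' u v := by
    unfold leftDeriv
    have := congrFun (mulInvariantVectorField_add (I := 𝓘(ℝ, M)) (G := G) u v) g
    exact (congrArg _ this).trans (map_add _ _ _)
  map_smul' c v := by
    unfold leftDeriv
    have := congrFun (mulInvariantVectorField_smul (I := 𝓘(ℝ, M)) (G := G) c v) g
    exact (congrArg _ this).trans (map_smul _ _ _)

variable [LieGroup 𝓘(ℝ, M) ∞ G]

/-- A homomorphism intertwines conjugation by `h` with conjugation by `φ h`; differentiate at `1`.
-/
theorem diffOne_Ad (φ : G →* G) (hφ : ContMDiff 𝓘(ℝ, M) 𝓘(ℝ, M) ∞ φ) (h : G) (v : M) :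
    (diffOne φ : M →L[ℝ] M) ((Ad h : M →L[ℝ] M) v) =
      (Ad (φ h) : M →L[ℝ] M) ((diffOne φ : M →L[ℝ] M) v) := by
  have hd := hφ.mdifferentiable (by simp)
  have h1 := diffOne_comp (f := φ) (φ := fun k : G => h * k * h⁻¹) (by simp) (mdifferentiable_conj h 1) (hd 1)
  have h2 := diffOne_comp (f := fun k : G => φ h * k * (φ h)⁻¹) (φ := φ) (by simp) (hd 1)
    (mdifferentiable_conj (φ h) 1)
  simp only [map_mul, map_inv] at h1
  rw [h1] at h2
  exact DFunLike.congr_fun h2 v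

/-- Both sides differentiate at `h = 1` the same function, because `g k (k⁻¹ h k) = g h k`. -/
theorem leftDeriv_mul_right {f : G → W} (hf : MDifferentiable 𝓘(ℝ, M) 𝓘(ℝ, W) f) (g k : G) (u : M) :
    leftDeriv ((Ad k⁻¹ : M →L[ℝ] M) u) f (g * k) = leftDeriv u (fun h => f (h * k)) g := by
  have hr : MDifferentiable 𝓘(ℝ, M) 𝓘(ℝ, M) (fun h : G => h * k) :=
    (contMDiff_mul_right (I := 𝓘(ℝ, M)) (n := ∞) (a := k)).mdifferentiable (by simp)
  have hl : ∀ g : G, MDifferentiable 𝓘(ℝ, M) 𝓘(ℝ, M) (fun h : G => g * h) := fun g =>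
    (contMDiff_mul_left (I := 𝓘(ℝ, M)) (n := ∞) (a := g)).mdifferentiable (by simp)
  have h1 : MDifferentiable 𝓘(ℝ, M) 𝓘(ℝ, W) (fun h => f (h * k)) := hf.comp hr
  have h2 : MDifferentiable 𝓘(ℝ, M) 𝓘(ℝ, W) (fun h => f (g * k * h)) := hf.comp (hl (g * k))
  rw [leftDeriv_eq_derivOne (hf _), leftDeriv_eq_derivOne (h1 _), Ad,
    ← ContinuousLinearMap.comp_apply, ← diffOne_comp_derivOne (by simp) (mdifferentiable_conj _ _)
    (h2 1)]
  simp [mul_assoc]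

variable [FiniteDimensional ℝ M]
  {N : Type*} [NormedAddCommGroup N] [NormedSpace ℝ N]
  {K : Type*} [TopologicalSpace K] [ChartedSpace N K] [Group K]
  {E : Type*} [NormedAddCommGroup E] [InnerProductSpace ℂ E]

namespace ReductiveData
variable (D : ReductiveData M G N K)

theorem ad_eq (u v : M) : D.ad u v = derivOne (fun g : G => (Ad g : M →L[ℝ] M) v) u := by
  rw [derivOne_Ad]; rfl

theorem ad_add (u u' : M) : D.ad (u + u') = D.ad u + D.ad u' := by
  ext v; simp [ad_eq]

theorem ad_smul (c : ℝ) (u : M) : D.ad (c • u) = c • D.ad u := by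
  ext v; simp [ad_eq]

theorem ad_swap (u v : M) : D.ad u v = - D.ad v u := by
  rw [ad_eq, ad_eq, derivOne_Ad, derivOne_Ad]
  exact VectorField.mlieBracket_swap_apply

theorem mdifferentiable_Ad (v : M) : MDifferentiable 𝓘(ℝ, M) 𝓘(ℝ, M) (fun g : G => (Ad g : M →L[ℝ] M) v) :=
  (contMDiff_Ad v).mdifferentiable (by simp)

/-- The function `g ↦ B(Ad(g) v, Ad(g) w)` is constant, so its derivative at `1` vanishes. -/
theorem B_ad (u v w : M) : D.B (D.ad u v) w = - D.B v (D.ad u w) := by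
  have hv := hasFDerivAt_chart (mdifferentiable_Ad (G := G) v 1)
  have hw := hasFDerivAt_chart (mdifferentiable_Ad (G := G) w 1)
  let Bc : M →L[ℝ] M →L[ℝ] ℝ := LinearMap.toContinuousLinearMap
    ((LinearMap.toContinuousLinearMap : (M →ₗ[ℝ] ℝ) ≃ₗ[ℝ] (M →L[ℝ] ℝ)).toLinearMap ∘ₗ D.B)
  have hB := (Bc.hasFDerivAt.comp _ hv).clm_apply hw
  have hc : (fun y : M => (Bc ∘ fun y => (Ad ((extChartAt 𝓘(ℝ, M) (1 : G)).symm y) : M →L[ℝ] M) v) y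
      ((Ad ((extChartAt 𝓘(ℝ, M) (1 : G)).symm y) : M →L[ℝ] M) w)) = fun _ => D.B v w := by
    ext y
    exact D.B_Ad _ v w
  rw [hc] at hB
  have := DFunLike.congr_fun (hB.unique (hasFDerivAt_const _ _)) u
  simp only [extChartAt_to_inv, Ad_one, Function.comp_apply] at this
  have h2 : D.B v (D.ad u w) + D.B (D.ad u v) w = 0 := by
    rw [ad_eq, ad_eq]
    exact this
  linarith

/-- This is the derivative of `diffOne_Ad` in `h` at `1`; it serves for `θ` and for inner
automorphisms. -/
theorem diffOne_ad (φ : G →* G) (hφ : ContMDiff 𝓘(ℝ, M) 𝓘(ℝ, M) ∞ φ) (u v : M) :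
    (diffOne φ : M →L[ℝ] M) (D.ad u v) =
      D.ad ((diffOne φ : M →L[ℝ] M) u) ((diffOne φ : M →L[ℝ] M) v) := by
  rw [ad_eq, ad_eq, ← ContinuousLinearMap.comp_apply, ← ContinuousLinearMap.comp_apply,
    ← derivOne_clm_comp _ (mdifferentiable_Ad v 1),
    ← diffOne_comp_derivOne (map_one φ) (hφ.mdifferentiable (by simp) 1) (mdifferentiable_Ad _ 1)]
  simp only [diffOne_Ad φ hφ]

theorem dθ_ad (u v : M) : D.dθ (D.ad u v) = D.ad (D.dθ u) (D.dθ v) := D.diffOne_ad D.θ D.contMDiff_θ u v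

theorem Ad_ad (g : G) (u v : M) : (Ad g : M →L[ℝ] M) (D.ad u v) =
    D.ad ((Ad g : M →L[ℝ] M) u) ((Ad g : M →L[ℝ] M) v) :=
  D.diffOne_ad (MulAut.conj g).toMonoidHom
    (contMDiff_mul_right.comp (contMDiff_mul_left (I := 𝓘(ℝ, M)) (n := ∞) (a := g))) u v

theorem dθ_dθ (u : M) : D.dθ (D.dθ u) = u := by
  have hd := D.contMDiff_θ.mdifferentiable (by simp)
  have h := diffOne_comp (f := D.θ) (φ := D.θ) (map_one _) (hd 1) (hd 1)
  have h2 : (fun k => D.θ (D.θ k)) = id := funext D.θ_θ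
  rw [h2] at h
  have h3 : (diffOne (id : G → G) : M →L[ℝ] M) = ContinuousLinearMap.id ℝ M := mfderiv_id
  rw [h3] at h
  exact (DFunLike.congr_fun h u).symm

theorem dθ_Ad_incl (k : K) (u : M) :
    D.dθ ((Ad (D.incl k) : M →L[ℝ] M) u) = (Ad (D.incl k) : M →L[ℝ] M) (D.dθ u) := by
  have h1 : D.θ (D.incl k) = D.incl k := by
    have : D.incl k ∈ {g | D.θ g = g} := D.range_incl ▸ Set.mem_range_self k
    exact this
  have := diffOne_Ad D.θ D.contMDiff_θ (D.incl k) u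
  rw [h1] at this
  exact this

theorem dθ_Ad_incl_inv (k : K) (u : M) :
    D.dθ ((Ad (D.incl k)⁻¹ : M →L[ℝ] M) u) = (Ad (D.incl k)⁻¹ : M →L[ℝ] M) (D.dθ u) := by
  rw [← map_inv]; exact D.dθ_Ad_incl k⁻¹ u

theorem projP_Ad_incl_inv (k : K) (u : M) :
    D.projP ((Ad (D.incl k)⁻¹ : M →L[ℝ] M) u) = (Ad (D.incl k)⁻¹ : M →L[ℝ] M) (D.projP u) := by
  simp [projP, dθ_Ad_incl_inv]

theorem projK_Ad_incl_inv (k : K) (u : M) :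
    D.projK ((Ad (D.incl k)⁻¹ : M →L[ℝ] M) u) = (Ad (D.incl k)⁻¹ : M →L[ℝ] M) (D.projK u) := by
  simp [projK, dθ_Ad_incl_inv]

theorem dθ_projK (u : M) : D.dθ (D.projK u) = D.projK u := by
  simp [projK, dθ_dθ, add_comm]

theorem exists_diffOne_incl {u : M} (hu : D.dθ u = u) : ∃ w : N, (diffOne D.incl : N →L[ℝ] M) w = u := by
  have : u ∈ Set.range (diffOne D.incl : N →L[ℝ] M) := by
    rw [D.range_diff_incl]; exact hu
  exact this

theorem dRep_diffOne_incl (ρ : K →* (E ≃ₗᵢ[ℂ] E)) (w : N) :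
    D.dRep ρ ((diffOne D.incl : N →L[ℝ] M) w) =
      derivOne (fun k : K => ((ρ k : E ≃ₗᵢ[ℂ] E) : E →L[ℂ] E)) w := by
  have := Function.leftInverse_invFun D.diff_incl_injective w
  exact congrArg (derivOne (fun k : K => ((ρ k : E ≃ₗᵢ[ℂ] E) : E →L[ℂ] E)) : N →L[ℝ] _) this

/-- The restriction to `𝔨` is essential: outside the range of the differential of the inclusion,
`Function.invFun` returns an arbitrary value. -/
theorem dRep_add (ρ : K →* (E ≃ₗᵢ[ℂ] E)) {u v : M} (hu : D.dθ u = u) (hv : D.dθ v = v) :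
    D.dRep ρ (u + v) = D.dRep ρ u + D.dRep ρ v := by
  obtain ⟨u, rfl⟩ := D.exists_diffOne_incl hu
  obtain ⟨v, rfl⟩ := D.exists_diffOne_incl hv
  rw [← map_add, dRep_diffOne_incl, dRep_diffOne_incl, dRep_diffOne_incl, map_add]

theorem dRep_smul (ρ : K →* (E ≃ₗᵢ[ℂ] E)) (c : ℝ) {u : M} (hu : D.dθ u = u) :
    D.dRep ρ (c • u) = c • D.dRep ρ u := by
  obtain ⟨u, rfl⟩ := D.exists_diffOne_incl hu
  rw [← map_smul, dRep_diffOne_incl, dRep_diffOne_incl, map_smul]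

/-- Equivariance says that `k ↦ ρ(k) s(g k)` is constant; differentiate at `k = 1`. -/
theorem dRep_section {ρ : K →* (E ≃ₗᵢ[ℂ] E)}
    (hρ : ContMDiff 𝓘(ℝ, N) 𝓘(ℝ, E →L[ℂ] E) ∞
      (fun k : K => ((ρ k : E ≃ₗᵢ[ℂ] E) : E →L[ℂ] E)))
    {s : G → E} (hs : IsSectionX D ρ s) {u : M} (hu : D.dθ u = u) (g : G) :
    D.dRep ρ u (s g) = - leftDeriv u s g := by
  obtain ⟨w, rfl⟩ := D.exists_diffOne_incl hu
  have hsd := hs.smooth.mdifferentiable (by simp)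
  have hl : MDifferentiable 𝓘(ℝ, M) 𝓘(ℝ, M) (fun h : G => g * h) :=
    (contMDiff_mul_left (I := 𝓘(ℝ, M)) (n := ∞) (a := g)).mdifferentiable (by simp)
  have hi : MDifferentiable 𝓘(ℝ, N) 𝓘(ℝ, M) D.incl := D.contMDiff_incl.mdifferentiable (by simp)
  have h0 : MDifferentiable 𝓘(ℝ, M) 𝓘(ℝ, E) (fun h => s (g * h)) := hsd.comp hl
  have h0' : MDifferentiable 𝓘(ℝ, N) 𝓘(ℝ, E) (fun k => s (g * D.incl k)) := h0.comp hi
  have h1 : leftDeriv ((diffOne D.incl : N →L[ℝ] M) w) s g = derivOne (fun k => s (g * D.incl k)) w := by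
    rw [leftDeriv_eq_derivOne (hsd g), ← ContinuousLinearMap.comp_apply,
      ← diffOne_comp_derivOne (map_one _) (hi 1) (h0 1)]
  have h2 := hasFDerivAt_chart (hρ.mdifferentiable (by simp) 1)
  have h3 := hasFDerivAt_chart (h0' 1)
  have h4 := ((ContinuousLinearMap.restrictScalarsL ℂ E E ℝ ℝ).hasFDerivAt.comp _ h2).clm_apply h3
  rw [dRep_diffOne_incl, h1]
  have hc : (fun y : N => ((ContinuousLinearMap.restrictScalarsL ℂ E E ℝ ℝ) ∘ fun y => ((ρ ((extChartAt 𝓘(ℝ, N) (1 : K)).symm y) : E ≃ₗᵢ[ℂ] E) : E →L[ℂ] E)) y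
      (s (g * D.incl ((extChartAt 𝓘(ℝ, N) (1 : K)).symm y)))) = fun _ => s g := by
    ext y
    simp [hs.equivariant]
  rw [hc] at h4
  have h5 := DFunLike.congr_fun (h4.unique (hasFDerivAt_const _ _)) w
  have h6 : derivOne (fun k => s (g * D.incl k)) w + (derivOne (fun k : K => ((ρ k : E ≃ₗᵢ[ℂ] E) : E →L[ℂ] E)) w) (s g) = 0 := by
    simpa using h5
  exact eq_neg_of_add_eq_zero_right h6

theorem leftDeriv_section {ρ : K →* (E ≃ₗᵢ[ℂ] E)} {s : G → E} (hs : IsSectionX D ρ s) (k : K)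
    (g : G) (u : M) :
    leftDeriv ((Ad (D.incl k)⁻¹ : M →L[ℝ] M) u) s (g * D.incl k) = ρ k⁻¹ (leftDeriv u s g) := by
  have hsd := hs.smooth.mdifferentiable (by simp)
  rw [leftDeriv_mul_right hsd]
  simp only [hs.equivariant]
  exact leftDeriv_clm_comp (((ρ k⁻¹ : E ≃ₗᵢ[ℂ] E) : E →L[ℂ] E).restrictScalars ℝ) (hsd g) u

end ReductiveData
end
end HypoLap
end

/-! ### Gaussian moments -/

noncomputable section
namespace HypoLap
section
open MeasureTheory Real

theorem integrable_pow_mul_exp_neg_sq (k : ℕ) :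
    Integrable (fun x : ℝ => x ^ k * exp (-x ^ 2)) := by
  have := integrable_rpow_mul_exp_neg_mul_sq (b := 1) one_pos (s := k) (by
    have : (0 : ℝ) ≤ k := Nat.cast_nonneg k
    linarith)
  simpa using this

theorem integral_exp_neg_sq : ∫ x : ℝ, exp (-x ^ 2) = √π := by
  simpa using integral_gaussian 1

theorem integral_mul_exp_neg_sq : ∫ x : ℝ, x * exp (-x ^ 2) = 0 := by
  have h := integral_neg_eq_self (fun x : ℝ => x * exp (-x ^ 2)) volume
  simp only [neg_sq, neg_mul, integral_neg] at h
  linarith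

/-- The derivative of `x e^{-x²}` integrates to zero. -/
theorem integral_sq_mul_exp_neg_sq : ∫ x : ℝ, x ^ 2 * exp (-x ^ 2) = √π / 2 := by
  have h0 := integrable_pow_mul_exp_neg_sq 0
  have h1 := integrable_pow_mul_exp_neg_sq 1
  have h2 := integrable_pow_mul_exp_neg_sq 2
  simp only [pow_zero, one_mul, pow_one] at h0 h1
  have hd : ∀ x : ℝ, HasDerivAt (fun x : ℝ => x * exp (-x ^ 2))
      (exp (-x ^ 2) - 2 * (x ^ 2 * exp (-x ^ 2))) x := by
    intro x
    have := (hasDerivAt_id x).mul ((hasDerivAt_pow 2 x).neg.exp)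
    refine this.congr_deriv ?_
    simp
    ring
  have := integral_eq_zero_of_hasDerivAt_of_integrable hd (h0.sub (h2.const_mul 2)) h1
  rw [integral_sub h0 (h2.const_mul 2), integral_const_mul, integral_exp_neg_sq] at this
  linarith

variable {ι : Type*} [Fintype ι]

theorem monomial_mul_exp_eq (k : ι → ℕ) (y : ι → ℝ) :
    (∏ i, y i ^ k i) * exp (-∑ i, y i ^ 2) = ∏ i, (y i ^ k i * exp (-y i ^ 2)) := by
  rw [Finset.prod_mul_distrib, ← exp_sum, Finset.sum_neg_distrib]

theorem integrable_monomial_mul_exp (k : ι → ℕ) :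
    Integrable (fun y : ι → ℝ => (∏ i, y i ^ k i) * exp (-∑ i, y i ^ 2)) := by
  simp only [monomial_mul_exp_eq]
  exact Integrable.fintype_prod (f := fun i x => x ^ k i * exp (-x ^ 2))
    fun i => integrable_pow_mul_exp_neg_sq (k i)

theorem integral_monomial_mul_exp (k : ι → ℕ) :
    ∫ y : ι → ℝ, (∏ i, y i ^ k i) * exp (-∑ i, y i ^ 2) =
      ∏ i, ∫ x : ℝ, x ^ k i * exp (-x ^ 2) := by
  simp only [monomial_mul_exp_eq]
  exact integral_fintype_prod_volume_eq_prod fun i x => x ^ k i * exp (-x ^ 2)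

/-- Squaring doubles the exponents and turns `e^{-|y|²/2}` into `e^{-|y|²}`, which reduces the claim
to integrability. -/
theorem memLp_monomial_mul_exp (k : ι → ℕ) :
    MemLp (fun y : ι → ℝ => (∏ i, y i ^ k i) * exp (-(∑ i, y i ^ 2) / 2)) 2 := by
  rw [memLp_two_iff_integrable_sq (by fun_prop)]
  refine (integrable_monomial_mul_exp fun i => k i * 2).congr (ae_of_all _ fun y => ?_)
  simp only [mul_pow, ← exp_nat_mul, pow_mul, Finset.prod_pow]
  congr 2
  push_cast; ring

/-- Listing the indices with repetition lets products such as `y a * y b` be treated uniformly,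
whether or not the indices coincide. -/
theorem list_prod_eq_monomial [DecidableEq ι] (l : List ι) (y : ι → ℝ) :
    (l.map y).prod = ∏ i, y i ^ l.count i := by
  rw [Finset.prod_list_map_count]
  refine Finset.prod_subset (Finset.subset_univ _) fun i _ hi => ?_
  rw [List.count_eq_zero_of_not_mem (by simpa using hi), pow_zero]

theorem integrable_list_prod_mul_exp (l : List ι) :
    Integrable (fun y : ι → ℝ => (l.map y).prod * exp (-∑ i, y i ^ 2)) := by
  classical
  simpa only [list_prod_eq_monomial] using integrable_monomial_mul_exp fun i => l.count i

theorem memLp_list_prod_mul_exp (l : List ι) :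
    MemLp (fun y : ι → ℝ => (l.map y).prod * exp (-(∑ i, y i ^ 2) / 2)) 2 := by
  classical
  simpa only [list_prod_eq_monomial] using memLp_monomial_mul_exp fun i => l.count i

theorem integral_exp_neg_sum_sq :
    ∫ y : ι → ℝ, exp (-∑ i, y i ^ 2) = √π ^ Fintype.card ι := by
  have := integral_monomial_mul_exp (fun _ : ι => 0)
  simpa [integral_exp_neg_sq] using this

theorem integral_coord_mul_exp (a : ι) :
    ∫ y : ι → ℝ, y a * exp (-∑ i, y i ^ 2) = 0 := by
  classical
  have := integral_monomial_mul_exp (fun i => [a].count i)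
  simp only [← list_prod_eq_monomial] at this
  simp only [List.map_cons, List.map_nil, List.prod_cons, List.prod_nil, mul_one] at this
  rw [this]
  exact Finset.prod_eq_zero (Finset.mem_univ a) (by simpa using integral_mul_exp_neg_sq)

theorem integral_coord_mul_coord_mul_exp [DecidableEq ι] (a b : ι) :
    ∫ y : ι → ℝ, y a * y b * exp (-∑ i, y i ^ 2) =
      if a = b then √π ^ Fintype.card ι / 2 else 0 := by
  have := integral_monomial_mul_exp (fun i => [a, b].count i)
  simp only [← list_prod_eq_monomial] at this
  simp only [List.map_cons, List.map_nil, List.prod_cons, List.prod_nil, mul_one] at this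
  rw [this]
  split_ifs with h
  · subst h
    have : ∀ i, ∫ x : ℝ, x ^ [a, a].count i * exp (-x ^ 2) = √π * (if a = i then 1 / 2 else 1) := by
      intro i
      by_cases h : a = i
      · simp [h, integral_sq_mul_exp_neg_sq]; ring
      · simp [h, integral_exp_neg_sq]
    simp only [this, Finset.prod_mul_distrib, Finset.prod_ite_eq, Finset.mem_univ, if_true,
      Finset.prod_const, Finset.card_univ]
    ring
  · refine Finset.prod_eq_zero (Finset.mem_univ a) ?_
    simpa [Ne.symm h] using integral_mul_exp_neg_sq

/-- In the application `a, c` index `𝔨` and `b, d` index `𝔭`. The hypotheses exclude the other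
pairings, so unless `a = c` and `b = d` some coordinate occurs exactly once and the integral
vanishes by parity. -/
theorem integral_quartic_mul_exp [DecidableEq ι] {a b c d : ι} (hab : a ≠ b) (hcb : c ≠ b)
    (had : a ≠ d) :
    ∫ y : ι → ℝ, y a * y b * (y c * y d) * exp (-∑ i, y i ^ 2) =
      if a = c ∧ b = d then √π ^ Fintype.card ι / 4 else 0 := by
  have := integral_monomial_mul_exp (fun i => [a, b, c, d].count i)
  simp only [← list_prod_eq_monomial] at this
  simp only [List.map_cons, List.map_nil, List.prod_cons, List.prod_nil, mul_one, ← mul_assoc] at this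
  simp only [← mul_assoc]
  rw [this]
  split_ifs with h
  · obtain ⟨rfl, rfl⟩ := h
    have : ∀ i, ∫ x : ℝ, x ^ [a, b, a, b].count i * exp (-x ^ 2) =
        √π * ((if a = i then 1 / 2 else 1) * (if b = i then 1 / 2 else 1)) := by
      intro i
      by_cases h : a = i
      · subst h
        simp [hab.symm, integral_sq_mul_exp_neg_sq]; ring
      · by_cases h' : b = i
        · subst h'
          simp [hab, integral_sq_mul_exp_neg_sq]; ring
        · simp [h, h', integral_exp_neg_sq]
    simp only [this, Finset.prod_mul_distrib, Finset.prod_ite_eq, Finset.mem_univ, if_true,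
      Finset.prod_const, Finset.card_univ]
    ring
  · by_cases h1 : a = c
    · have h2 : b ≠ d := fun h2 => h ⟨h1, h2⟩
      refine Finset.prod_eq_zero (Finset.mem_univ b) ?_
      simpa [hab, hcb, Ne.symm h2] using integral_mul_exp_neg_sq
    · refine Finset.prod_eq_zero (Finset.mem_univ a) ?_
      simpa [hab.symm, Ne.symm h1, had.symm] using integral_mul_exp_neg_sq

end
end HypoLap
end

/-! ### Smooth square integrable solutions of the oscillator equation -/

noncomputable section
namespace HypoLap
set_option linter.unusedSectionVars false
section
open MeasureTheory Real

/-- Integration by parts against the constant function `1`. -/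
theorem integral_fderiv_eq_zero_of_hasCompactSupport {V : Type*} [NormedAddCommGroup V]
    [NormedSpace ℝ V] [FiniteDimensional ℝ V] [MeasurableSpace V] [BorelSpace V] (μ : Measure V)
    [μ.IsAddHaarMeasure] {f : V → ℝ} (hf : ContDiff ℝ 1 f) (hc : HasCompactSupport f) (v : V) :
    ∫ x, fderiv ℝ f x v ∂μ = 0 := by
  have hc' : HasCompactSupport (fun x => fderiv ℝ f x v) := hc.fderiv_apply (𝕜 := ℝ) v
  have hcont : Continuous (fun x => fderiv ℝ f x v) :=
    (hf.continuous_fderiv (by simp)).clm_apply continuous_const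
  have := integral_mul_fderiv_eq_neg_fderiv_mul_of_integrable (𝕜 := ℝ) (μ := μ) (f := fun _ : V => (1 : ℝ)) (g := f)
    (v := v) (by simp) (by simpa using hcont.integrable_of_hasCompactSupport hc')
    (by simpa using hf.continuous.integrable_of_hasCompactSupport hc)
    (fun _ _ => differentiableAt_const _) (fun x _ => hf.differentiable (by simp) x)
  simpa using this

variable {ι : Type*} [Fintype ι] [DecidableEq ι]

/-- Partial derivative along a coordinate. -/
def pd (a : ι) (u : (ι → ℝ) → ℝ) (y : ι → ℝ) : ℝ := fderiv ℝ u y (Pi.single a 1)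

theorem contDiff_pd {u : (ι → ℝ) → ℝ} (hu : ContDiff ℝ ∞ u) (a : ι) : ContDiff ℝ ∞ (pd a u) :=
  (hu.fderiv_right (m := ∞) (by simp)).clm_apply contDiff_const

theorem pd_mul {u v : (ι → ℝ) → ℝ} (hu : ContDiff ℝ ∞ u) (hv : ContDiff ℝ ∞ v) (a : ι) (y : ι → ℝ) :
    pd a (fun y => u y * v y) y = pd a u y * v y + u y * pd a v y := by
  have := ((hu.differentiable (by simp) y).hasFDerivAt.mul
    (hv.differentiable (by simp) y).hasFDerivAt).fderiv
  simp only [pd]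
  change fderiv ℝ (u * v) y _ = _
  rw [this]
  simp
  ring

theorem pd_add {u v : (ι → ℝ) → ℝ} (hu : ContDiff ℝ ∞ u) (hv : ContDiff ℝ ∞ v) (a : ι) (y : ι → ℝ) :
    pd a (fun y => u y + v y) y = pd a u y + pd a v y := by
  have := ((hu.differentiable (by simp) y).hasFDerivAt.add
    (hv.differentiable (by simp) y).hasFDerivAt).fderiv
  simp only [pd]
  change fderiv ℝ (u + v) y _ = _
  rw [this]
  simp

theorem pd_coord (a : ι) (y : ι → ℝ) : pd a (fun y => y a) y = 1 := by
  simp only [pd]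
  rw [(hasFDerivAt_apply a y).fderiv]
  simp

/-- The annihilation operator `∂_a + y_a`. -/
def annih (a : ι) (u : (ι → ℝ) → ℝ) (y : ι → ℝ) : ℝ := pd a u y + y a * u y

theorem contDiff_annih {u : (ι → ℝ) → ℝ} (hu : ContDiff ℝ ∞ u) (a : ι) : ContDiff ℝ ∞ (annih a u) :=
  (contDiff_pd hu a).add ((contDiff_apply ℝ ℝ a).mul hu)

/-- The left side is the divergence of the field `χ² u (∂_a + y_a) u`. The equation eliminates the
second derivatives, since it says `∑ (∂_a² u + u - y_a² u) = 2c u`. -/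
theorem sum_pd_cutoff {u χ : (ι → ℝ) → ℝ} (hu : ContDiff ℝ ∞ u) (hχ : ContDiff ℝ ∞ χ) {c : ℝ}
    (h : ∀ y, -∑ a, pd a (pd a u) y + (∑ a, y a ^ 2 - Fintype.card ι + 2 * c) * u y = 0) (y : ι → ℝ) :
    ∑ a, pd a (fun y => χ y ^ 2 * u y * annih a u y) y =
      ∑ a, (2 * χ y * pd a χ y * u y * annih a u y + χ y ^ 2 * annih a u y ^ 2) +
        2 * c * χ y ^ 2 * u y ^ 2 := by
  have h1 : ∀ a, pd a (fun y => χ y ^ 2 * u y * annih a u y) y =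
      2 * χ y * pd a χ y * u y * annih a u y + χ y ^ 2 * annih a u y ^ 2 +
      χ y ^ 2 * u y * (pd a (pd a u) y + u y - y a ^ 2 * u y) := by
    intro a
    have e1 : pd a (annih a u) y = pd a (pd a u) y + (u y + y a * pd a u y) := by
      unfold annih
      rw [pd_add (contDiff_pd hu a) ((contDiff_apply ℝ ℝ a).mul hu),
        pd_mul (contDiff_apply ℝ ℝ a) hu, pd_coord, one_mul]
    have e2 : pd a (fun y => χ y ^ 2) y = 2 * χ y * pd a χ y := by
      simp only [pow_two]
      rw [pd_mul hχ hχ]; ring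
    rw [pd_mul ((hχ.pow 2).mul hu) (contDiff_annih hu a), pd_mul (hχ.pow 2) hu, e1, e2]
    simp only [annih]
    ring
  simp only [h1]
  rw [Finset.sum_add_distrib]
  congr 1
  rw [← Finset.mul_sum]
  have h2 : ∑ a, (pd a (pd a u) y + u y - y a ^ 2 * u y) = 2 * c * u y := by
    rw [Finset.sum_sub_distrib, Finset.sum_add_distrib, ← Finset.sum_mul]
    simp only [Finset.sum_const, Finset.card_univ, nsmul_eq_mul]
    linarith [h y]
  rw [h2]; ring

/-- A Caccioppoli inequality: the divergence of `sum_pd_cutoff` integrates to zero, and its cross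
term is absorbed by half of `χ² ∑ (annih a u)²` at the price of `2 |∇χ|² u²`. -/
theorem energy_estimate {u χ : (ι → ℝ) → ℝ} (hu : ContDiff ℝ ∞ u) (hχ : ContDiff ℝ ∞ χ)
    (hχc : HasCompactSupport χ) {c : ℝ}
    (h : ∀ y, -∑ a, pd a (pd a u) y + (∑ a, y a ^ 2 - Fintype.card ι + 2 * c) * u y = 0) :
    ∫ y, χ y ^ 2 * ((∑ a, annih a u y ^ 2) / 2 + 2 * c * u y ^ 2) ≤
      ∫ y, 2 * (∑ a, pd a χ y ^ 2) * u y ^ 2 := by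
  have hs : ∀ {f g : (ι → ℝ) → ℝ}, Continuous f → Continuous g →
      HasCompactSupport f → Integrable (fun y => f y * g y) := fun hf hg hfc =>
    (hf.mul hg).integrable_of_hasCompactSupport (hfc.mul_right)
  have hχ2 : HasCompactSupport (fun y => χ y ^ 2) := 
    hχc.comp_left (g := fun x : ℝ => x ^ 2) (by simp)
  have hpd : ∀ a, HasCompactSupport (fun y => pd a χ y ^ 2) := fun a => by
    have : HasCompactSupport (pd a χ) := hχc.fderiv_apply (𝕜 := ℝ) _
    exact this.comp_left (g := fun x : ℝ => x ^ 2) (by simp)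
  have ca := fun a => (contDiff_annih hu a).continuous
  have cp := fun a => (contDiff_pd hχ a).continuous
  have cu := hu.continuous
  have cχ := hχ.continuous
  have hcs : ∀ a, HasCompactSupport (fun y => χ y ^ 2 * u y * annih a u y) := fun a => by
    simp only [mul_assoc]; exact hχ2.mul_right
  have hint : ∀ a, Integrable (fun y => pd a (fun y => χ y ^ 2 * u y * annih a u y) y) := fun a => by
    have hd : ContDiff ℝ ∞ (fun y => χ y ^ 2 * u y * annih a u y) :=
      ((hχ.pow 2).mul hu).mul (contDiff_annih hu a)
    exact (contDiff_pd hd a).continuous.integrable_of_hasCompactSupport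
      ((hcs a).fderiv_apply (𝕜 := ℝ) _)
  have h0 : ∫ y, ∑ a, pd a (fun y => χ y ^ 2 * u y * annih a u y) y = 0 := by
    rw [integral_finsetSum _ fun a _ => hint a]
    refine Finset.sum_eq_zero fun a _ => ?_
    refine integral_fderiv_eq_zero_of_hasCompactSupport volume ?_ (hcs a) _
    exact (((hχ.pow 2).mul hu).mul (contDiff_annih hu a)).of_le (by simp)
  have hI1 : Integrable fun y => χ y ^ 2 * ((∑ a, annih a u y ^ 2) / 2 + 2 * c * u y ^ 2) :=
    hs (by fun_prop) (by fun_prop) hχ2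
  have hI2 : Integrable fun y => 2 * (∑ a, pd a χ y ^ 2) * u y ^ 2 := by
    have : ∀ a, Integrable fun y => pd a χ y ^ 2 * (2 * u y ^ 2) := fun a =>
      hs (by fun_prop) (by fun_prop) (hpd a)
    refine (integrable_finsetSum Finset.univ fun a _ => this a).congr (ae_of_all _ fun y => ?_)
    simp only [← Finset.sum_mul]; ring
  have hI3 : Integrable fun y => ∑ a, pd a (fun y => χ y ^ 2 * u y * annih a u y) y :=
    integrable_finsetSum _ fun a _ => hint a
  rw [← sub_nonneg, ← integral_sub hI2 hI1]
  have hI4 : Integrable fun y => 2 * (∑ a, pd a χ y ^ 2) * u y ^ 2 -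
      χ y ^ 2 * ((∑ a, annih a u y ^ 2) / 2 + 2 * c * u y ^ 2) := hI2.sub hI1
  -- Adding the divergence, whose integral is zero, makes the difference of the two integrands
  -- nonnegative pointwise.
  have : ∫ y, (∑ a, pd a (fun y => χ y ^ 2 * u y * annih a u y) y) +
     (2 * (∑ a, pd a χ y ^ 2) * u y ^ 2 - χ y ^ 2 * ((∑ a, annih a u y ^ 2) / 2 + 2 * c * u y ^ 2)) =
     ∫ y, (2 * (∑ a, pd a χ y ^ 2) * u y ^ 2 - χ y ^ 2 * ((∑ a, annih a u y ^ 2) / 2 + 2 * c * u y ^ 2)) := by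
    rw [integral_add hI3 hI4, h0, zero_add]
  rw [← this]
  refine integral_nonneg fun y => ?_
  simp only [Pi.zero_apply]
  rw [sum_pd_cutoff hu hχ h]
  have key : ∑ a, (2 * χ y * pd a χ y * u y * annih a u y + χ y ^ 2 * annih a u y ^ 2) +
      2 * (∑ a, pd a χ y ^ 2) * u y ^ 2 - χ y ^ 2 * ((∑ a, annih a u y ^ 2) / 2) =
      ∑ a, (χ y * annih a u y + 2 * pd a χ y * u y) ^ 2 / 2 := by
    rw [mul_assoc, ← Finset.sum_div, Finset.sum_mul, Finset.mul_sum, mul_div_assoc', Finset.mul_sum, Finset.sum_div, ← Finset.sum_add_distrib, ← Finset.sum_sub_distrib, Finset.sum_div]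
    refine Finset.sum_congr rfl fun a _ => ?_
    ring
  have : 0 ≤ ∑ a, (χ y * annih a u y + 2 * pd a χ y * u y) ^ 2 / 2 :=
    Finset.sum_nonneg fun a _ => by positivity
  nlinarith [key, this]

theorem exists_cutoff (ι : Type*) [Fintype ι] [DecidableEq ι] :
    ∃ (η : (ι → ℝ) → ℝ), ContDiff ℝ ∞ η ∧ HasCompactSupport η ∧ (∀ y, 0 ≤ η y ∧ η y ≤ 1) ∧
      (∀ y, ‖y‖ ≤ 1 → η y = 1) ∧ (∀ y, 2 ≤ ‖y‖ → η y = 0) ∧ ∃ C, ∀ y, ∑ a, pd a η y ^ 2 ≤ C := by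
  let f : ContDiffBump (0 : ι → ℝ) := ⟨1, 2, one_pos, one_lt_two⟩
  refine ⟨f, f.contDiff, f.hasCompactSupport, fun y => ⟨f.nonneg, f.le_one⟩, fun y hy =>
    f.one_of_mem_closedBall (by simpa [f] using hy), fun y hy =>
    f.zero_of_le_dist (by simpa [f] using hy), ?_⟩
  have hc : HasCompactSupport (fun y => ∑ a, pd a f y ^ 2) := by
    refine (f.hasCompactSupport.fderiv (𝕜 := ℝ)).mono fun y hy => ?_
    contrapose! hy
    simp only [Function.mem_support, not_not] at hy ⊢
    simp [pd, hy]
  have hcont : Continuous (fun y => ∑ a, pd a f y ^ 2) :=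
    continuous_finsetSum _ fun a _ => (contDiff_pd f.contDiff a).continuous.pow 2
  obtain ⟨C, hC⟩ := hc.exists_bound_of_continuous hcont
  exact ⟨C, fun y => (le_abs_self _).trans (hC y)⟩

theorem pd_comp_smul {η : (ι → ℝ) → ℝ} (hη : ContDiff ℝ ∞ η) (t : ℝ) (a : ι) (y : ι → ℝ) :
    pd a (fun y => η (t • y)) y = t * pd a η (t • y) := by
  have h1 : HasFDerivAt (fun y : ι → ℝ => t • y) (t • ContinuousLinearMap.id ℝ (ι → ℝ)) y :=
    (hasFDerivAt_id y).const_smul t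
  have := ((hη.differentiable (by simp) (t • y)).hasFDerivAt.comp y h1).fderiv
  simp only [pd]
  change fderiv ℝ (η ∘ fun y => t • y) y _ = _
  rw [this]
  simp

/-- With the cut-offs `η(t y)` the right side of `energy_estimate` is at most a constant times `t² ∫
u²`, hence tends to zero with `t`. Since `c ≥ 0` the integrand on the left is nonnegative, and being
continuous it vanishes everywhere. -/
theorem annih_eq_zero {u : (ι → ℝ) → ℝ} (hu : ContDiff ℝ ∞ u) (hL : MemLp u 2) {c : ℝ} (hc : 0 ≤ c)
    (h : ∀ y, -∑ a, pd a (pd a u) y + (∑ a, y a ^ 2 - Fintype.card ι + 2 * c) * u y = 0) (y : ι → ℝ) :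
    (∑ a, annih a u y ^ 2) / 2 + 2 * c * u y ^ 2 = 0 := by
  obtain ⟨η, hη, hηc, h01, h1, h2, C, hC⟩ := exists_cutoff ι
  set Q : (ι → ℝ) → ℝ := fun y => (∑ a, annih a u y ^ 2) / 2 + 2 * c * u y ^ 2 with hQ
  have hQc : Continuous Q := by
    have ca := fun a => (contDiff_annih hu a).continuous
    have cu := hu.continuous
    fun_prop
  have hQ0 : ∀ y, 0 ≤ Q y := fun y =>
    add_nonneg (div_nonneg (Finset.sum_nonneg fun a _ => sq_nonneg _) two_pos.le) (by positivity)
  have hsc : ∀ t : ℝ, 0 < t → HasCompactSupport (fun y => η (t • y)) := fun t ht =>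
    hηc.comp_homeomorph (Homeomorph.smulOfNeZero t ht.ne')
  have hscd : ∀ t : ℝ, ContDiff ℝ ∞ (fun y => η (t • y)) := fun t =>
    hη.comp (contDiff_const_smul t)
  have hsc2 : ∀ t : ℝ, 0 < t → HasCompactSupport (fun y => η (t • y) ^ 2) := fun t ht => 
    (hsc t ht).comp_left (g := fun x : ℝ => x ^ 2) (by simp)
  have hI : ∀ t : ℝ, 0 < t → Integrable fun y => η (t • y) ^ 2 * Q y := fun t ht =>
    (((hscd t).continuous.pow 2).mul hQc).integrable_of_hasCompactSupport (hsc2 t ht).mul_right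
  set A := ∫ y, u y ^ 2
  have hbound : ∀ t : ℝ, 0 < t → ∫ y, η (t • y) ^ 2 * Q y ≤ 2 * C * A * t ^ 2 := by
    intro t ht
    refine (energy_estimate hu (hscd t) (hsc t ht) h).trans ?_
    have hu2 := hL.integrable_sq
    have : 2 * C * A * t ^ 2 = ∫ y, (2 * C * t ^ 2) * u y ^ 2 := by
      rw [integral_const_mul]; ring
    rw [this]
    refine integral_mono_of_nonneg (ae_of_all _ fun y => ?_) (hu2.const_mul _) (ae_of_all _ fun y => ?_)
    · exact mul_nonneg (mul_nonneg two_pos.le (Finset.sum_nonneg fun a _ => sq_nonneg _)) (sq_nonneg _)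
    · refine mul_le_mul_of_nonneg_right ?_ (sq_nonneg _)
      simp only [pd_comp_smul hη, mul_pow]
      rw [← Finset.mul_sum]
      nlinarith [hC (t • y), sq_nonneg t]
  by_contra hne
  -- fix a cut-off which is `1` at `y`
  set r : ℝ := ‖y‖ + 1 with hr
  have hr0 : 0 < r := by positivity
  have hpos : 0 < ∫ z, η (r⁻¹ • z) ^ 2 * Q z := by
    refine Continuous.integral_pos_of_hasCompactSupport_nonneg_nonzero
      (((hscd _).continuous.pow 2).mul hQc) (hsc2 _ (inv_pos.2 hr0)).mul_right
      (fun z => mul_nonneg (sq_nonneg _) (hQ0 z)) (x := y) ?_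
    rw [h1]
    · simpa using hne
    · rw [norm_smul, norm_inv, Real.norm_of_nonneg hr0.le, inv_mul_le_iff₀ hr0]
      simp [hr]
  -- For `t ≤ 1/(2r)` the function `η(t ·)` equals `1` on the ball of radius `2r`, outside which
  -- `η(r⁻¹ ·)` vanishes; so the fixed cut-off is dominated by all the later ones.
  have hle : ∀ t : ℝ, 0 < t → t ≤ (2 * r)⁻¹ → ∫ z, η (r⁻¹ • z) ^ 2 * Q z ≤ 2 * C * A * t ^ 2 := by
    intro t ht htr
    refine (integral_mono (hI _ (inv_pos.2 hr0)) (hI t ht) fun z => ?_).trans (hbound t ht)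
    refine mul_le_mul_of_nonneg_right ?_ (hQ0 z)
    by_cases hz : 2 ≤ ‖r⁻¹ • z‖
    · rw [h2 _ hz]; simp [sq_nonneg]
    · rw [h1 (t • z)]
      · have := h01 (r⁻¹ • z)
        nlinarith
      · push Not at hz
        rw [norm_smul, norm_inv, Real.norm_of_nonneg hr0.le, inv_mul_lt_iff₀ hr0] at hz
        rw [norm_smul, Real.norm_of_nonneg ht.le]
        calc t * ‖z‖ ≤ (2 * r)⁻¹ * (r * 2) := by gcongr
          _ = 1 := by field_simp
  have hlim : Filter.Tendsto (fun t : ℝ => 2 * C * A * t ^ 2) (nhdsWithin 0 (Set.Ioi 0)) (nhds 0) := by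
    have : Filter.Tendsto (fun t : ℝ => 2 * C * A * t ^ 2) (nhds 0) (nhds (2 * C * A * 0 ^ 2)) :=
      (continuous_const.mul (continuous_pow 2)).tendsto 0
    simpa using this.mono_left nhdsWithin_le_nhds
  have hev : ∀ᶠ t : ℝ in nhdsWithin 0 (Set.Ioi 0), ∫ z, η (r⁻¹ • z) ^ 2 * Q z ≤ 2 * C * A * t ^ 2 := by
    have h3 : (0 : ℝ) < (2 * r)⁻¹ := by positivity
    filter_upwards [Ioc_mem_nhdsGT h3] with t ht using hle t ht.1 ht.2
  exact absurd (ge_of_tendsto hlim hev) (not_le.2 hpos)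

/-- The derivative of `e^{|y|²/2} u` is `e^{|y|²/2}` times the vector of the `annih a u`, hence
zero. -/
theorem eq_gaussian_of_annih {u : (ι → ℝ) → ℝ} (hu : ContDiff ℝ ∞ u)
    (h : ∀ a y, annih a u y = 0) (y : ι → ℝ) : u y = exp (-(∑ i, y i ^ 2) / 2) * u 0 := by
  have hg : ∀ y : ι → ℝ, HasFDerivAt (fun y : ι → ℝ => (∑ i, y i ^ 2) / 2)
      (∑ i, y i • ContinuousLinearMap.proj (R := ℝ) (φ := fun _ : ι => ℝ) i) y := by
    intro y
    have h1 := HasFDerivAt.fun_sum (u := Finset.univ) (fun i _ => ((hasFDerivAt_apply (𝕜 := ℝ) (F' := fun _ : ι => ℝ) i y).pow 2))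
    have h2 := h1.const_smul (2⁻¹ : ℝ)
    refine (h2.congr_fderiv ?_).congr_of_eventuallyEq (Filter.Eventually.of_forall fun z => ?_)
    · ext v; simp [Finset.mul_sum, ← mul_assoc]
    · simp; ring
  have hd : ∀ y, HasFDerivAt (fun y => exp ((∑ i, y i ^ 2) / 2) * u y) (0 : (ι → ℝ) →L[ℝ] ℝ) y := by
    intro y
    have := (hg y).exp.mul (hu.differentiable (by simp) y).hasFDerivAt
    refine this.congr_fderiv ?_
    apply ContinuousLinearMap.coe_injective
    refine (Pi.basisFun ℝ ι).ext fun a => ?_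
    have h3 := h a y
    simp only [annih, pd] at h3
    simp [Pi.single_apply]
    linear_combination exp ((∑ i, y i ^ 2) / 2) * h3
  have hconst := is_const_of_fderiv_eq_zero (𝕜 := ℝ) (f := fun y => exp ((∑ i, y i ^ 2) / 2) * u y)
    (fun y => (hd y).differentiableAt) (fun y => (hd y).fderiv) y 0
  simp at hconst
  rw [← hconst, ← mul_assoc, ← exp_add]
  simp [neg_div]

end
end HypoLap
end

/-! ### Clifford operators in low degree and the zero order part of `β` -/

noncomputable section
namespace HypoLap
set_option linter.unusedSectionVars false
section
variable {M : Type*} [NormedAddCommGroup M] [NormedSpace ℝ M] [FiniteDimensional ℝ M]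
  {G : Type*} [TopologicalSpace G] [ChartedSpace M G] [Group G] [LieGroup 𝓘(ℝ, M) ∞ G]
  {N : Type*} [NormedAddCommGroup N] [NormedSpace ℝ N]
  {K : Type*} [TopologicalSpace K] [ChartedSpace N K] [Group K]
  {E : Type*} [NormedAddCommGroup E] [InnerProductSpace ℂ E]

/-- `ξ ∧ w` as a linear function of `w`. -/
def wedgeL (ξ : M →L[ℝ] ℝ) : Forms M E →ₗ[ℝ] Forms M E where
  toFun := wedge ξ
  map_add' w w' := by
    funext p
    cases p with
    | zero => simp [wedge]
    | succ p =>
      simp only [wedge, Pi.add_apply]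
      rw [← ContinuousAlternatingMap.alternatizeUncurryFin_add]
      congr 1
      ext; simp
  map_smul' c w := by
    funext p
    cases p with
    | zero => simp [wedge]
    | succ p =>
      simp only [wedge, Pi.smul_apply, RingHom.id_apply]
      rw [← ContinuousAlternatingMap.alternatizeUncurryFin_smul]
      congr 1
      ext a b
      simpa using smul_comm (ξ a) c (w p b)

/-- `i_u w` as a linear function of `w`. -/
def contractL (u : M) : Forms M E →ₗ[ℝ] Forms M E where
  toFun := contract u
  map_add' w w' := by funext p; simp [contract]
  map_smul' c w := by funext p; simp [contract]

/-- `degZero` as a linear map. -/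
def degZeroL : E →ₗ[ℝ] Forms M E where
  toFun := degZero
  map_add' x y := by funext p; cases p <;> (ext; simp [degZero])
  map_smul' c x := by funext p; cases p <;> (ext; simp [degZero])

theorem degZero_smul (c : ℝ) (x : E) : degZero (M := M) (c • x) = c • degZero x :=
  map_smul (degZeroL (M := M) (E := E)) c x

@[simp] theorem degZero_zero_apply (x : E) (v : Fin 0 → M) : degZero (M := M) x 0 v = x := rfl

@[simp] theorem degZero_succ (x : E) (p : ℕ) : degZero (M := M) x (p + 1) = 0 := rfl

/-- A linear map of `E` acting on forms, as a linear map. -/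
def actEL (T : E →L[ℂ] E) : Forms M E →ₗ[ℝ] Forms M E where
  toFun := actE T
  map_add' w w' := by funext p; ext; simp [actE]
  map_smul' c w := by funext p; ext; simp [actE]

theorem alternatizeUncurryFin_zero (p : ℕ) :
    ContinuousAlternatingMap.alternatizeUncurryFin (0 : M →L[ℝ] M [⋀^Fin p]→L[ℝ] E) = 0 :=
  map_zero (ContinuousAlternatingMap.alternatizeUncurryFinCLM ℝ M E)

namespace ReductiveData
variable (D : ReductiveData M G N K)

/-- `φu ∧ + ε i_u`: this is `c(u)` for `ε = -1` and `ĉ(u)` for `ε = 1`. -/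
def cliff (ε : ℝ) (u : M) : Forms M E →ₗ[ℝ] Forms M E := wedgeL (D.flat u) + ε • contractL u

theorem c_eq_cliff (u : M) (w : Forms M E) : D.c u w = D.cliff (-1) u w := by
  simp only [c, cliff, LinearMap.add_apply, LinearMap.smul_apply, neg_smul, one_smul, sub_eq_add_neg]
  rfl

theorem chat_eq_cliff (u : M) (w : Forms M E) : D.chat u w = D.cliff 1 u w := by
  simp only [chat, cliff, LinearMap.add_apply, one_smul]
  rfl

theorem cliff_zero (ε : ℝ) (u : M) (w : Forms M E) :
    D.cliff ε u w 0 = ε • (w 1).curryLeft u := by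
  simp [cliff, wedgeL, contractL, wedge, contract]

theorem cliff_succ (ε : ℝ) (u : M) (w : Forms M E) (p : ℕ) :
    D.cliff ε u w (p + 1) =
      ContinuousAlternatingMap.alternatizeUncurryFin ((D.flat u).smulRight (w p)) +
        ε • (w (p + 2)).curryLeft u := by
  simp [cliff, wedgeL, contractL, wedge, contract]

theorem cliff_cliff_zero (ε : ℝ) (u v : M) (w : Forms M E) :
    D.cliff ε u (D.cliff ε v w) 0 ![] =
      (ε * D.B v u) • w 0 ![] + (ε * ε) • w 2 ![v, u] := by
  rw [cliff_zero, cliff_succ]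
  simp [ContinuousAlternatingMap.alternatizeUncurryFin_apply, flat, smul_smul]

theorem cliff_degZero (ε : ℝ) (v : M) (x : E) (p : ℕ) (hp : p ≠ 1) :
    D.cliff ε v (degZero x) p = 0 := by
  match p, hp with
  | 0, _ => rw [cliff_zero]; simp
  | p + 2, _ => rw [cliff_succ]; simp [alternatizeUncurryFin_zero]

/-- Only the two exterior multiplications reach degree 2, so the sign `ε` drops out. -/
theorem cliff_cliff_degZero_two (ε : ℝ) (u v : M) (x : E) (a b : M) :
    D.cliff ε u (D.cliff ε v (degZero x)) 2 ![a, b] =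
      (D.B u a * D.B v b - D.B u b * D.B v a) • x := by
  rw [cliff_succ, cliff_degZero _ _ _ _ 3 (by norm_num), cliff_succ]
  simp [ContinuousAlternatingMap.alternatizeUncurryFin_apply, flat, smul_smul, Fin.sum_univ_two]
  rw [sub_smul, sub_eq_add_neg]
  rfl

theorem cliff_cliff_degZero_of_ne (ε : ℝ) (u v : M) (x : E) (p : ℕ) (hp : p ≠ 0) (hp' : p ≠ 2) :
    D.cliff ε u (D.cliff ε v (degZero x)) p = 0 := by
  match p, hp, hp' with
  | 1, _, _ =>
    rw [cliff_succ, cliff_degZero _ _ _ _ 0 (by norm_num), cliff_degZero _ _ _ _ 2 (by norm_num)]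
    simp [alternatizeUncurryFin_zero]
  | p + 3, _, _ =>
    rw [cliff_succ, cliff_degZero _ _ _ _ (p + 2) (by omega), cliff_degZero _ _ _ _ (p + 4) (by omega)]
    simp [alternatizeUncurryFin_zero]

end ReductiveData

namespace AdaptedBasis
variable {D : ReductiveData M G N K} {m n : ℕ} (e : AdaptedBasis D m n)

/-- The sign of `B` on the basis vectors: `1` on `𝔭` and `-1` on `𝔨`. -/
def sgn : Fin m ⊕ Fin n → ℝ
  | Sum.inl _ => 1
  | Sum.inr _ => -1

@[simp] theorem sgn_mul_self (a : Fin m ⊕ Fin n) : sgn a * sgn a = 1 := by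
  cases a <;> simp [sgn]

theorem dual_eq (a : Fin m ⊕ Fin n) : e.dual a = sgn a • e.basis a := by
  cases a <;> simp [dual, sgn]

theorem dθ_basis (a : Fin m ⊕ Fin n) : D.dθ (e.basis a) = -(sgn a • e.basis a) := by
  cases a <;> simp [sgn, e.mem_p, e.mem_k]

theorem B_basis (a b : Fin m ⊕ Fin n) :
    D.B (e.basis a) (e.basis b) = if a = b then sgn a else 0 := by
  have h := e.orthonormal a b
  rw [ReductiveData.scal, dθ_basis, map_neg, map_smul, neg_neg, smul_eq_mul] at h
  have h2 : D.B (e.basis a) (e.basis b) = sgn b * (if a = b then 1 else 0) := by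
    rw [← h, ← mul_assoc, sgn_mul_self, one_mul]
  rw [h2]
  split_ifs with hab
  · simp [hab]
  · simp

theorem sum_B_smul_dual (v : M) : ∑ a, D.B (e.basis a) v • e.dual a = v := by
  let L : M →ₗ[ℝ] M := ∑ a, (D.B (e.basis a)).smulRight (e.dual a)
  have hL : L = LinearMap.id := by
    refine e.basis.ext fun b => ?_
    simp [L, LinearMap.sum_apply, B_basis, dual_eq, smul_smul, -Fintype.sum_sum_type]
  have := DFunLike.congr_fun hL v
  simpa [L, LinearMap.sum_apply] using this

theorem sum_B_dual_mul_B (v w : M) : ∑ a, D.B (e.basis a) v * D.B (e.dual a) w = D.B v w := by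
  conv_rhs => rw [← e.sum_B_smul_dual v]
  simp

/-- `¼ ∑ B(A e_i^*, e_j^*) (φe_i ∧ + ε i_{e_i}) (φe_j ∧ + ε i_{e_j})`. -/
def quad (ε : ℝ) (A : M →ₗ[ℝ] M) : Forms M E →ₗ[ℝ] Forms M E :=
  (1 / 4 : ℝ) • ∑ i, ∑ j, D.B (A (e.dual i)) (e.dual j) •
    (D.cliff ε (e.basis i) ∘ₗ D.cliff ε (e.basis j))

theorem cEnd_eq_quad (A : M →ₗ[ℝ] M) (w : Forms M E) : e.cEnd A w = e.quad (-1) A w := by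
  simp [cEnd, quad, ReductiveData.c_eq_cliff, LinearMap.sum_apply]

theorem chatEnd_eq_quad (A : M →ₗ[ℝ] M) (w : Forms M E) : e.chatEnd A w = -e.quad 1 A w := by
  simp [chatEnd, quad, ReductiveData.chat_eq_cliff, LinearMap.sum_apply]

theorem quad_add (ε : ℝ) (A A' : M →ₗ[ℝ] M) :
    e.quad (E := E) ε (A + A') = e.quad ε A + e.quad ε A' := by
  simp only [quad, LinearMap.add_apply, map_add, add_smul, Finset.sum_add_distrib, smul_add]

theorem quad_smul (ε c : ℝ) (A : M →ₗ[ℝ] M) : e.quad (E := E) ε (c • A) = c • e.quad ε A := by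
  simp only [quad, LinearMap.smul_apply, map_smul, smul_eq_mul, mul_smul, ← Finset.smul_sum]
  rw [smul_comm]

theorem sum_antisymm_mul_symm {ι : Type*} [Fintype ι] {Q S : ι → ι → ℝ}
    (hQ : ∀ i j, Q i j = -Q j i) (hS : ∀ i j, S i j = S j i) : ∑ i, ∑ j, Q i j * S i j = 0 := by
  have h : ∑ i, ∑ j, Q i j * S i j = -∑ i, ∑ j, Q i j * S i j := by
    conv_lhs => rw [Finset.sum_comm]
    simp only [← Finset.sum_neg_distrib]
    refine Finset.sum_congr rfl fun i _ => Finset.sum_congr rfl fun j _ => ?_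
    rw [hQ, hS]; ring
  linarith

/-- The terms that lower and raise the degree carry the symmetric factor `B(e_j, e_i)` against
antisymmetric coefficients and cancel; only the double contraction of the degree 2 component
remains. -/
theorem quad_zero (ε : ℝ) {A : M →ₗ[ℝ] M} (hA : ∀ v w, D.B (A v) w = -D.B v (A w))
    (w : Forms M E) :
    e.quad ε A w 0 ![] =
      (1 / 4 * (ε * ε)) • ∑ i, ∑ j, D.B (A (e.dual i)) (e.dual j) • w 2 ![e.basis j, e.basis i] := by
  have h1 : e.quad ε A w 0 ![] = (1 / 4 : ℝ) • ∑ i, ∑ j, D.B (A (e.dual i)) (e.dual j) •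
      D.cliff ε (e.basis i) (D.cliff ε (e.basis j) w) 0 ![] := by
    simp [quad, LinearMap.sum_apply, ContinuousAlternatingMap.sum_apply]
  rw [h1]
  simp only [ReductiveData.cliff_cliff_zero, smul_add, Finset.sum_add_distrib]
  have h2 : ∑ i, ∑ j, D.B (A (e.dual i)) (e.dual j) •
      (ε * D.B (e.basis j) (e.basis i)) • w 0 ![] = 0 := by
    simp only [smul_smul, ← Finset.sum_smul]
    rw [sum_antisymm_mul_symm (Q := fun i j => D.B (A (e.dual i)) (e.dual j))
      (S := fun i j => ε * D.B (e.basis j) (e.basis i)), zero_smul]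
    · intro i j
      rw [hA, D.B_symm]
    · intro i j
      rw [D.B_symm]
  rw [h2, smul_zero, zero_add]
  simp only [Finset.smul_sum]
  refine Finset.sum_congr rfl fun i _ => Finset.sum_congr rfl fun j _ => ?_
  module

/-- Expanding `v` and `w` in the dual basis collapses the double sum. The two antisymmetrised terms
are equal by antisymmetry of `A`, whence `1/2` instead of `1/4`. -/
theorem quad_degZero_two (ε : ℝ) {A : M →ₗ[ℝ] M} (hA : ∀ v w, D.B (A v) w = -D.B v (A w))
    (x : E) (v w : M) :
    e.quad ε A (degZero x) 2 ![v, w] = (1 / 2 * D.B (A v) w) • x := by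
  have h1 : e.quad ε A (degZero x) 2 ![v, w] = (1 / 4 : ℝ) • ∑ i, ∑ j, D.B (A (e.dual i)) (e.dual j) •
      D.cliff ε (e.basis i) (D.cliff ε (e.basis j) (degZero x)) 2 ![v, w] := by
    simp [quad, LinearMap.sum_apply, ContinuousAlternatingMap.sum_apply]
  rw [h1]
  simp only [ReductiveData.cliff_cliff_degZero_two, smul_smul, ← Finset.sum_smul]
  congr 1
  have h2 : ∀ v w : M, ∑ i, ∑ j, D.B (A (e.dual i)) (e.dual j) *
      (D.B (e.basis i) v * D.B (e.basis j) w) = D.B (A v) w := by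
    intro v w
    conv_rhs => rw [← e.sum_B_smul_dual v, ← e.sum_B_smul_dual w]
    simp only [map_sum, map_smul, LinearMap.sum_apply, LinearMap.smul_apply, smul_eq_mul,
      Finset.mul_sum]
    rw [Finset.sum_comm]
    refine Finset.sum_congr rfl fun i _ => Finset.sum_congr rfl fun j _ => ?_
    ring
  have h3 : D.B (A w) v = -D.B (A v) w := by rw [hA, D.B_symm]
  simp only [mul_sub, Finset.sum_sub_distrib]
  rw [h2, h2, h3]
  ring

theorem quad_degZero_of_ne (ε : ℝ) (A : M →ₗ[ℝ] M) (x : E) (p : ℕ) (hp : p ≠ 0) (hp' : p ≠ 2) :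
    e.quad ε A (degZero x) p = 0 := by
  simp [quad, LinearMap.sum_apply, D.cliff_cliff_degZero_of_ne ε _ _ x p hp hp']

theorem quad_degZero_zero (ε : ℝ) {A : M →ₗ[ℝ] M} (hA : ∀ v w, D.B (A v) w = -D.B v (A w))
    (x : E) : e.quad ε A (degZero x) 0 = 0 := by
  ext v
  rw [Subsingleton.elim v ![], quad_zero _ _ hA]
  simp

/-- `θ` is an involution preserving `B`, so it is self-adjoint, and it commutes with `ad(u)` for `u
∈ 𝔨`. -/
theorem dθ_ad_antisymm (D : ReductiveData M G N K) {u : M} (hu : D.dθ u = u) (v w : M) :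
    D.B ((D.dθ ∘ₗ D.ad u) v) w = -D.B v ((D.dθ ∘ₗ D.ad u) w) := by
  have h : ∀ x y, D.B (D.dθ x) y = D.B x (D.dθ y) := fun x y => by
    have := D.B_θ x (D.dθ y)
    rw [← this]
    change _ = D.B (D.dθ x) (D.dθ (D.dθ y))
    rw [D.dθ_dθ]
  simp only [LinearMap.comp_apply]
  rw [h, D.B_ad, D.dθ_ad, hu]

/-- The zero order part of `β` as an operator on forms, depending linearly on `Y ∈ 𝔤`. -/
def zeroOrder (ρ : K →* (E ≃ₗᵢ[ℂ] E)) : M →ₗ[ℝ] Forms M E →ₗ[ℝ] Forms M E where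
  toFun u := -e.quad 1 (D.ad (D.projP u)) - (e.quad (-1) (D.ad (D.projP u)) +
    Complex.I • e.quad (-1) (D.dθ ∘ₗ D.ad (D.projK u))) - Complex.I • actEL (D.dRep ρ (D.projK u))
  map_add' u v := by
    have h : actEL (M := M) (D.dRep ρ (D.projK (u + v))) =
        actEL (D.dRep ρ (D.projK u)) + actEL (D.dRep ρ (D.projK v)) := by
      rw [map_add, D.dRep_add ρ (D.dθ_projK u) (D.dθ_projK v)]
      rfl
    rw [h]
    simp only [map_add, D.ad_add, quad_add, LinearMap.comp_add, smul_add]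
    abel
  map_smul' c u := by
    have h : actEL (M := M) (D.dRep ρ (D.projK (c • u))) = c • actEL (D.dRep ρ (D.projK u)) := by
      rw [map_smul, D.dRep_smul ρ c (D.dθ_projK u)]
      rfl
    rw [h]
    simp only [map_smul, D.ad_smul, quad_smul, LinearMap.comp_smul, RingHom.id_apply, smul_sub, smul_add,
      smul_neg, smul_comm Complex.I c]

theorem zeroOrder_apply (ρ : K →* (E ≃ₗᵢ[ℂ] E)) (u : M) (w : Forms M E) :
    e.zeroOrder ρ u w = -e.quad 1 (D.ad (D.projP u)) w - (e.quad (-1) (D.ad (D.projP u)) w +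
    Complex.I • e.quad (-1) (D.dθ ∘ₗ D.ad (D.projK u)) w) - Complex.I • actE (D.dRep ρ (D.projK u)) w := rfl

theorem β_eq (ρ : K →* (E ≃ₗᵢ[ℂ] E)) (φ : G → M → Forms M E) (g : G) (Y : M) :
    e.β ρ φ g Y = nablaY D φ g Y + e.zeroOrder ρ Y (φ g Y) := by
  rw [zeroOrder_apply]
  simp only [β, cEnd_eq_quad, chatEnd_eq_quad]
  abel

theorem zeroOrder_degZero_zero (ρ : K →* (E ≃ₗᵢ[ℂ] E)) (u : M) (x : E) :
    e.zeroOrder ρ u (degZero x) 0 ![] = -Complex.I • D.dRep ρ (D.projK u) x := by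
  rw [zeroOrder_apply]
  simp [quad_degZero_zero e _ (D.B_ad _), quad_degZero_zero e _ (dθ_ad_antisymm D (D.dθ_projK u)), actE]

/-- The minus sign in the definition of `ĉ(A)` makes `ĉ(ad(Y^𝔭))` and `-c(ad(Y^𝔭))` add up on degree
0 forms rather than cancel: `-1/2 - 1/2 = -1`. -/
theorem zeroOrder_degZero_two (ρ : K →* (E ≃ₗᵢ[ℂ] E)) (u : M) (x : E) (v w : M) :
    e.zeroOrder ρ u (degZero x) 2 ![v, w] =
      -(D.B (D.ad (D.projP u) v) w • x) -
        (1 / 2 * D.B (D.dθ (D.ad (D.projK u) v)) w) • (Complex.I • x) := by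
  rw [zeroOrder_apply]
  simp [quad_degZero_two e _ (D.B_ad _), quad_degZero_two e _ (dθ_ad_antisymm D (D.dθ_projK u)), actE]
  rw [smul_comm Complex.I]
  generalize Complex.I • x = y
  module

theorem zeroOrder_degZero_of_ne (ρ : K →* (E ≃ₗᵢ[ℂ] E)) (u : M) (x : E) (p : ℕ) (hp : p ≠ 0)
    (hp' : p ≠ 2) : e.zeroOrder ρ u (degZero x) p = 0 := by
  rw [zeroOrder_apply]
  obtain ⟨q, rfl⟩ := Nat.exists_eq_succ_of_ne_zero hp
  simp [quad_degZero_of_ne e _ _ _ _ hp hp', actE]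
  ext; simp

/-- By `quad_zero` the double contraction does not see the sign `ε = ±1`, so the `𝔭` terms of `c`
and `ĉ` again combine, with coefficient `1/4 + 1/4`. -/
theorem zeroOrder_zero (ρ : K →* (E ≃ₗᵢ[ℂ] E)) (u : M) (w : Forms M E) :
    e.zeroOrder ρ u w 0 ![] =
      -((1 / 2 : ℝ) • ∑ i, ∑ j, D.B (D.ad (D.projP u) (e.dual i)) (e.dual j) • w 2 ![e.basis j, e.basis i]) -
      Complex.I • ((1 / 4 : ℝ) • ∑ i, ∑ j, D.B (D.dθ (D.ad (D.projK u) (e.dual i))) (e.dual j) •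
        w 2 ![e.basis j, e.basis i]) - Complex.I • D.dRep ρ (D.projK u) (w 0 ![]) := by
  rw [zeroOrder_apply]
  have h1 := quad_zero e 1 (D.B_ad (D.projP u)) w
  have h2 := quad_zero e (-1) (D.B_ad (D.projP u)) w
  have h3 := quad_zero e (-1) (dθ_ad_antisymm D (D.dθ_projK u)) w
  simp only [Pi.sub_apply, Pi.neg_apply, Pi.add_apply, Pi.smul_apply, ContinuousAlternatingMap.sub_apply,
    ContinuousAlternatingMap.neg_apply, ContinuousAlternatingMap.add_apply, ContinuousAlternatingMap.smul_apply, h1, h2, h3]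
  simp only [mul_one, neg_mul_neg, LinearMap.comp_apply, actE]
  change _ - Complex.I • D.dRep ρ (D.projK u) (w 0 ![]) = _
  rw [sub_left_inj, ← sub_sub, sub_left_inj]
  module

end AdaptedBasis
end
end HypoLap
end

/-! ### The oscillator along the fibres of `TX ⊕ N` -/

noncomputable section
namespace HypoLap
set_option linter.unusedSectionVars false
section
variable {M : Type*} [NormedAddCommGroup M] [NormedSpace ℝ M] [FiniteDimensional ℝ M]
  {G : Type*} [TopologicalSpace G] [ChartedSpace M G] [Group G] [LieGroup 𝓘(ℝ, M) ∞ G]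
  {N : Type*} [NormedAddCommGroup N] [NormedSpace ℝ N]
  {K : Type*} [TopologicalSpace K] [ChartedSpace N K] [Group K]
  {E : Type*} [NormedAddCommGroup E] [InnerProductSpace ℂ E]
  {V : Type*} [NormedAddCommGroup V] [NormedSpace ℝ V]

open MeasureTheory

theorem contDiff_fibre {f : G × M → V}
    (hf : ContMDiff (𝓘(ℝ, M).prod 𝓘(ℝ, M)) 𝓘(ℝ, V) ∞ f) (g : G) :
    ContDiff ℝ ∞ (fun Y => f (g, Y)) :=
  contMDiff_iff_contDiff.1 (hf.comp (contMDiff_const.prodMk contMDiff_id))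

namespace AdaptedBasis
variable {D : ReductiveData M G N K} {m n : ℕ} (e : AdaptedBasis D m n)

/-- The coordinates in the orthonormal basis. -/
def coord (a : Fin m ⊕ Fin n) : M →L[ℝ] ℝ := LinearMap.toContinuousLinearMap (e.basis.coord a)

/-- The identification `ℝ^{m+n} = 𝔤` given by the orthonormal basis. -/
def vecL : (Fin m ⊕ Fin n → ℝ) →L[ℝ] M :=
  LinearMap.toContinuousLinearMap e.basis.equivFun.symm.toLinearMap

theorem vecL_apply (y : Fin m ⊕ Fin n → ℝ) : e.vecL y = e.vec y :=
  e.basis.equivFun_symm_apply y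

@[simp] theorem coord_basis (a b : Fin m ⊕ Fin n) :
    e.coord a (e.basis b) = if b = a then 1 else 0 := by
  simp [coord, Finsupp.single_apply]

theorem sum_coord_smul (Y : M) : ∑ a, e.coord a Y • e.basis a = Y := e.basis.sum_repr Y

theorem vec_coord (Y : M) : e.vec (fun a => e.coord a Y) = Y := e.sum_coord_smul Y

theorem sum_coord_smul_map (L : M →ₗ[ℝ] V) (Y : M) : ∑ a, e.coord a Y • L (e.basis a) = L Y := by
  conv_rhs => rw [← e.sum_coord_smul Y]
  simp only [map_sum, map_smul]

theorem scal_vec (x y : Fin m ⊕ Fin n → ℝ) : D.scal (e.vec x) (e.vec y) = ∑ a, x a * y a := by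
  have h : ∀ a b, -D.B (e.basis a) (D.dθ (e.basis b)) = if a = b then 1 else 0 := e.orthonormal
  have h' : ∀ a b, D.B (e.basis a) (D.dθ (e.basis b)) = if a = b then -1 else 0 := fun a b => by
    have := h a b
    split_ifs at this ⊢ <;> linarith
  simp only [ReductiveData.scal, vec, map_sum, map_smul, LinearMap.sum_apply, LinearMap.smul_apply, h',
    smul_eq_mul, mul_ite, mul_zero, Finset.sum_ite_eq', Finset.mem_univ, if_true]
  rw [← Finset.sum_neg_distrib]
  exact Finset.sum_congr rfl fun a _ => by ring

theorem normSq_vec (y : Fin m ⊕ Fin n → ℝ) : D.normSq (e.vec y) = ∑ a, y a ^ 2 := by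
  simp only [ReductiveData.normSq, scal_vec, pow_two]

theorem normSq_eq (Y : M) : D.normSq Y = ∑ a, e.coord a Y ^ 2 := by
  rw [← e.normSq_vec, vec_coord]

theorem contDiff_normSq (e : AdaptedBasis D m n) : ContDiff ℝ ∞ D.normSq := by
  have : D.normSq = fun Y => ∑ a, e.coord a Y ^ 2 := funext e.normSq_eq
  rw [this]
  exact ContDiff.sum fun a _ => (e.coord a).contDiff.pow 2

theorem contDiff_gauss (e : AdaptedBasis D m n) : ContDiff ℝ ∞ (fun Y => Real.exp (-D.normSq Y / 2)) :=
  (e.contDiff_normSq.neg.div_const 2).exp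

theorem fderiv_gauss_smul {f : M → V} {f' : M →L[ℝ] V} {Y : M} (hf : HasFDerivAt f f' Y)
    (a : Fin m ⊕ Fin n) :
    fderiv ℝ (fun Y => Real.exp (-D.normSq Y / 2) • f Y) Y (e.basis a) =
      Real.exp (-D.normSq Y / 2) • (f' (e.basis a) - e.coord a Y • f Y) := by
  have hN : HasFDerivAt D.normSq (∑ b, (2 * e.coord b Y) • e.coord b) Y := by
    have : D.normSq = fun Y => ∑ a, e.coord a Y ^ 2 := funext e.normSq_eq
    rw [this]
    refine HasFDerivAt.fun_sum fun b _ => ?_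
    simpa using (e.coord b).hasFDerivAt.pow 2
  have h1 : HasFDerivAt (fun Y => Real.exp (-D.normSq Y / 2))
      (Real.exp (-D.normSq Y / 2) • ((-1 / 2 : ℝ) • ∑ b, (2 * e.coord b Y) • e.coord b)) Y := by
    refine HasFDerivAt.exp ((hN.const_smul (-1 / 2 : ℝ)).congr_of_eventuallyEq
      (Filter.Eventually.of_forall fun Z => ?_))
    simp; ring
  rw [(h1.fun_smul hf).fderiv]
  have h2 : (∑ b, (2 * e.coord b Y) • e.coord b) (e.basis a) = 2 * e.coord a Y := by
    simp [-Fintype.sum_sum_type]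
  simp only [add_apply, smul_apply,
    ContinuousLinearMap.smulRight_apply, h2, smul_eq_mul]
  module

/-- The harmonic oscillator on `e^{-|Y|²/2}` times an affine function. -/
theorem oscillator_gauss_affine (x : V) (L : M →L[ℝ] V) (Y : M) :
    -(∑ a, fderiv ℝ (fun Z => fderiv ℝ (fun Z' => Real.exp (-D.normSq Z' / 2) • (x + L Z')) Z
        (e.basis a)) Y (e.basis a)) +
      (D.normSq Y - (m : ℝ) - (n : ℝ)) • (Real.exp (-D.normSq Y / 2) • (x + L Y)) =
      (2 : ℝ) • (Real.exp (-D.normSq Y / 2) • L Y) := by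
  have h1 : ∀ Z, HasFDerivAt (fun Z => x + L Z) L Z := fun Z => L.hasFDerivAt.const_add x
  have h2 : ∀ a, fderiv ℝ (fun Z => fderiv ℝ (fun Z' => Real.exp (-D.normSq Z' / 2) • (x + L Z')) Z
        (e.basis a)) Y (e.basis a) = Real.exp (-D.normSq Y / 2) •
        (-(x + L Y) - (2 : ℝ) • (e.coord a Y • L (e.basis a)) + e.coord a Y ^ 2 • (x + L Y)) := by
    intro a
    simp only [e.fderiv_gauss_smul (h1 _) a]
    have h3 : HasFDerivAt (fun Z => L (e.basis a) - e.coord a Z • (x + L Z))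
      (-(e.coord a Y • L + (e.coord a).smulRight (x + L Y))) Y :=
      ((e.coord a).hasFDerivAt.smul (h1 Y)).const_sub _
    rw [e.fderiv_gauss_smul h3]
    simp only [neg_apply, add_apply, smul_apply,
      ContinuousLinearMap.smulRight_apply, coord_basis, if_true]
    module
  simp only [h2]
  rw [← Finset.smul_sum, Finset.sum_add_distrib, Finset.sum_sub_distrib, ← Finset.smul_sum,
    ← Finset.sum_smul, ← e.normSq_eq]
  -- Euler's identity `∑ Y_a L(e_a) = L(Y)`: the cross terms of the Laplacian produce the eigenvalue
  -- 2 on the linear part.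
  have h4 := e.sum_coord_smul_map L.toLinearMap Y
  simp only [ContinuousLinearMap.coe_coe] at h4
  rw [h4]
  simp only [Finset.sum_const, Finset.card_univ, Fintype.card_sum, Fintype.card_fin, ← Nat.cast_smul_eq_nsmul ℝ]
  push_cast
  module

/-- In degree `p`, the constant part of the affine factor has eigenvalue `p` and the linear part `1
+ p`. The case `L = 0` gives the kernel and the case `x = 0` gives `α⁻¹β`. -/
theorem α_gauss_affine {φ : G → M → Forms M E} {g : G} {p : ℕ} (x : M [⋀^Fin p]→L[ℝ] E)
    (L : M →L[ℝ] M [⋀^Fin p]→L[ℝ] E)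
    (h : ∀ Y, φ g Y p = Real.exp (-D.normSq Y / 2) • (x + L Y)) (Y : M) :
    e.α φ g Y p = Real.exp (-D.normSq Y / 2) • (L Y + (p : ℝ) • (x + L Y)) := by
  have h1 := e.oscillator_gauss_affine x L Y
  have h2 : e.α φ g Y p = (1 / 2 : ℝ) • (-(∑ a, fderiv ℝ (fun Z => fderiv ℝ (fun Z' => φ g Z' p) Z
        (e.basis a)) Y (e.basis a)) + (D.normSq Y - (m : ℝ) - (n : ℝ)) • φ g Y p) + (p : ℝ) • φ g Y p := rfl
  rw [h2]
  simp only [h]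
  rw [h1]
  module

/-- Coordinates and a real functional `ℓ` reduce form-valued functions on `𝔤` to the scalar equation
on `ℝ^{m+n}` studied above. -/
theorem pd_comp_vec {f : M → V} (hf : Differentiable ℝ f) (ℓ : V →L[ℝ] ℝ) (a : Fin m ⊕ Fin n) :
    pd a (fun y => ℓ (f (e.vec y))) = fun y => ℓ (fderiv ℝ f (e.vec y) (e.basis a)) := by
  funext y
  have h := (ℓ.hasFDerivAt (x := f (e.vecL y))).comp y
    ((hf (e.vecL y)).hasFDerivAt.comp y e.vecL.hasFDerivAt)
  simp only [vecL_apply] at h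
  have h' : fderiv ℝ (fun y => ℓ (f (e.vec y))) y = _ := HasFDerivAt.fderiv (by
    refine h.congr_of_eventuallyEq (Filter.Eventually.of_forall fun z => ?_)
    simp [vecL_apply])
  rw [pd, h']
  simp [vecL]

/-- A smooth square integrable solution of `α φ = 0` along a fibre. -/
theorem eq_gauss_of_α_eq_zero {φ : G → M → Forms M E} {g : G} {p : ℕ}
    (hs : ContDiff ℝ ∞ (fun Y => φ g Y p)) (hL : MemLp (fun y => φ g (e.vec y) p) 2 volume)
    (h : ∀ Y, e.α φ g Y p = 0) (Y : M) :
    φ g Y p = Real.exp (-D.normSq Y / 2) • φ g 0 p ∧ (p ≠ 0 → φ g Y p = 0) := by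
  -- Continuous real functionals separate points, so it suffices to treat `ℓ ∘ φ`.
  have key : ∀ ℓ : (M [⋀^Fin p]→L[ℝ] E) →L[ℝ] ℝ, 
      ℓ (φ g Y p) = ℓ (Real.exp (-D.normSq Y / 2) • φ g 0 p) ∧ (p ≠ 0 → ℓ (φ g Y p) = ℓ 0) := by
    intro ℓ
    set u : (Fin m ⊕ Fin n → ℝ) → ℝ := fun y => ℓ (φ g (e.vec y) p) with hu
    have hus : ContDiff ℝ ∞ u := by
      have : u = fun y => ℓ (φ g (e.vecL y) p) := by funext y; simp [hu, vecL_apply]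
      rw [this]
      exact ℓ.contDiff.comp (hs.comp e.vecL.contDiff)
    have huL : MemLp u 2 volume := ℓ.comp_memLp' hL
    have hpd : ∀ a y, pd a (pd a u) y = ℓ (fderiv ℝ (fun Z => fderiv ℝ (fun Z' => φ g Z' p) Z
        (e.basis a)) (e.vec y) (e.basis a)) := by
      intro a y
      have hd : ContDiff ℝ ∞ (fun Z => fderiv ℝ (fun Z' => φ g Z' p) Z (e.basis a)) :=
        (hs.fderiv_right (m := ∞) (by simp)).clm_apply contDiff_const
      rw [hu, e.pd_comp_vec (hs.differentiable (by simp)),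
        e.pd_comp_vec (f := fun Z => fderiv ℝ (fun Z' => φ g Z' p) Z (e.basis a))
          (hd.differentiable (by simp))]
    -- Twice the equation `α φ = 0`, so the form degree `p` is the constant `c` of `annih_eq_zero`.
    have heq : ∀ y, -∑ a, pd a (pd a u) y +
        (∑ a, y a ^ 2 - Fintype.card (Fin m ⊕ Fin n) + 2 * (p : ℝ)) * u y = 0 := by
      intro y
      have h2 : e.α φ g (e.vec y) p = (1 / 2 : ℝ) • (-(∑ a, fderiv ℝ (fun Z => fderiv ℝ (fun Z' => φ g Z' p) Z
        (e.basis a)) (e.vec y) (e.basis a)) + (D.normSq (e.vec y) - (m : ℝ) - (n : ℝ)) • φ g (e.vec y) p) +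
        (p : ℝ) • φ g (e.vec y) p := rfl
      have h3 := congrArg ℓ ((h (e.vec y)).symm.trans h2)
      simp only [map_zero, map_add, map_smul, map_neg, map_sum, ← hpd, normSq_vec, smul_eq_mul] at h3
      have h4 : ℓ (φ g (e.vec y) p) = u y := rfl
      rw [h4] at h3
      simp only [Fintype.card_sum, Fintype.card_fin]
      push_cast
      linarith
    have h5 := annih_eq_zero hus huL (Nat.cast_nonneg p) heq
    have h6 : ∀ y, ∑ a, annih a u y ^ 2 = 0 ∧ (p : ℝ) * u y ^ 2 = 0 := by
      intro y
      have h7 : 0 ≤ ∑ a, annih a u y ^ 2 := Finset.sum_nonneg fun a _ => sq_nonneg _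
      have h8 : 0 ≤ (p : ℝ) * u y ^ 2 := by positivity
      have := h5 y
      constructor <;> linarith
    have h9 : ∀ a y, annih a u y = 0 := by
      intro a y
      have := (Finset.sum_eq_zero_iff_of_nonneg (fun a _ => sq_nonneg (annih a u y))).1 (h6 y).1 a (Finset.mem_univ a)
      simpa using this
    have h10 := eq_gaussian_of_annih hus h9 (fun a => e.coord a Y)
    have h11 := (h6 (fun a => e.coord a Y)).2
    have h12 : u (fun a => e.coord a Y) = ℓ (φ g Y p) := by simp only [hu, vec_coord]
    have h13 : u 0 = ℓ (φ g 0 p) := by simp [hu, vec]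
    rw [h12, h13, ← normSq_eq] at h10
    rw [h12] at h11
    refine ⟨by simpa using h10, fun hp => ?_⟩
    rw [map_zero]
    simpa [hp] using h11
  exact ⟨(SeparatingDual.eq_iff_forall_dual_eq (R := ℝ)).2 fun ℓ => (key ℓ).1,
    fun hp => (SeparatingDual.eq_iff_forall_dual_eq (R := ℝ)).2 fun ℓ => (key ℓ).2 hp⟩

end AdaptedBasis
end
end HypoLap
end

/-! ### The space `H^⊥` and the injectivity of `α` on it -/

noncomputable section
namespace HypoLap
set_option linter.unusedSectionVars false
section
variable {M : Type*} [NormedAddCommGroup M] [NormedSpace ℝ M] [FiniteDimensional ℝ M]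
  {G : Type*} [TopologicalSpace G] [ChartedSpace M G] [Group G] [LieGroup 𝓘(ℝ, M) ∞ G]
  {N : Type*} [NormedAddCommGroup N] [NormedSpace ℝ N]
  {K : Type*} [TopologicalSpace K] [ChartedSpace N K] [Group K]
  {E : Type*} [NormedAddCommGroup E] [InnerProductSpace ℂ E]
  {V : Type*} [NormedAddCommGroup V] [NormedSpace ℝ V]

open MeasureTheory

theorem ReductiveData.normSq_Ad_incl_inv (D : ReductiveData M G N K) (k : K) (Y : M) :
    D.normSq (Ad (D.incl k)⁻¹ Y) = D.normSq Y := by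
  simp only [ReductiveData.normSq, ReductiveData.scal, D.dθ_Ad_incl_inv, D.B_Ad]

namespace AdaptedBasis
variable {D : ReductiveData M G N K} {m n : ℕ} (e : AdaptedBasis D m n)

theorem memLp_list_prod_gauss_smul (l : List (Fin m ⊕ Fin n)) (x : V) :
    MemLp (fun y : Fin m ⊕ Fin n → ℝ =>
      ((l.map y).prod * Real.exp (-D.normSq (e.vec y) / 2)) • x) 2 volume := by
  simp only [e.normSq_vec]
  exact ((ContinuousLinearMap.id ℝ ℝ).smulRight x).comp_memLp' (memLp_list_prod_mul_exp l)

/-- A product of two square integrable functions is integrable. -/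
theorem integrable_gauss_smul {f : (Fin m ⊕ Fin n → ℝ) → V} (hf : MemLp f 2 volume) :
    Integrable (fun y => Real.exp (-D.normSq (e.vec y) / 2) • f y) volume := by
  have h := memLp_list_prod_mul_exp ([] : List (Fin m ⊕ Fin n))
  simp only [List.map_nil, List.prod_nil, one_mul] at h
  simp only [e.normSq_vec]
  exact memLp_one_iff_integrable.1 (MemLp.smul hf h)

theorem formInner_degZero (x : E) (w : Forms M E) :
    e.formInner (degZero x) w = inner ℂ x (w 0 ![]) := by
  rw [formInner, Finset.sum_eq_single 0]
  · simp only [Nat.factorial_zero, Nat.cast_one, inv_one, one_mul, degZero_zero_apply,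
      Finset.univ_unique, Finset.sum_singleton]
    rw [Subsingleton.elim (fun i => e.basis ((default : Fin 0 → Fin m ⊕ Fin n) i)) ![]]
  · intro p _ hp
    obtain ⟨q, rfl⟩ := Nat.exists_eq_succ_of_ne_zero hp
    simp
  · simp

/-- The product along a fibre with an element of `e^{-|Y|²/2} ⊗ E`. -/
theorem fibreInner_gauss [CompleteSpace E] {u : M → Forms M E}
    (hu : MemLp (fun y => u (e.vec y) 0 ![]) 2 volume) (x : E) :
    e.fibreInner (fun Y => degZero (Real.exp (-D.normSq Y / 2) • x)) u =
      inner ℂ x (∫ y, Real.exp (-D.normSq (e.vec y) / 2) • u (e.vec y) 0 ![]) := by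
  rw [← integral_inner (e.integrable_gauss_smul hu)]
  refine integral_congr_ae (Filter.Eventually.of_forall fun y => ?_)
  simp only [formInner_degZero]
  rw [inner_smul_left_eq_smul, inner_smul_right_eq_smul]

theorem memLp_degree_zero {φ : G → M → Forms M E} (h : e.FibreL2 φ) (g : G) :
    MemLp (fun y => φ g (e.vec y) 0 ![]) 2 volume :=
  (ContinuousAlternatingMap.apply ℝ M E ![]).comp_memLp' (h g 0)

theorem integral_gauss_smul_eq_zero [CompleteSpace E] {ρ : K →* (E ≃ₗᵢ[ℂ] E)} {φ : G → M → Forms M E}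
    (h : e.InHperp ρ φ) (g : G) :
    ∫ y, Real.exp (-D.normSq (e.vec y) / 2) • φ g (e.vec y) 0 ![] = 0 := by
  refine ext_inner_left ℂ fun x => ?_
  rw [inner_zero_right, ← e.fibreInner_gauss (e.memLp_degree_zero h.fibreL2 g), h.orthogonal]

theorem map_vec {W : Type*} [AddCommGroup W] [Module ℝ W] (T : M →ₗ[ℝ] W) (y : Fin m ⊕ Fin n → ℝ) :
    T (e.vec y) = ∑ a, y a • T (e.basis a) := by
  rw [vec, map_sum]
  exact Finset.sum_congr rfl fun a _ => map_smul _ _ _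

theorem map_vec_apply (T : M →ₗ[ℝ] Forms M E) (y : Fin m ⊕ Fin n → ℝ) (p : ℕ) :
    T (e.vec y) p = ∑ a, y a • T (e.basis a) p :=
  e.map_vec (LinearMap.proj p ∘ₗ T) y


theorem exp_mul_exp_normSq (y : Fin m ⊕ Fin n → ℝ) :
    Real.exp (-D.normSq (e.vec y) / 2) * Real.exp (-D.normSq (e.vec y) / 2) =
      Real.exp (-∑ i, y i ^ 2) := by
  rw [← Real.exp_add, e.normSq_vec]
  ring_nf

theorem integrable_list_prod_smul (l : List (Fin m ⊕ Fin n)) (x : V) :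
    Integrable (fun y : Fin m ⊕ Fin n → ℝ => ((l.map y).prod * Real.exp (-∑ i, y i ^ 2)) • x)
      volume :=
  (integrable_list_prod_mul_exp l).smul_const x

/-- First moments of a Gaussian vanish. This is the orthogonality to `H` of `β h` and of `α⁻¹β h`.
-/
theorem integral_gauss_smul_gauss_linear [CompleteSpace V] (c : ℝ) (T : M →ₗ[ℝ] V) :
    ∫ y, Real.exp (-D.normSq (e.vec y) / 2) •
      ((c * Real.exp (-D.normSq (e.vec y) / 2)) • T (e.vec y)) = 0 := by
  have h : ∀ y, Real.exp (-D.normSq (e.vec y) / 2) •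
      ((c * Real.exp (-D.normSq (e.vec y) / 2)) • T (e.vec y)) =
      ∑ a, (y a * Real.exp (-∑ i, y i ^ 2)) • (c • T (e.basis a)) := by
    intro y
    rw [smul_smul, mul_left_comm, exp_mul_exp_normSq, map_vec, Finset.smul_sum]
    refine Finset.sum_congr rfl fun a _ => ?_
    module
  simp only [h]
  rw [integral_finsetSum]
  · refine Finset.sum_eq_zero fun a _ => ?_
    rw [integral_smul_const, integral_coord_mul_exp, zero_smul]
  · intro a _
    simpa using integrable_list_prod_smul [a] (c • T (e.basis a))

theorem integral_gauss_smul_gauss [CompleteSpace V] (x : V) :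
    ∫ y, Real.exp (-D.normSq (e.vec y) / 2) • (Real.exp (-D.normSq (e.vec y) / 2) • x) =
      (√Real.pi ^ (m + n)) • x := by
  simp only [smul_smul, exp_mul_exp_normSq]
  rw [integral_smul_const, integral_exp_neg_sum_sq, Fintype.card_sum, Fintype.card_fin,
    Fintype.card_fin]

theorem memLp_gauss_linear (c : ℝ) (T : M →ₗ[ℝ] V) :
    MemLp (fun y => (c * Real.exp (-D.normSq (e.vec y) / 2)) • T (e.vec y)) 2 volume := by
  have h : ∀ y, (c * Real.exp (-D.normSq (e.vec y) / 2)) • T (e.vec y) =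
      ∑ a, (y a * Real.exp (-D.normSq (e.vec y) / 2)) • (c • T (e.basis a)) := by
    intro y
    rw [map_vec, Finset.smul_sum]
    refine Finset.sum_congr rfl fun a _ => ?_
    module
  simp only [h]
  refine memLp_finsetSum _ fun a _ => ?_
  simpa using e.memLp_list_prod_gauss_smul [a] (c • T (e.basis a))

/-- Membership in `H^⊥` for both `β h` and `α⁻¹β h`: orthogonality is parity, and equivariance is
that of `T`, because `|Y|²` is invariant under `K`. -/
theorem inHperp_gauss_linear [FiniteDimensional ℂ E] {ρ : K →* (E ≃ₗᵢ[ℂ] E)} (c : ℝ)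
    {T : G → M →ₗ[ℝ] Forms M E}
    (hT : ∀ u p, ContMDiff 𝓘(ℝ, M) 𝓘(ℝ, M [⋀^Fin p]→L[ℝ] E) ∞ (fun g => T g u p))
    (hT' : ∀ (k : K) (g : G) (u : M), T (g * D.incl k) (Ad (D.incl k)⁻¹ u) =
      actE ((ρ k⁻¹ : E ≃ₗᵢ[ℂ] E) : E →L[ℂ] E) (pull (Ad (D.incl k)) (T g u))) :
    e.InHperp ρ (fun g Y => (c * Real.exp (-D.normSq Y / 2)) • T g Y) := by
  have hL2 : e.FibreL2 (fun g Y => (c * Real.exp (-D.normSq Y / 2)) • T g Y) :=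
    fun g p => by
      let L : M →ₗ[ℝ] M [⋀^Fin p]→L[ℝ] E := LinearMap.proj p ∘ₗ T g
      exact e.memLp_gauss_linear c L
  refine ⟨⟨fun p => ?_, fun k g Y => ?_⟩, hL2, fun g x => ?_⟩
  · have h : ∀ x : G × M, ((c * Real.exp (-D.normSq x.2 / 2)) • T x.1 x.2) p =
        ∑ a, (c * Real.exp (-D.normSq x.2 / 2) * e.coord a x.2) • T x.1 (e.basis a) p := by
      intro x
      have h := e.map_vec_apply (T x.1) (fun a => e.coord a x.2) p
      rw [vec_coord] at h
      rw [Pi.smul_apply, h, Finset.smul_sum]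
      exact Finset.sum_congr rfl fun a _ => smul_smul _ _ _
    simp only [h]
    refine ContMDiff.sum fun a _ => ?_
    have h1 : ContMDiff (𝓘(ℝ, M).prod 𝓘(ℝ, M)) 𝓘(ℝ, M [⋀^Fin p]→L[ℝ] E) ∞
        (fun x : G × M => T x.1 (e.basis a) p) := (hT _ p).comp contMDiff_fst
    have h2 : ContDiff ℝ ∞ (fun Y => c * Real.exp (-D.normSq Y / 2) * e.coord a Y) :=
      (contDiff_const.mul e.contDiff_gauss).mul (e.coord a).contDiff
    have h3 : ContMDiff (𝓘(ℝ, M).prod 𝓘(ℝ, M)) 𝓘(ℝ, ℝ) ∞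
        (fun x : G × M => c * Real.exp (-D.normSq x.2 / 2) * e.coord a x.2) :=
      h2.contMDiff.comp contMDiff_snd
    exact h3.smul h1
  · simp only [D.normSq_Ad_incl_inv, hT']
    exact (map_smul (actEL _) _ (pull _ _)).symm
  · rw [e.fibreInner_gauss (e.memLp_degree_zero hL2 g)]
    have h := e.integral_gauss_smul_gauss_linear c
      ((ContinuousAlternatingMap.apply ℝ M E ![]).toLinearMap ∘ₗ LinearMap.proj 0 ∘ₗ T g)
    rw [← inner_zero_right x, ← h]
    rfl

/-- `α` is injective on `H^⊥`. -/
theorem eq_of_α_eq [FiniteDimensional ℂ E] {ρ : K →* (E ≃ₗᵢ[ℂ] E)} {φ ψ : G → M → Forms M E}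
    (hφ : e.InHperp ρ φ) (hψ : e.InHperp ρ ψ) (h : e.α φ = e.α ψ) : φ = ψ := by
  have hc : ∀ {φ : G → M → Forms M E}, e.InHperp ρ φ → ∀ g p, ContDiff ℝ ∞ (fun Y => φ g Y p) :=
    fun h g p => contDiff_fibre (h.isSection.smooth p) g
  have hd : ∀ {φ : G → M → Forms M E}, e.InHperp ρ φ → ∀ g p Y,
      DifferentiableAt ℝ (fun Y => φ g Y p) Y :=
    fun h g p Y => (hc h g p).differentiable (by simp) Y
  have hd' : ∀ {φ : G → M → Forms M E}, e.InHperp ρ φ → ∀ g p v Y,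
      DifferentiableAt ℝ (fun Z => fderiv ℝ (fun Z' => φ g Z' p) Z v) Y := by
    intro φ h g p v Y
    have : ContDiff ℝ ∞ (fun Z => fderiv ℝ (fun Z' => φ g Z' p) Z v) :=
      ((hc h g p).fderiv_right (m := ∞) (by simp)).clm_apply contDiff_const
    exact this.differentiable (by simp) Y
  have hα : ∀ g Y p, e.α (φ - ψ) g Y p = 0 := by
    intro g Y p
    have h1 : ∀ χ : G → M → Forms M E, e.α χ g Y p =
      (1 / 2 : ℝ) • (-(∑ a, fderiv ℝ (fun Z => fderiv ℝ (fun Z' => χ g Z' p) Z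
        (e.basis a)) Y (e.basis a)) + (D.normSq Y - (m : ℝ) - (n : ℝ)) • χ g Y p) + (p : ℝ) • χ g Y p :=
      fun _ => rfl
    have h2 : ∀ a, fderiv ℝ (fun Z => fderiv ℝ (fun Z' => (φ - ψ) g Z' p) Z (e.basis a)) Y (e.basis a) =
        fderiv ℝ (fun Z => fderiv ℝ (fun Z' => φ g Z' p) Z (e.basis a)) Y (e.basis a) -
        fderiv ℝ (fun Z => fderiv ℝ (fun Z' => ψ g Z' p) Z (e.basis a)) Y (e.basis a) := by
      intro a
      simp only [Pi.sub_apply]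
      simp only [fderiv_fun_sub (hd hφ g p _) (hd hψ g p _), sub_apply]
      rw [fderiv_fun_sub (hd' hφ g p _ _) (hd' hψ g p _ _), sub_apply]
    have h3 : e.α φ g Y p - e.α ψ g Y p = 0 := by rw [h, sub_self]
    rw [← h3]
    rw [h1 (φ - ψ), h1 φ, h1 ψ, Finset.sum_congr rfl fun a _ => h2 a, Finset.sum_sub_distrib]
    simp only [Pi.sub_apply]
    module
  funext g Y p
  have hs : ContDiff ℝ ∞ (fun Y => (φ - ψ) g Y p) := (hc hφ g p).sub (hc hψ g p)
  have hL : MemLp (fun y => (φ - ψ) g (e.vec y) p) 2 volume := (hφ.fibreL2 g p).sub (hψ.fibreL2 g p)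
  have key := fun Y => e.eq_gauss_of_α_eq_zero hs hL (fun Y => hα g Y p) Y
  rw [← sub_eq_zero]
  change (φ - ψ) g Y p = 0
  -- In positive degree the difference already vanishes. In degree 0 it is a multiple of the
  -- Gaussian, and it is also orthogonal to the Gaussian.
  rcases Nat.eq_zero_or_pos p with rfl | hp
  · have h0 : ∫ y, Real.exp (-D.normSq (e.vec y) / 2) • (φ - ψ) g (e.vec y) 0 ![] = 0 := by
      have h1 := e.integrable_gauss_smul (e.memLp_degree_zero hφ.fibreL2 g)
      have h2 := e.integrable_gauss_smul (e.memLp_degree_zero hψ.fibreL2 g)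
      have h3 := integral_sub h1 h2
      rw [e.integral_gauss_smul_eq_zero hφ, e.integral_gauss_smul_eq_zero hψ, sub_zero] at h3
      rw [← h3]
      refine integral_congr_ae (Filter.Eventually.of_forall fun y => ?_)
      simp [smul_sub]
    have h6 : ∀ y, (φ - ψ) g (e.vec y) 0 ![] =
        Real.exp (-D.normSq (e.vec y) / 2) • (φ - ψ) g 0 0 ![] := fun y => by
      rw [(key (e.vec y)).1]; rfl
    simp only [h6] at h0
    rw [e.integral_gauss_smul_gauss] at h0
    have h4 : (φ - ψ) g 0 0 ![] = 0 := by
      refine (smul_eq_zero.1 h0).resolve_left (pow_ne_zero _ ?_)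
      exact (Real.sqrt_pos.2 Real.pi_pos).ne'
    have h5 : (φ - ψ) g 0 0 = 0 := by
      ext v
      rw [Subsingleton.elim v ![], h4]
      rfl
    rw [(key Y).1, h5, smul_zero]
  · exact (key Y).2 hp.ne'

end AdaptedBasis
end
end HypoLap
end

/-! ### `β` on `H`, the explicit `α⁻¹β`, and `P` on `H` -/

noncomputable section
namespace HypoLap
set_option linter.unusedSectionVars false
section
variable {M : Type*} [NormedAddCommGroup M] [NormedSpace ℝ M] [FiniteDimensional ℝ M]
  {G : Type*} [TopologicalSpace G] [ChartedSpace M G] [Group G] [LieGroup 𝓘(ℝ, M) ∞ G]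
  {N : Type*} [NormedAddCommGroup N] [NormedSpace ℝ N]
  {K : Type*} [TopologicalSpace K] [ChartedSpace N K] [Group K]
  {E : Type*} [NormedAddCommGroup E] [InnerProductSpace ℂ E]
  {V : Type*} [NormedAddCommGroup V] [NormedSpace ℝ V]

open MeasureTheory

/-- `(1 + N^{Λ^•})⁻¹`. -/
def numInv : Forms M E →ₗ[ℝ] Forms M E where
  toFun w p := (1 + (p : ℝ))⁻¹ • w p
  map_add' w w' := by funext p; simp
  map_smul' c w := by funext p; simp [smul_comm c]

theorem numInv_apply (w : Forms M E) (p : ℕ) : numInv w p = (1 + (p : ℝ))⁻¹ • w p := rfl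

theorem numInv_actE_pull (T : E →L[ℂ] E) (A : M →L[ℝ] M) (w : Forms M E) :
    numInv (actE T (pull A w)) = actE T (pull A (numInv w)) := by
  funext p
  exact (congrFun (map_smul (actEL T) (1 + (p : ℝ))⁻¹ (pull A w)) p).symm

theorem contMDiff_degZero {s : G → E} (hs : ContMDiff 𝓘(ℝ, M) 𝓘(ℝ, E) ∞ s) (p : ℕ) :
    ContMDiff 𝓘(ℝ, M) 𝓘(ℝ, M [⋀^Fin p]→L[ℝ] E) ∞ (fun g => degZero (M := M) (s g) p) := by
  cases p with
  | zero =>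
    exact ((ContinuousAlternatingMap.constOfIsEmptyLIE ℝ M E (Fin 0)).toContinuousLinearEquiv
      : E →L[ℝ] M [⋀^Fin 0]→L[ℝ] E).contDiff.contMDiff.comp hs
  | succ p => exact contMDiff_const

theorem ReductiveData.B_ad_Ad_incl_inv (D : ReductiveData M G N K) (g : G) (u v w : M) :
    D.B (D.ad (Ad g⁻¹ u) v) w = D.B (D.ad u (Ad g v)) (Ad g w) := by
  conv_lhs => rw [← Ad_inv_Ad g v, ← Ad_inv_Ad g w, ← D.Ad_ad, D.B_Ad]

theorem ReductiveData.B_dθ_ad_Ad_incl_inv (D : ReductiveData M G N K) (k : K) (u v w : M) :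
    D.B (D.dθ (D.ad (Ad (D.incl k)⁻¹ u) v)) w =
      D.B (D.dθ (D.ad u (Ad (D.incl k) v))) (Ad (D.incl k) w) := by
  conv_lhs => rw [← Ad_inv_Ad (D.incl k) v, ← Ad_inv_Ad (D.incl k) w, ← D.Ad_ad,
    D.dθ_Ad_incl_inv, D.B_Ad]

namespace AdaptedBasis
variable {D : ReductiveData M G N K} {m n : ℕ} (e : AdaptedBasis D m n)

/-- The operator `β` with `Y` frozen, as a linear function of `Y`. -/
def firstOrder (ρ : K →* (E ≃ₗᵢ[ℂ] E)) (w : G → Forms M E) (g : G) : M →ₗ[ℝ] Forms M E :=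
  LinearMap.pi (fun p => leftDerivL (fun h => w h p) g ∘ₗ D.projP) + (e.zeroOrder ρ).flip (w g)

theorem firstOrder_apply (ρ : K →* (E ≃ₗᵢ[ℂ] E)) (w : G → Forms M E) (g : G) (u : M) (p : ℕ) :
    e.firstOrder ρ w g u p =
      leftDeriv (D.projP u) (fun h => w h p) g + e.zeroOrder ρ u (w g) p := rfl

/-- `β` contains no derivative in `Y`, so `Y` can be frozen both in the scalar factor and in `w`. -/
theorem β_smul (ρ : K →* (E ≃ₗᵢ[ℂ] E)) (f : M → ℝ) {w : M → G → Forms M E} {g : G} {Y : M}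
    (hw : ∀ p, MDifferentiableAt 𝓘(ℝ, M) 𝓘(ℝ, M [⋀^Fin p]→L[ℝ] E) (fun h => w Y h p) g) :
    e.β ρ (fun h Z => f Z • w Z h) g Y = f Y • e.firstOrder ρ (w Y) g Y := by
  rw [β_eq, map_smul]
  funext p
  simp only [Pi.add_apply, Pi.smul_apply, nablaY, firstOrder_apply, smul_add]
  rw [leftDeriv_const_smul_fun (hw p)]

theorem embed_eq (s : G → E) : e.embed s = fun g Y =>
    (Real.pi ^ (-((m : ℝ) + n) / 4) * Real.exp (-D.normSq Y / 2)) • degZero (s g) := by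
  funext g Y
  exact degZero_smul _ _

section Section
variable {ρ : K →* (E ≃ₗᵢ[ℂ] E)} {s : G → E}

theorem β_embed (hs : IsSectionX D ρ s) : e.β ρ (e.embed s) = fun g Y =>
    (Real.pi ^ (-((m : ℝ) + n) / 4) * Real.exp (-D.normSq Y / 2)) •
      e.firstOrder ρ (fun h => degZero (s h)) g Y := by
  funext g Y
  rw [embed_eq]
  exact e.β_smul ρ (fun Y => Real.pi ^ (-((m : ℝ) + n) / 4) * Real.exp (-D.normSq Y / 2))
    (w := fun _ h => degZero (s h)) fun p => (contMDiff_degZero hs.smooth p).mdifferentiableAt (by simp)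

/-- The Clifford terms have no degree 0 component on scalars, and `-iρ^E(Y^𝔨) s = i Y^𝔨 s` by
`dRep_section`. -/
theorem firstOrder_degZero_zero
    (hρ : ContMDiff 𝓘(ℝ, N) 𝓘(ℝ, E →L[ℂ] E) ∞ (fun k : K => ((ρ k : E ≃ₗᵢ[ℂ] E) : E →L[ℂ] E)))
    (hs : IsSectionX D ρ s) (g : G) (u : M) :
    e.firstOrder ρ (fun h => degZero (s h)) g u 0 ![] =
      leftDeriv (D.projP u) s g + Complex.I • leftDeriv (D.projK u) s g := by
  have h := leftDeriv_clm_comp ((ContinuousAlternatingMap.constOfIsEmptyLIE ℝ M E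
    (Fin 0)).toContinuousLinearEquiv : E →L[ℝ] M [⋀^Fin 0]→L[ℝ] E) (f := s) (g := g)
    (hs.smooth.mdifferentiableAt (by simp)) (D.projP u)
  have h' : leftDeriv (D.projP u) (fun h => degZero (M := M) (s h) 0) g ![] = 
    leftDeriv (D.projP u) s g := congrArg (fun w => w ![]) h
  rw [firstOrder_apply, ContinuousAlternatingMap.add_apply, zeroOrder_degZero_zero, h',
    D.dRep_section hρ hs (D.dθ_projK u)]
  simp

theorem firstOrder_degZero_succ (ρ : K →* (E ≃ₗᵢ[ℂ] E)) (s : G → E) (g : G) (u : M) (p : ℕ) :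
    e.firstOrder ρ (fun h => degZero (s h)) g u (p + 1) =
      e.zeroOrder ρ u (degZero (s g)) (p + 1) := by
  rw [firstOrder_apply]
  simp only [degZero_succ, leftDeriv_zero_fun, zero_add]

theorem firstOrder_degZero_two (ρ : K →* (E ≃ₗᵢ[ℂ] E)) (s : G → E) (g : G) (u v w : M) :
    e.firstOrder ρ (fun h => degZero (s h)) g u 2 ![v, w] =
      -(D.B (D.ad (D.projP u) v) w • s g) -
        (1 / 2 * D.B (D.dθ (D.ad (D.projK u) v)) w) • (Complex.I • s g) := by
  rw [e.firstOrder_degZero_succ ρ s g u 1, zeroOrder_degZero_two]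

theorem contMDiff_firstOrder_degZero [FiniteDimensional ℂ E] (hs : IsSectionX D ρ s) (u : M) (p : ℕ) :
    ContMDiff 𝓘(ℝ, M) 𝓘(ℝ, M [⋀^Fin p]→L[ℝ] E) ∞
      (fun g => e.firstOrder ρ (fun h => degZero (s h)) g u p) := by
  have : FiniteDimensional ℝ E := FiniteDimensional.complexToReal E
  let L : E →ₗ[ℝ] M [⋀^Fin p]→L[ℝ] E := LinearMap.proj p ∘ₗ e.zeroOrder ρ u ∘ₗ degZeroL
  have h1 : ContMDiff 𝓘(ℝ, M) 𝓘(ℝ, M [⋀^Fin p]→L[ℝ] E) ∞ (fun g => L (s g)) :=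
    (LinearMap.toContinuousLinearMap L).contDiff.contMDiff.comp hs.smooth
  exact (contMDiff_leftDeriv (contMDiff_degZero hs.smooth p) (D.projP u)).add h1

/-- Only degrees 0 and 2 are nonzero. Equivariance comes from that of `s` and its derivatives in
degree 0, and from the invariance of `B`, `θ` and the bracket in degree 2. -/
theorem firstOrder_degZero_equivariant
    (hρ : ContMDiff 𝓘(ℝ, N) 𝓘(ℝ, E →L[ℂ] E) ∞ (fun k : K => ((ρ k : E ≃ₗᵢ[ℂ] E) : E →L[ℂ] E)))
    (hs : IsSectionX D ρ s) (k : K) (g : G) (u : M) :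
    e.firstOrder ρ (fun h => degZero (s h)) (g * D.incl k) (Ad (D.incl k)⁻¹ u) =
      actE ((ρ k⁻¹ : E ≃ₗᵢ[ℂ] E) : E →L[ℂ] E)
        (pull (Ad (D.incl k)) (e.firstOrder ρ (fun h => degZero (s h)) g u)) := by
  funext p
  ext v
  change _ = (ρ k⁻¹) (e.firstOrder ρ (fun h => degZero (s h)) g u p (Ad (D.incl k) ∘ v))
  match p, v with
  | 0, v =>
    rw [Subsingleton.elim v ![], Subsingleton.elim (Ad (D.incl k) ∘ ![]) ![],
      firstOrder_degZero_zero e hρ hs, firstOrder_degZero_zero e hρ hs, D.projP_Ad_incl_inv,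
      D.projK_Ad_incl_inv, D.leftDeriv_section hs, D.leftDeriv_section hs, map_add, map_smul]
  | 1, v =>
    rw [firstOrder_degZero_succ, firstOrder_degZero_succ, zeroOrder_degZero_of_ne _ _ _ _ _ (by simp) (by simp),
      zeroOrder_degZero_of_ne _ _ _ _ _ (by simp) (by simp)]
    simp
  | 2, v =>
    have hv : v = ![v 0, v 1] := by ext i; fin_cases i <;> rfl
    have hv' : Ad (D.incl k) ∘ v = ![Ad (D.incl k) (v 0), Ad (D.incl k) (v 1)] := by
      ext i; fin_cases i <;> rfl
    rw [hv', hv, firstOrder_degZero_two, firstOrder_degZero_two,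
      D.projP_Ad_incl_inv, D.projK_Ad_incl_inv, D.B_ad_Ad_incl_inv, D.B_dθ_ad_Ad_incl_inv, hs.equivariant]
    have hr : ∀ (c : ℝ) (x : E), (ρ k⁻¹) (c • x) = c • (ρ k⁻¹) x := fun c x =>
      (((ρ k⁻¹ : E ≃ₗᵢ[ℂ] E) : E →L[ℂ] E).restrictScalars ℝ).map_smul c x
    rw [map_sub, map_neg, hr, hr, map_smul]
    rfl
  | p + 3, v =>
    rw [firstOrder_degZero_succ, firstOrder_degZero_succ, zeroOrder_degZero_of_ne _ _ _ _ _ (by simp) (by simp),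
      zeroOrder_degZero_of_ne _ _ _ _ _ (by simp) (by simp)]
    simp

/-- `α⁻¹ β` on the image of the embedding. -/
def invβ (ρ : K →* (E ≃ₗᵢ[ℂ] E)) (s : G → E) : G → M → Forms M E := fun g Y =>
  (Real.pi ^ (-((m : ℝ) + n) / 4) * Real.exp (-D.normSq Y / 2)) •
    numInv (e.firstOrder ρ (fun h => degZero (s h)) g Y)

/-- The factor `(1 + p)⁻¹` of `numInv` cancels the eigenvalue of `α` on a Gaussian times a linear
form of degree `p`. -/
theorem α_invβ (ρ : K →* (E ≃ₗᵢ[ℂ] E)) (hs : IsSectionX D ρ s) : e.α (e.invβ ρ s) = e.β ρ (e.embed s) := by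
  rw [e.β_embed hs]
  funext g Y p
  let L₀ : M →ₗ[ℝ] M [⋀^Fin p]→L[ℝ] E := LinearMap.proj p ∘ₗ numInv ∘ₗ
    e.firstOrder ρ (fun h => degZero (s h)) g
  have h := e.α_gauss_affine (φ := e.invβ ρ s) (g := g) (p := p) 0
    ((Real.pi ^ (-((m : ℝ) + n) / 4)) • LinearMap.toContinuousLinearMap L₀) (fun Y => by
      rw [zero_add, smul_apply, smul_smul, mul_comm]
      rfl) Y
  rw [h]
  have h2 : L₀ Y = (1 + (p : ℝ))⁻¹ • e.firstOrder ρ (fun h => degZero (s h)) g Y p := rfl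
  have h3 : (1 + (p : ℝ)) * (1 + (p : ℝ))⁻¹ = 1 := mul_inv_cancel₀ (by positivity)
  simp only [zero_add, smul_apply, LinearMap.coe_toContinuousLinearMap', h2, Pi.smul_apply]
  generalize e.firstOrder ρ (fun h => degZero (s h)) g Y p = w
  simp only [smul_smul, ← add_smul]
  congr 1
  linear_combination (Real.exp (-D.normSq Y / 2) * Real.pi ^ (-((m : ℝ) + n) / 4)) * h3

theorem inHperp_β_embed [FiniteDimensional ℂ E] 
    (hρ : ContMDiff 𝓘(ℝ, N) 𝓘(ℝ, E →L[ℂ] E) ∞ (fun k : K => ((ρ k : E ≃ₗᵢ[ℂ] E) : E →L[ℂ] E)))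
    (hs : IsSectionX D ρ s) : e.InHperp ρ (e.β ρ (e.embed s)) := by
  rw [e.β_embed hs]
  exact e.inHperp_gauss_linear _ (fun u p => e.contMDiff_firstOrder_degZero hs u p)
    (e.firstOrder_degZero_equivariant hρ hs)

theorem inHperp_invβ [FiniteDimensional ℂ E] 
    (hρ : ContMDiff 𝓘(ℝ, N) 𝓘(ℝ, E →L[ℂ] E) ∞ (fun k : K => ((ρ k : E ≃ₗᵢ[ℂ] E) : E →L[ℂ] E)))
    (hs : IsSectionX D ρ s) : e.InHperp ρ (e.invβ ρ s) := by
  refine e.inHperp_gauss_linear _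
    (T := fun g => numInv ∘ₗ e.firstOrder ρ (fun h => degZero (s h)) g) (fun u p => ?_) (fun k g u => ?_)
  · have h1 : ContMDiff 𝓘(ℝ, M) 𝓘(ℝ, ℝ) ∞ (fun _ : G => (1 + (p : ℝ))⁻¹) := contMDiff_const
    exact h1.smul (e.contMDiff_firstOrder_degZero hs u p)
  · simp only [LinearMap.comp_apply, e.firstOrder_degZero_equivariant hρ hs, numInv_actE_pull]

theorem existsUnique_α_eq_β_embed [FiniteDimensional ℂ E] 
    (hρ : ContMDiff 𝓘(ℝ, N) 𝓘(ℝ, E →L[ℂ] E) ∞ (fun k : K => ((ρ k : E ≃ₗᵢ[ℂ] E) : E →L[ℂ] E)))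
    (hs : IsSectionX D ρ s) : ∃! v, e.InHperp ρ v ∧ e.α v = e.β ρ (e.embed s) :=
  ⟨e.invβ ρ s, ⟨e.inHperp_invβ hρ hs, e.α_invβ ρ hs⟩, fun _ hv =>
    e.eq_of_α_eq hv.1 (e.inHperp_invβ hρ hs) (hv.2.trans (e.α_invβ ρ hs).symm)⟩

theorem αInv_β_embed [FiniteDimensional ℂ E] 
    (hρ : ContMDiff 𝓘(ℝ, N) 𝓘(ℝ, E →L[ℂ] E) ∞ (fun k : K => ((ρ k : E ≃ₗᵢ[ℂ] E) : E →L[ℂ] E)))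
    (hs : IsSectionX D ρ s) : e.αInv ρ (e.β ρ (e.embed s)) = e.invβ ρ s := by
  have h := e.existsUnique_α_eq_β_embed hρ hs
  rw [αInv, dif_pos h]
  exact h.unique h.choose_spec.1 ⟨e.inHperp_invβ hρ hs, e.α_invβ ρ hs⟩

theorem α_embed (s : G → E) : e.α (e.embed s) = 0 := by
  funext g Y p
  rw [e.α_gauss_affine ((Real.pi ^ (-((m : ℝ) + n) / 4)) • degZero (s g) p) 0 (fun Y => by
    rw [embed_eq]
    simp [smul_smul, mul_comm])]
  cases p <;> simp

theorem pi_rpow_pos (x : ℝ) : 0 < Real.pi ^ x := Real.rpow_pos_of_pos Real.pi_pos x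

/-- By `eq_gauss_of_α_eq_zero` the section is determined by its degree 0 value at `Y = 0`, which
yields `s` after dividing by the normalising constant. Since `Ad` fixes `0`, equivariance restricts
there. -/
theorem exists_eq_embed {φ : G → M → Forms M E} (hφ : IsSection D ρ φ) (hL : e.FibreL2 φ)
    (h : e.α φ = 0) : ∃ s : G → E, IsSectionX D ρ s ∧ φ = e.embed s := by
  have hc := pi_rpow_pos (-((m : ℝ) + n) / 4)
  set c := Real.pi ^ (-((m : ℝ) + n) / 4)
  refine ⟨fun g => c⁻¹ • φ g 0 0 ![], ⟨?_, fun k g => ?_⟩, ?_⟩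
  · have h1 : ContMDiff 𝓘(ℝ, M) (𝓘(ℝ, M).prod 𝓘(ℝ, M)) ∞ (fun g : G => (g, (0 : M))) :=
      contMDiff_id.prodMk contMDiff_const
    exact (c⁻¹ • ContinuousAlternatingMap.apply ℝ M E ![]).contDiff.contMDiff.comp
      ((hφ.smooth 0).comp h1)
  · have h1 := congrFun (hφ.equivariant k g 0) 0
    rw [map_zero] at h1
    have h2 : actE ((ρ k⁻¹ : E ≃ₗᵢ[ℂ] E) : E →L[ℂ] E) (pull (Ad (D.incl k)) (φ g 0)) 0 ![] =
        ρ k⁻¹ (φ g 0 0 ![]) := by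
      change ρ k⁻¹ (φ g 0 0 (Ad (D.incl k) ∘ ![])) = _
      rw [Subsingleton.elim (Ad (D.incl k) ∘ ![]) ![]]
    rw [h1, h2]
    exact (((ρ k⁻¹ : E ≃ₗᵢ[ℂ] E) : E →L[ℂ] E).restrictScalars ℝ).map_smul c⁻¹ _ |>.symm
  · funext g Y p
    have h1 := e.eq_gauss_of_α_eq_zero (contDiff_fibre (hφ.smooth p) g) (hL g p)
      (fun Y => by rw [h]; rfl) Y
    rw [embed_eq]
    cases p with
    | zero =>
      ext v
      rw [h1.1, Subsingleton.elim v ![]]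
      simp only [Pi.smul_apply, ContinuousAlternatingMap.smul_apply, degZero_zero_apply, smul_smul]
      congr 1
      change _ = c * _ * _
      field_simp
    | succ p => rw [h1.2 (by simp)]; simp

/-- The powers of `π` match because `-(m+n)/2 + (m+n)/4 = -(m+n)/4`. All uses of `P` below go
through this moment criterion. -/
theorem P_gauss_smul [FiniteDimensional ℂ E] {φ : G → M → Forms M E} {s : G → E}
    (h : ∀ g, ∫ y, Real.exp (-D.normSq (e.vec y) / 2) • φ g (e.vec y) 0 ![] =
      (Real.pi ^ (((m : ℝ) + n) / 4)) • s g) : e.P φ = e.embed s := by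
  funext g Y
  rw [P, h, embed, smul_smul]
  congr 2
  rw [mul_right_comm, ← Real.rpow_add Real.pi_pos]
  congr 2
  ring

theorem sqrt_pi_pow (a : ℕ) : √Real.pi ^ a = Real.pi ^ ((a : ℝ) / 2) := by
  rw [Real.sqrt_eq_rpow, ← Real.rpow_natCast, ← Real.rpow_mul Real.pi_pos.le]
  congr 1
  ring

theorem pi_rpow_mul_sqrt_pi_pow :
    Real.pi ^ (-((m : ℝ) + n) / 4) * √Real.pi ^ (m + n) = Real.pi ^ (((m : ℝ) + n) / 4) := by
  rw [sqrt_pi_pow, ← Real.rpow_add Real.pi_pos]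
  congr 1
  push_cast
  ring

theorem P_embed [FiniteDimensional ℂ E] (s : G → E) : e.P (e.embed s) = e.embed s := by
  refine e.P_gauss_smul fun g => ?_
  have h := e.integral_gauss_smul_gauss ((Real.pi ^ (-((m : ℝ) + n) / 4)) • s g)
  rw [smul_smul, mul_comm, pi_rpow_mul_sqrt_pi_pow] at h
  rw [← h]
  refine integral_congr_ae (Filter.Eventually.of_forall fun y => ?_)
  simp only [embed_eq, Pi.smul_apply, ContinuousAlternatingMap.smul_apply, degZero_zero_apply]
  module

end Section
end AdaptedBasis
end
end HypoLap
end

/-! ### Structure constants and the traces of the Casimir element of `𝔨` -/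

noncomputable section
namespace HypoLap
set_option linter.unusedSectionVars false
section
variable {M : Type*} [NormedAddCommGroup M] [NormedSpace ℝ M] [FiniteDimensional ℝ M]
  {G : Type*} [TopologicalSpace G] [ChartedSpace M G] [Group G] [LieGroup 𝓘(ℝ, M) ∞ G]
  {N : Type*} [NormedAddCommGroup N] [NormedSpace ℝ N]
  {K : Type*} [TopologicalSpace K] [ChartedSpace N K] [Group K]
  {E : Type*} [NormedAddCommGroup E] [InnerProductSpace ℂ E]
  {V : Type*} [NormedAddCommGroup V] [NormedSpace ℝ V]

open MeasureTheory

namespace AdaptedBasis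
variable {D : ReductiveData M G N K} {m n : ℕ} (e : AdaptedBasis D m n)

/-! ### Structure constants -/

/-- The structure constants `B([e_a, e_b], e_c)`. -/
def structConst (a b c : Fin m ⊕ Fin n) : ℝ := D.B (D.ad (e.basis a) (e.basis b)) (e.basis c)

theorem structConst_swap_left (a b c : Fin m ⊕ Fin n) :
    e.structConst a b c = -e.structConst b a c := by
  rw [structConst, D.ad_swap, map_neg]; rfl

theorem structConst_swap_right (a b c : Fin m ⊕ Fin n) :
    e.structConst a b c = -e.structConst a c b := by
  rw [structConst, D.B_ad, D.B_symm]; rfl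

/-- Since `θ e_a = -sgn a • e_a`, invariance under `θ` multiplies the constant by `-sgn a sgn b sgn
c`. Thus it vanishes when an odd number of the three vectors lies in `𝔭`. -/
theorem structConst_eq_zero {a b c : Fin m ⊕ Fin n} (h : sgn a * sgn b * sgn c = 1) :
    e.structConst a b c = 0 := by
  have h1 : D.B (D.dθ (D.ad (e.basis a) (e.basis b))) (D.dθ (e.basis c)) = e.structConst a b c :=
    D.B_θ _ _
  rw [D.dθ_ad, e.dθ_basis, e.dθ_basis, e.dθ_basis, ← neg_smul, ← neg_smul, ← neg_smul, D.ad_smul,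
    LinearMap.smul_apply, map_smul, map_smul, map_smul, map_smul] at h1
  simp only [LinearMap.smul_apply, smul_eq_mul] at h1
  change -sgn c * (-sgn a * (-sgn b * e.structConst a b c)) = _ at h1
  linear_combination (-1 / 2) * h1 - (1 / 2) * e.structConst a b c * h

theorem coord_eq (v : M) (c : Fin m ⊕ Fin n) : e.coord c v = sgn c * D.B v (e.basis c) := by
  conv_lhs => rw [← e.sum_B_smul_dual v]
  simp only [map_sum, map_smul, dual_eq, coord_basis, smul_eq_mul, mul_ite, mul_one, mul_zero,
    Finset.sum_ite_eq', Finset.mem_univ, if_true]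
  rw [D.B_symm, mul_comm]

theorem normSq_eq_sum_B (v : M) : D.normSq v = ∑ c, D.B v (e.basis c) ^ 2 := by
  rw [e.normSq_eq]
  refine Finset.sum_congr rfl fun c _ => ?_
  rw [coord_eq, mul_pow, pow_two (sgn c), sgn_mul_self, one_mul]

theorem B_self_eq_sum (v : M) : D.B v v = ∑ c, sgn c * D.B v (e.basis c) ^ 2 := by
  rw [← e.sum_B_dual_mul_B v v]
  refine Finset.sum_congr rfl fun c _ => ?_
  rw [dual_eq, map_smul, LinearMap.smul_apply, D.B_symm _ v, smul_eq_mul]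
  ring

/-- `∑ B([e_j, e_i], e_{i'})²` for `e_j ∈ 𝔨`, `e_i, e_{i'} ∈ 𝔭`. -/
def sumKPP : ℝ :=
  ∑ j : Fin n, ∑ i : Fin m, ∑ i' : Fin m, e.structConst (Sum.inr j) (Sum.inl i) (Sum.inl i') ^ 2

/-- `∑ B([e_j, e_{j'}], e_{j''})²` for `e_j, e_{j'}, e_{j''} ∈ 𝔨`. -/
def sumKKK : ℝ :=
  ∑ j : Fin n, ∑ i : Fin n, ∑ i' : Fin n, e.structConst (Sum.inr j) (Sum.inr i) (Sum.inr i') ^ 2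

theorem structConst_ppp (i i' i'' : Fin m) :
    e.structConst (Sum.inl i) (Sum.inl i') (Sum.inl i'') = 0 :=
  e.structConst_eq_zero (by simp [sgn])

theorem structConst_pkk (i : Fin m) (j j' : Fin n) :
    e.structConst (Sum.inl i) (Sum.inr j) (Sum.inr j') = 0 :=
  e.structConst_eq_zero (by simp [sgn])

theorem structConst_kpk (i : Fin m) (j j' : Fin n) :
    e.structConst (Sum.inr j) (Sum.inl i) (Sum.inr j') = 0 :=
  e.structConst_eq_zero (by simp [sgn])

theorem structConst_kkp (i : Fin m) (j j' : Fin n) :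
    e.structConst (Sum.inr j) (Sum.inr j') (Sum.inl i) = 0 :=
  e.structConst_eq_zero (by simp [sgn])

/-- Only pairs with exactly one of `b, c` in `𝔭` contribute. Their sign is `-1`, and each of the two
orders gives `sumKPP` by antisymmetry. -/
theorem sum_structConst_p : ∑ i : Fin m, ∑ b, ∑ c,
    sgn b * sgn c * e.structConst (Sum.inl i) b c ^ 2 = -(2 * e.sumKPP) := by
  have h1 : ∑ i : Fin m, ∑ b : Fin m, ∑ c : Fin n,
      e.structConst (Sum.inl i) (Sum.inl b) (Sum.inr c) ^ 2 = e.sumKPP := by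
    simp only [sumKPP]
    rw [Finset.sum_comm' (t' := Finset.univ) (s' := fun _ => Finset.univ) (by simp)]
    conv_rhs => rw [Finset.sum_comm]
    rw [Finset.sum_comm]
    refine Finset.sum_congr rfl fun i _ => ?_
    conv_rhs => rw [Finset.sum_comm]
    refine Finset.sum_congr rfl fun b _ => Finset.sum_congr rfl fun c _ => ?_
    rw [structConst_swap_right, structConst_swap_left]
    ring
  have h2 : ∑ i : Fin m, ∑ c : Fin n, ∑ b : Fin m,
      e.structConst (Sum.inl i) (Sum.inr c) (Sum.inl b) ^ 2 = e.sumKPP := by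
    simp only [sumKPP]
    rw [Finset.sum_comm]
    refine Finset.sum_congr rfl fun c _ => Finset.sum_congr rfl fun i _ =>
      Finset.sum_congr rfl fun b _ => ?_
    rw [structConst_swap_left]
    ring
  simp only [Fintype.sum_sum_type, structConst_ppp, structConst_pkk, sgn, Finset.sum_add_distrib,
    one_mul, mul_one, neg_mul, neg_neg, Finset.sum_neg_distrib, h1, h2]
  simp
  ring

theorem sum_structConst_k : ∑ j : Fin n, ∑ b, ∑ c, e.structConst (Sum.inr j) b c ^ 2 =
    e.sumKPP + e.sumKKK := by
  simp [Fintype.sum_sum_type, structConst_kpk, structConst_kkp, Finset.sum_add_distrib, sumKPP,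
    sumKKK]

theorem trace_eq (L : M →ₗ[ℝ] M) :
    LinearMap.trace ℝ M L = ∑ a, sgn a * D.B (L (e.basis a)) (e.basis a) := by
  rw [LinearMap.trace_eq_matrix_trace ℝ e.basis, Matrix.trace]
  refine Finset.sum_congr rfl fun a _ => ?_
  rw [Matrix.diag_apply, LinearMap.toMatrix_apply, ← coord_eq]
  rfl

theorem projP_inl (i : Fin m) : D.projP (e.basis (Sum.inl i)) = e.basis (Sum.inl i) := by
  rw [ReductiveData.projP, LinearMap.smul_apply, LinearMap.sub_apply, e.mem_p, LinearMap.id_apply]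
  module

theorem projP_inr (j : Fin n) : D.projP (e.basis (Sum.inr j)) = 0 := by
  rw [ReductiveData.projP, LinearMap.smul_apply, LinearMap.sub_apply, e.mem_k, LinearMap.id_apply]
  module

theorem projK_inl (i : Fin m) : D.projK (e.basis (Sum.inl i)) = 0 := by
  rw [ReductiveData.projK, LinearMap.smul_apply, LinearMap.add_apply, e.mem_p, LinearMap.id_apply]
  module

theorem projK_inr (j : Fin n) : D.projK (e.basis (Sum.inr j)) = e.basis (Sum.inr j) := by
  rw [ReductiveData.projK, LinearMap.smul_apply, LinearMap.add_apply, e.mem_k, LinearMap.id_apply]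
  module

theorem B_casimirK (a : Fin m ⊕ Fin n) : D.B (e.casimirK (e.basis a)) (e.basis a) =
    -∑ j : Fin n, ∑ c, sgn c * e.structConst (Sum.inr j) a c ^ 2 := by
  simp only [casimirK, LinearMap.sum_apply, LinearMap.comp_apply, map_sum, ← Finset.sum_neg_distrib (s := (Finset.univ : Finset (Fin n)))]
  refine Finset.sum_congr rfl fun j _ => ?_
  rw [D.B_ad, B_self_eq_sum]
  rfl

/-- By invariance, `B(ad(e_j)² v, v) = -B(ad(e_j) v, ad(e_j) v)`. As `ad(e_j)` preserves `𝔭` and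
`𝔨`, the sign of `B` cancels that in the trace formula on each summand, so both traces are minus
sums of squares. -/
theorem traceP_eq : e.traceP = -e.sumKPP := by
  rw [traceP, e.trace_eq, Fintype.sum_sum_type]
  simp only [LinearMap.comp_apply, projP_inl, projP_inr, map_zero, LinearMap.zero_apply, mul_zero,
    Finset.sum_const_zero, add_zero, sgn, one_mul, B_casimirK, Fintype.sum_sum_type, structConst_kpk]
  simp only [ne_eq, OfNat.ofNat_ne_zero, not_false_eq_true, zero_pow, mul_zero, Finset.sum_const_zero,
    add_zero, Finset.sum_neg_distrib, sumKPP]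
  rw [Finset.sum_comm]

theorem traceK_eq : e.traceK = -e.sumKKK := by
  rw [traceK, e.trace_eq, Fintype.sum_sum_type]
  simp only [LinearMap.comp_apply, projK_inl, projK_inr, map_zero, LinearMap.zero_apply, mul_zero,
    Finset.sum_const_zero, zero_add, sgn, one_mul, B_casimirK, Fintype.sum_sum_type, structConst_kkp]
  simp only [ne_eq, OfNat.ofNat_ne_zero, not_false_eq_true, zero_pow, Finset.sum_const_zero,
    zero_add, Finset.sum_neg_distrib, sumKKK, neg_mul, one_mul, neg_neg]
  rw [Finset.sum_comm]

theorem B_ad_projK_projP_vec (y : Fin m ⊕ Fin n → ℝ) (c : Fin m ⊕ Fin n) :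
    D.B (D.ad (D.projK (e.vec y)) (D.projP (e.vec y))) (e.basis c) =
      ∑ t : Fin n × Fin m, y (Sum.inr t.1) * y (Sum.inl t.2) *
        e.structConst (Sum.inr t.1) (Sum.inl t.2) c := by
  have hK : D.projK (e.vec y) = ∑ j : Fin n, y (Sum.inr j) • e.basis (Sum.inr j) := by
    rw [map_vec, Fintype.sum_sum_type]
    simp [projK_inl, projK_inr]
  have hP : D.projP (e.vec y) = ∑ i : Fin m, y (Sum.inl i) • e.basis (Sum.inl i) := by
    rw [map_vec, Fintype.sum_sum_type]
    simp [projP_inl, projP_inr]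
  let adL : M →ₗ[ℝ] M →ₗ[ℝ] M :=
    { toFun := D.ad, map_add' := D.ad_add, map_smul' := D.ad_smul }
  have hL : ∀ u, D.ad u = adL u := fun _ => rfl
  rw [hK, hP, hL, Fintype.sum_prod_type]
  simp only [map_sum, map_smul, LinearMap.sum_apply, LinearMap.smul_apply, smul_eq_mul]
  simp only [Finset.mul_sum]
  rw [Finset.sum_comm]
  refine Finset.sum_congr rfl fun j _ => Finset.sum_congr rfl fun i _ => ?_
  change _ * (_ * e.structConst _ _ _) = _
  ring

theorem sum_structConst_kp : ∑ c, ∑ t : Fin n × Fin m,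
    e.structConst (Sum.inr t.1) (Sum.inl t.2) c ^ 2 = e.sumKPP := by
  rw [Finset.sum_comm, Fintype.sum_prod_type]
  simp [Fintype.sum_sum_type, structConst_kpk, sumKPP]

end AdaptedBasis
end
end HypoLap
end

/-! ### The second application of `β`, its projection, and the comparison with `ℒ^X` -/

noncomputable section
namespace HypoLap
set_option linter.unusedSectionVars false
section
variable {M : Type*} [NormedAddCommGroup M] [NormedSpace ℝ M] [FiniteDimensional ℝ M]
  {G : Type*} [TopologicalSpace G] [ChartedSpace M G] [Group G] [LieGroup 𝓘(ℝ, M) ∞ G]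
  {N : Type*} [NormedAddCommGroup N] [NormedSpace ℝ N]
  {K : Type*} [TopologicalSpace K] [ChartedSpace N K] [Group K]
  {E : Type*} [NormedAddCommGroup E] [InnerProductSpace ℂ E]
  {V : Type*} [NormedAddCommGroup V] [NormedSpace ℝ V]

open MeasureTheory

namespace AdaptedBasis
variable {D : ReductiveData M G N K} {m n : ℕ} (e : AdaptedBasis D m n)
  {ρ : K →* (E ≃ₗᵢ[ℂ] E)} {s : G → E}

theorem contMDiff_numInv_firstOrder [FiniteDimensional ℂ E] (hs : IsSectionX D ρ s) (u : M) (p : ℕ) :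
    ContMDiff 𝓘(ℝ, M) 𝓘(ℝ, M [⋀^Fin p]→L[ℝ] E) ∞
      (fun g => numInv (e.firstOrder ρ (fun h => degZero (s h)) g u) p) := by
  have h1 : ContMDiff 𝓘(ℝ, M) 𝓘(ℝ, ℝ) ∞ (fun _ : G => (1 + (p : ℝ))⁻¹) := contMDiff_const
  exact h1.smul (e.contMDiff_firstOrder_degZero hs u p)

/-- The coefficient of `Y_a Y_b` in `β α⁻¹ β` on the image of the embedding. -/
def secondCoeff (ρ : K →* (E ≃ₗᵢ[ℂ] E)) (s : G → E) (g : G) (a b : Fin m ⊕ Fin n) : Forms M E :=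
  e.firstOrder ρ (fun h => numInv (e.firstOrder ρ (fun h' => degZero (s h')) h (e.basis a))) g
    (e.basis b)

theorem firstOrder_sum_smul {ι : Type*} [Fintype ι] (c : ι → ℝ) {w : ι → G → Forms M E} {g : G}
    (hw : ∀ a p, MDifferentiableAt 𝓘(ℝ, M) 𝓘(ℝ, M [⋀^Fin p]→L[ℝ] E) (fun h => w a h p) g) (u : M) :
    e.firstOrder ρ (fun h => ∑ a, c a • w a h) g u = ∑ a, c a • e.firstOrder ρ (w a) g u := by
  funext p
  have h1 : ∀ a, MDifferentiableAt 𝓘(ℝ, M) 𝓘(ℝ, M [⋀^Fin p]→L[ℝ] E) (fun h => c a • w a h p) g :=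
    fun a => MDifferentiableAt.const_smul (hw a p) (c a)
  have h2 := leftDeriv_sum_fun Finset.univ h1 (D.projP u)
  rw [firstOrder_apply, Finset.sum_apply, map_sum, Finset.sum_apply]
  simp only [Finset.sum_apply, Pi.smul_apply, map_smul, firstOrder_apply, smul_add,
    Finset.sum_add_distrib]
  rw [h2]
  congr 1
  exact Finset.sum_congr rfl fun a _ => leftDeriv_const_smul_fun (hw a p) (c a) _

/-- A finite sum of monomials times the Gaussian, with coefficients independent of `y`: this form
gives square integrability and reduces the projection to moments. -/
theorem β_invβ_vec [FiniteDimensional ℂ E] (hs : IsSectionX D ρ s) (g : G) (y : Fin m ⊕ Fin n → ℝ)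
    (p : ℕ) : e.β ρ (e.invβ ρ s) g (e.vec y) p =
      ∑ t : (Fin m ⊕ Fin n) × (Fin m ⊕ Fin n),
        (([t.1, t.2].map y).prod * Real.exp (-D.normSq (e.vec y) / 2)) •
        (Real.pi ^ (-((m : ℝ) + n) / 4)) • e.secondCoeff ρ s g t.1 t.2 p := by
  have hw : ∀ u p, MDifferentiableAt 𝓘(ℝ, M) 𝓘(ℝ, M [⋀^Fin p]→L[ℝ] E)
      (fun h => numInv (e.firstOrder ρ (fun h => degZero (s h)) h u) p) g := fun u p =>
    (e.contMDiff_numInv_firstOrder hs u p).mdifferentiableAt (by simp)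
  have h1 : e.β ρ (e.invβ ρ s) g (e.vec y) = _ := e.β_smul ρ (fun Y => Real.pi ^ (-((m : ℝ) + n) / 4) * Real.exp (-D.normSq Y / 2))
    (w := fun Y h => numInv (e.firstOrder ρ (fun h => degZero (s h)) h Y)) (g := g) (Y := e.vec y)
    (hw _)
  have h2 : (fun h => numInv (e.firstOrder ρ (fun h => degZero (s h)) h (e.vec y))) =
      fun h => ∑ a, y a • numInv (e.firstOrder ρ (fun h => degZero (s h)) h (e.basis a)) := by
    funext h
    exact e.map_vec (numInv ∘ₗ e.firstOrder ρ (fun h => degZero (s h)) h) y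
  rw [h1, h2, e.firstOrder_sum_smul y (fun a => hw _), Fintype.sum_prod_type]
  simp only [Pi.smul_apply, Finset.sum_apply, map_vec_apply, Finset.smul_sum]
  refine Finset.sum_congr rfl fun a _ => Finset.sum_congr rfl fun b _ => ?_
  simp only [List.map_cons, List.map_nil, List.prod_cons, List.prod_nil, mul_one, secondCoeff]
  module

theorem vartheta_embed_vec (s : G → E) (g : G) (y : Fin m ⊕ Fin n → ℝ) (p : ℕ) :
    vartheta D (e.embed s) g (e.vec y) p =
      ∑ t : (Fin m ⊕ Fin n) × (Fin n × Fin m) × (Fin n × Fin m),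
        (([Sum.inr t.2.1.1, Sum.inl t.2.1.2, Sum.inr t.2.2.1, Sum.inl t.2.2.2].map y).prod *
          Real.exp (-D.normSq (e.vec y) / 2)) •
        (Real.pi ^ (-((m : ℝ) + n) / 4)) •
        (1 / 2 * (e.structConst (Sum.inr t.2.1.1) (Sum.inl t.2.1.2) t.1 *
          e.structConst (Sum.inr t.2.2.1) (Sum.inl t.2.2.2) t.1)) • degZero (M := M) (s g) p := by
  rw [vartheta, e.normSq_eq_sum_B, embed_eq]
  simp only [Pi.smul_apply, smul_smul, ← Finset.sum_smul, B_ad_projK_projP_vec]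
  congr 1
  rw [Fintype.sum_prod_type, mul_right_comm, Finset.mul_sum]
  refine Finset.sum_congr rfl fun c _ => ?_
  rw [pow_two, Finset.sum_mul_sum, Fintype.sum_prod_type (α₁ := Fin n × Fin m),
    Finset.mul_sum]
  refine Finset.sum_congr rfl fun t _ => ?_
  rw [Finset.mul_sum]
  refine Finset.sum_congr rfl fun t' _ => ?_
  simp only [List.map_cons, List.map_nil, List.prod_cons, List.prod_nil, mul_one]
  ring

theorem memLp_sum_list_prod_gauss_smul {τ : Type*} [Fintype τ] (l : τ → List (Fin m ⊕ Fin n))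
    (x : τ → V) : MemLp (fun y : Fin m ⊕ Fin n → ℝ =>
      ∑ t, (((l t).map y).prod * Real.exp (-D.normSq (e.vec y) / 2)) • x t) 2 volume :=
  memLp_finsetSum _ fun t _ => e.memLp_list_prod_gauss_smul (l t) (x t)

theorem fibreL2_vartheta_embed (s : G → E) : e.FibreL2 (vartheta D (e.embed s)) := by
  intro g p
  simp only [vartheta_embed_vec]
  exact e.memLp_sum_list_prod_gauss_smul _ _

theorem fibreL2_β_invβ [FiniteDimensional ℂ E] (hs : IsSectionX D ρ s) :
    e.FibreL2 (e.β ρ (e.invβ ρ s)) := by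
  intro g p
  simp only [e.β_invβ_vec hs]
  exact e.memLp_sum_list_prod_gauss_smul _ _

theorem integral_gauss_smul_sum [CompleteSpace V] {τ : Type*} [Fintype τ]
    (l : τ → List (Fin m ⊕ Fin n)) (x : τ → V) :
    ∫ y, Real.exp (-D.normSq (e.vec y) / 2) •
      ∑ t, (((l t).map y).prod * Real.exp (-D.normSq (e.vec y) / 2)) • x t =
      ∑ t, (∫ y : Fin m ⊕ Fin n → ℝ, ((l t).map y).prod * Real.exp (-∑ i, y i ^ 2)) • x t := by
  simp only [Finset.smul_sum, smul_smul, mul_left_comm (Real.exp (-D.normSq _ / 2)), 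
    exp_mul_exp_normSq]
  rw [integral_finsetSum _ fun t _ => integrable_list_prod_smul (l t) (x t)]
  exact Finset.sum_congr rfl fun t _ => integral_smul_const _ _

/-- The constant is `1/8 = 1/2 · 1/4`: the factor in `ϑ` times the normalised fourth moment of two
distinct coordinates, one in `𝔨` and one in `𝔭`. -/
theorem integral_vartheta_embed [FiniteDimensional ℂ E] (s : G → E) (g : G) :
    ∫ y, Real.exp (-D.normSq (e.vec y) / 2) • vartheta D (e.embed s) g (e.vec y) 0 ![] =
      (Real.pi ^ (((m : ℝ) + n) / 4)) • (1 / 8 * e.sumKPP) • s g := by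
  have h1 : ∀ y, vartheta D (e.embed s) g (e.vec y) 0 ![] = 
      ∑ t : (Fin m ⊕ Fin n) × (Fin n × Fin m) × (Fin n × Fin m),
        (([Sum.inr t.2.1.1, Sum.inl t.2.1.2, Sum.inr t.2.2.1, Sum.inl t.2.2.2].map y).prod *
          Real.exp (-D.normSq (e.vec y) / 2)) •
        (Real.pi ^ (-((m : ℝ) + n) / 4)) •
        (1 / 2 * (e.structConst (Sum.inr t.2.1.1) (Sum.inl t.2.1.2) t.1 *
          e.structConst (Sum.inr t.2.2.1) (Sum.inl t.2.2.2) t.1)) • s g := fun y => by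
    rw [vartheta_embed_vec, ContinuousAlternatingMap.sum_apply]
    rfl
  simp only [h1]
  rw [e.integral_gauss_smul_sum (fun t : (Fin m ⊕ Fin n) × (Fin n × Fin m) × (Fin n × Fin m) =>
    [Sum.inr t.2.1.1, Sum.inl t.2.1.2, Sum.inr t.2.2.1, Sum.inl t.2.2.2])]
  have h2 : ∀ t t' : Fin n × Fin m, ∫ y : Fin m ⊕ Fin n → ℝ,
      ([Sum.inr t.1, Sum.inl t.2, Sum.inr t'.1, Sum.inl t'.2].map y).prod * Real.exp (-∑ i, y i ^ 2) =
      if t = t' then √Real.pi ^ (m + n) / 4 else 0 := by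
    intro t t'
    have h := integral_quartic_mul_exp (ι := Fin m ⊕ Fin n) (a := Sum.inr t.1) (b := Sum.inl t.2)
      (c := Sum.inr t'.1) (d := Sum.inl t'.2) (by simp) (by simp) (by simp)
    simp only [Sum.inr.injEq, Sum.inl.injEq, Fintype.card_sum, Fintype.card_fin, ← Prod.ext_iff] at h
    rw [← h]
    simp only [List.map_cons, List.map_nil, List.prod_cons, List.prod_nil, mul_one, mul_assoc]
  simp only [h2, Fintype.sum_prod_type (f := fun t : (Fin m ⊕ Fin n) × _ => _), smul_smul, ← Finset.sum_smul]
  congr 1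
  rw [← pi_rpow_mul_sqrt_pi_pow, ← sum_structConst_kp, Finset.mul_sum, Finset.mul_sum]
  refine Finset.sum_congr rfl fun c _ => ?_
  rw [Fintype.sum_prod_type (α₁ := Fin n × Fin m), Finset.mul_sum, Finset.mul_sum]
  refine Finset.sum_congr rfl fun t _ => ?_
  simp only [ite_mul, zero_mul, Finset.sum_ite_eq, Finset.mem_univ, if_true]
  ring

/-- The normalised second moments are `δ_{ab}/2`, so only half the trace of the coefficients
survives. -/
theorem integral_β_invβ [FiniteDimensional ℂ E] (hs : IsSectionX D ρ s) (g : G) :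
    ∫ y, Real.exp (-D.normSq (e.vec y) / 2) • e.β ρ (e.invβ ρ s) g (e.vec y) 0 ![] =
      (Real.pi ^ (((m : ℝ) + n) / 4)) • (1 / 2 : ℝ) • ∑ a, e.secondCoeff ρ s g a a 0 ![] := by
  have h1 : ∀ y, e.β ρ (e.invβ ρ s) g (e.vec y) 0 ![] = 
      ∑ t : (Fin m ⊕ Fin n) × (Fin m ⊕ Fin n),
        (([t.1, t.2].map y).prod * Real.exp (-D.normSq (e.vec y) / 2)) •
        (Real.pi ^ (-((m : ℝ) + n) / 4)) • e.secondCoeff ρ s g t.1 t.2 0 ![] := fun y => by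
    rw [e.β_invβ_vec hs, ContinuousAlternatingMap.sum_apply]
    rfl
  simp only [h1]
  rw [e.integral_gauss_smul_sum (fun t : (Fin m ⊕ Fin n) × (Fin m ⊕ Fin n) => [t.1, t.2])]
  have h2 : ∀ a b, ∫ y : Fin m ⊕ Fin n → ℝ, ([a, b].map y).prod * Real.exp (-∑ i, y i ^ 2) =
      if a = b then √Real.pi ^ (m + n) / 2 else 0 := by
    intro a b
    have h := integral_coord_mul_coord_mul_exp a b
    simp only [Fintype.card_sum, Fintype.card_fin] at h
    rw [← h]
    simp only [List.map_cons, List.map_nil, List.prod_cons, List.prod_nil, mul_one]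
  rw [Fintype.sum_prod_type]
  simp only [h2, ite_smul, zero_smul, Finset.sum_ite_eq, Finset.mem_univ, if_true,
    ← pi_rpow_mul_sqrt_pi_pow, Finset.smul_sum]
  refine Finset.sum_congr rfl fun a _ => ?_
  module

theorem leftDeriv_numInv_zero {w : G → Forms M E} {g : G}
    (hw : MDifferentiableAt 𝓘(ℝ, M) 𝓘(ℝ, M [⋀^Fin 0]→L[ℝ] E) (fun h => w h 0) g) (u : M) :
    leftDeriv u (fun h => numInv (w h) 0) g ![] = leftDeriv u (fun h => w h 0 ![]) g := by
  have h1 : ∀ h, numInv (w h) 0 = w h 0 := fun h => by simp [numInv_apply]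
  simp only [h1]
  exact (leftDeriv_clm_comp (ContinuousAlternatingMap.apply ℝ M E ![]) hw u).symm

theorem numInv_two (w : Forms M E) (v : Fin 2 → M) : numInv w 2 v = (1 / 3 : ℝ) • w 2 v := by
  simp only [numInv_apply, ContinuousAlternatingMap.smul_apply]
  congr 1
  norm_num

theorem secondCoeff_zero [FiniteDimensional ℂ E] (hs : IsSectionX D ρ s) (g : G)
    (a b : Fin m ⊕ Fin n) : e.secondCoeff ρ s g a b 0 ![] =
      leftDeriv (D.projP (e.basis b))
        (fun h => e.firstOrder ρ (fun h' => degZero (s h')) h (e.basis a) 0 ![]) g +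
      e.zeroOrder ρ (e.basis b) (numInv (e.firstOrder ρ (fun h' => degZero (s h')) g (e.basis a))) 0 ![] := by
  rw [secondCoeff, firstOrder_apply, ContinuousAlternatingMap.add_apply, leftDeriv_numInv_zero]
  exact (e.contMDiff_firstOrder_degZero hs _ 0).mdifferentiableAt (by simp)

theorem leftDeriv_zero_left (f : G → V) (g : G) : leftDeriv (0 : M) f g = 0 :=
  (leftDerivL f g).map_zero

theorem _root_.HypoLap.ReductiveData.ad_zero (D : ReductiveData M G N K) : D.ad 0 = 0 := by
  have := D.ad_smul 0 (0 : M)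
  rwa [zero_smul, zero_smul] at this

theorem _root_.HypoLap.ReductiveData.dRep_zero (D : ReductiveData M G N K) (ρ : K →* (E ≃ₗᵢ[ℂ] E)) :
    D.dRep ρ 0 = 0 := by
  have := D.dRep_smul ρ (u := (0 : M)) 0 (map_zero _)
  rwa [zero_smul, zero_smul] at this

/-- The constant is `1/6 = 1/2 · 1/3`: the coefficient of the double contraction times `(1 + 2)⁻¹`
from `α⁻¹` in degree 2. Antisymmetry of the structure constants gives the sign. -/
theorem secondCoeff_inl [FiniteDimensional ℂ E]
    (hρ : ContMDiff 𝓘(ℝ, N) 𝓘(ℝ, E →L[ℂ] E) ∞ (fun k : K => ((ρ k : E ≃ₗᵢ[ℂ] E) : E →L[ℂ] E)))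
    (hs : IsSectionX D ρ s) (g : G) (i : Fin m) :
    e.secondCoeff ρ s g (Sum.inl i) (Sum.inl i) 0 ![] =
      leftDeriv (e.basis (Sum.inl i)) (leftDeriv (e.basis (Sum.inl i)) s) g -
      (1 / 6 * ∑ b, ∑ c, sgn b * sgn c * e.structConst (Sum.inl i) b c ^ 2) • s g := by
  rw [e.secondCoeff_zero hs, zeroOrder_zero]
  simp only [e.firstOrder_degZero_zero hρ hs, projP_inl, projK_inl, leftDeriv_zero_left, D.dRep_zero, D.ad_zero, smul_zero, add_zero,
    sub_zero, map_zero, LinearMap.zero_apply, zero_apply, zero_smul, Finset.sum_const_zero, numInv_two,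
    firstOrder_degZero_two]
  change leftDeriv (e.basis (Sum.inl i)) (leftDeriv (e.basis (Sum.inl i)) s) g + _ = _ 
  rw [sub_eq_add_neg]
  congr 1
  simp only [mul_zero, zero_smul, sub_zero, smul_neg, smul_smul, ← Finset.sum_smul, Finset.sum_neg_distrib, neg_neg]
  rw [← neg_smul]
  congr 1
  rw [Finset.mul_sum, Finset.mul_sum, ← Finset.sum_neg_distrib]
  refine Finset.sum_congr rfl fun b _ => ?_
  rw [Finset.mul_sum, Finset.mul_sum, ← Finset.sum_neg_distrib]
  refine Finset.sum_congr rfl fun c _ => ?_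
  simp only [dual_eq, map_smul, LinearMap.smul_apply, smul_eq_mul]
  change _ * (_ * (_ * e.structConst (Sum.inl i) b c) * (_ * e.structConst (Sum.inl i) c b)) = _
  rw [e.structConst_swap_right _ c b]
  ring

theorem B_dθ_basis (v : M) (c : Fin m ⊕ Fin n) :
    D.B (D.dθ v) (e.basis c) = -(sgn c * D.B v (e.basis c)) := by
  have h : D.B (D.dθ (D.dθ v)) (D.dθ (e.basis c)) = D.B (D.dθ v) (e.basis c) := D.B_θ _ _
  rw [← h, D.dθ_dθ, dθ_basis, map_neg, map_smul, smul_eq_mul]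

/-- The constant is `1/24 = 1/4 · 1/3 · 1/2`. Two factors `i` and one antisymmetry give the plus
sign, and the two occurrences of `θ` cancel the signs of the dual basis, so the sum is unsigned. -/
theorem secondCoeff_inr [FiniteDimensional ℂ E]
    (hρ : ContMDiff 𝓘(ℝ, N) 𝓘(ℝ, E →L[ℂ] E) ∞ (fun k : K => ((ρ k : E ≃ₗᵢ[ℂ] E) : E →L[ℂ] E)))
    (hs : IsSectionX D ρ s) (g : G) (j : Fin n) :
    e.secondCoeff ρ s g (Sum.inr j) (Sum.inr j) 0 ![] =
      -leftDeriv (e.basis (Sum.inr j)) (leftDeriv (e.basis (Sum.inr j)) s) g +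
      (1 / 24 * ∑ b, ∑ c, e.structConst (Sum.inr j) b c ^ 2) • s g := by
  have h0 : ∀ h, e.firstOrder ρ (fun h' => degZero (s h')) h (e.basis (Sum.inr j)) 0 ![] =
      Complex.I • leftDeriv (e.basis (Sum.inr j)) s h := fun h => by
    rw [e.firstOrder_degZero_zero hρ hs, projP_inr, projK_inr, leftDeriv_zero_left, zero_add]
  have h1 : -(Complex.I • D.dRep ρ (e.basis (Sum.inr j))
      (Complex.I • leftDeriv (e.basis (Sum.inr j)) s g)) =
      -leftDeriv (e.basis (Sum.inr j)) (leftDeriv (e.basis (Sum.inr j)) s) g := by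
    -- The derivative of `s` along `e_j` need not be a section, so `dRep_section` is applied to `s`
    -- and differentiated, `ρ^E(e_j)` being a constant endomorphism of `E`.
    have h2 := leftDeriv_clm_comp ((D.dRep ρ (e.basis (Sum.inr j))).restrictScalars ℝ)
      (hs.smooth.mdifferentiableAt (x := g) (by simp)) (e.basis (Sum.inr j))
    have h3 : (fun h => (D.dRep ρ (e.basis (Sum.inr j))).restrictScalars ℝ (s h)) =
        fun h => (-1 : ℝ) • leftDeriv (e.basis (Sum.inr j)) s h := by
      funext h
      rw [neg_one_smul]
      exact D.dRep_section hρ hs (e.mem_k j) h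
    have h4 := leftDeriv_const_smul_fun ((contMDiff_leftDeriv hs.smooth
      (e.basis (Sum.inr j))).mdifferentiableAt (x := g) (by simp)) (-1) (e.basis (Sum.inr j))
    rw [h3, h4, neg_one_smul] at h2
    rw [map_smul, smul_smul, Complex.I_mul_I, neg_one_smul, neg_neg]
    exact h2.symm
  have h5 : numInv (e.firstOrder ρ (fun h' => degZero (s h')) g (e.basis (Sum.inr j))) 0 ![] =
      Complex.I • leftDeriv (e.basis (Sum.inr j)) s g := by
    rw [← h0, numInv_apply]
    simp
  have h6 : ∀ v w, D.B (D.ad 0 v) w = 0 := fun v w => by simp [D.ad_zero]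
  rw [e.secondCoeff_zero hs, zeroOrder_zero, h5]
  simp only [projP_inr, projK_inr, leftDeriv_zero_left, h6, zero_smul, Finset.sum_const_zero, smul_zero,
    neg_zero, zero_sub, zero_add, numInv_two, firstOrder_degZero_two]
  rw [sub_eq_add_neg, h1, add_comm]
  congr 1
  have h7 : ∀ (r t : ℝ), r • (1 / 3 : ℝ) • -((1 / 2 * t) • Complex.I • s g) =
      (-(1 / 6) * (r * t)) • Complex.I • s g := fun r t => by module
  simp only [h7, ← Finset.sum_smul, smul_smul]
  rw [← neg_smul, smul_comm, smul_smul]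
  have h8 : -Complex.I * Complex.I = 1 := by simp
  rw [h8, one_smul]
  congr 1
  rw [Finset.mul_sum, Finset.mul_sum]
  refine Finset.sum_congr rfl fun b _ => ?_
  rw [Finset.mul_sum, Finset.mul_sum]
  refine Finset.sum_congr rfl fun c _ => ?_
  simp only [dual_eq, map_smul, LinearMap.smul_apply, smul_eq_mul, B_dθ_basis]
  change _ * (_ * (_ * (_ * -(_ * e.structConst (Sum.inr j) b c)) *
    -(_ * e.structConst (Sum.inr j) c b))) = _
  rw [e.structConst_swap_right _ c b]
  linear_combination (1 / 24 * e.structConst (Sum.inr j) b c ^ 2) *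
    ((sgn c * sgn c) * sgn_mul_self b + sgn_mul_self c)

/-- The coefficient of `sumKPP` is `1/8 - 1/6 - 1/48 = -1/16`, from `ϑ`, `𝔭` and `𝔨` respectively,
and that of `sumKKK` is `-1/48`. The second order terms form `½ C^𝔤`. -/
theorem LX_eq [FiniteDimensional ℂ E]
    (hρ : ContMDiff 𝓘(ℝ, N) 𝓘(ℝ, E →L[ℂ] E) ∞ (fun k : K => ((ρ k : E ≃ₗᵢ[ℂ] E) : E →L[ℂ] E)))
    (hs : IsSectionX D ρ s) (g : G) :
    (1 / 8 * e.sumKPP) • s g - (1 / 2 : ℝ) • ∑ a, e.secondCoeff ρ s g a a 0 ![] = e.LX s g := by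
  have h1 : e.LX s g = (1 / 2 : ℝ) •
      (-(∑ i : Fin m, leftDeriv (e.basis (Sum.inl i)) (leftDeriv (e.basis (Sum.inl i)) s) g) +
      ∑ j : Fin n, leftDeriv (e.basis (Sum.inr j)) (leftDeriv (e.basis (Sum.inr j)) s) g) +
      (1 / 16 * e.traceP + 1 / 48 * e.traceK) • s g := by
    simp [LX, casimir]
  rw [h1, e.traceP_eq, e.traceK_eq, Fintype.sum_sum_type]
  simp only [e.secondCoeff_inl hρ hs, e.secondCoeff_inr hρ hs, Finset.sum_sub_distrib,
    Finset.sum_add_distrib, Finset.sum_neg_distrib, ← Finset.sum_smul, ← Finset.mul_sum,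
    sum_structConst_p, sum_structConst_k]
  module

theorem P_secondOrder_embed [FiniteDimensional ℂ E]
    (hρ : ContMDiff 𝓘(ℝ, N) 𝓘(ℝ, E →L[ℂ] E) ∞ (fun k : K => ((ρ k : E ≃ₗᵢ[ℂ] E) : E →L[ℂ] E)))
    (hs : IsSectionX D ρ s) :
    e.FibreL2 (e.secondOrder ρ (e.embed s)) ∧ e.P (e.secondOrder ρ (e.embed s)) = e.embed (e.LX s) := by
  have hϑ := e.fibreL2_vartheta_embed s
  have hβ := e.fibreL2_β_invβ (ρ := ρ) hs
  rw [secondOrder, e.αInv_β_embed hρ hs]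
  refine ⟨fun g p => (hϑ g p).sub (hβ g p), e.P_gauss_smul fun g => ?_⟩
  have h1 := integral_sub (e.integrable_gauss_smul (e.memLp_degree_zero hϑ g))
    (e.integrable_gauss_smul (e.memLp_degree_zero hβ g))
  rw [e.integral_vartheta_embed, e.integral_β_invβ hs, ← smul_sub, e.LX_eq hρ hs] at h1
  rw [← h1]
  refine integral_congr_ae (Filter.Eventually.of_forall fun y => ?_)
  exact smul_sub _ _ _

end AdaptedBasis
end
end HypoLap
end

/-! ### The theorem -/

theorem theorem2p16p1
    {M : Type*} [NormedAddCommGroup M] [NormedSpace ℝ M] [FiniteDimensional ℝ M]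
    {G : Type*} [TopologicalSpace G] [ChartedSpace M G] [Group G] [LieGroup 𝓘(ℝ, M) ∞ G]
    {N : Type*} [NormedAddCommGroup N] [NormedSpace ℝ N] [FiniteDimensional ℝ N]
    {K : Type*} [TopologicalSpace K] [ChartedSpace N K] [Group K] [LieGroup 𝓘(ℝ, N) ∞ K]
    {E : Type*} [NormedAddCommGroup E] [InnerProductSpace ℂ E] [FiniteDimensional ℂ E]
    (D : HypoLap.ReductiveData M G N K)
    (ρ : K →* (E ≃ₗᵢ[ℂ] E))
    (hρ : ContMDiff 𝓘(ℝ, N) 𝓘(ℝ, E →L[ℂ] E) ∞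
      (fun k : K => ((ρ k : E ≃ₗᵢ[ℂ] E) : E →L[ℂ] E)))
    {m n : ℕ} (e : HypoLap.AdaptedBasis D m n) :
    -- `H = e^{-|Y|²/2} ⊗ F` is the fibrewise kernel of `α`
    (∀ φ : G → M → HypoLap.Forms M E, HypoLap.IsSection D ρ φ → e.FibreL2 φ →
      (e.α φ = 0 ↔ ∃ s : G → E, HypoLap.IsSectionX D ρ s ∧ φ = e.embed s)) ∧
    ∀ s : G → E, HypoLap.IsSectionX D ρ s →
      e.P (e.embed s) = e.embed s ∧
      -- `β` maps `H` to `H^⊥`, on which `α` is invertible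
      e.InHperp ρ (e.β ρ (e.embed s)) ∧
      (∃! v, e.InHperp ρ v ∧ e.α v = e.β ρ (e.embed s)) ∧
      -- `P (ϑ - β α⁻¹ β) P = ℒ^X`
      e.FibreL2 (e.secondOrder ρ (e.embed s)) ∧
      e.P (e.secondOrder ρ (e.P (e.embed s))) = e.embed (e.LX s) := by
  refine ⟨fun φ hφ hL => ⟨fun h => e.exists_eq_embed hφ hL h, ?_⟩, fun s hs =>
    ⟨e.P_embed s, e.inHperp_β_embed hρ hs, e.existsUnique_α_eq_β_embed hρ hs,
      (e.P_secondOrder_embed hρ hs).1, ?_⟩⟩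
  · rintro ⟨s, _, rfl⟩
    exact e.α_embed s
  · rw [e.P_embed s]
    exact (e.P_secondOrder_embed hρ hs).2
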